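/- Let $k$ be a field, $K$ a commutative $k$-algebra, $R$ an associative unital $K$-algebra and $M$ an $R$-bimodule over $K$ (the left and right $K$-actions on $M$ agree). Write $C^*(R/K,M)$, with $C^q(R/K,M)=\mathrm{Hom}_K(R^{\otimes_K q},M)$, for the Hochschild cochain complex of $R$ over $K$, and $H^*(R/K,M)$ for its cohomology. Let $K^{**}(K,R,M)$ be the bicomplex ($p,q\ge 0$, tensor products and Hom over $k$) $$K^{pq}(K,R,M)=\mathrm{Hom}_k(K^{\otimes pq}\otimes R^{\otimes q},M).$$ For $f\in K^{pq}$, written as a function $f(a,r)$ of a $p\times q$ matrix $a=(a_{ij})$ over $K$ and of $r=(r_1,\dots,r_q)\in R^q$, the horizontal differential $d:K^{pq}\to K^{p+1,q}$ is, for a matrix with rows $a_0,\dots,a_p\in K^q$, $$df(a_0,\dots,a_p,r)=\Big(\prod_{j}a_{0j}\Big)f(a_1,\dots,a_p,r)+\sum_{0\le i<p}(-1)^{i+1}f(a_0,\dots,a_ia_{i+1},\dots,a_p,r)+(-1)^{p+1}f(a_0,\dots,a_{p-1},a_pr)$$ (products of rows and $a_pr$ are taken entrywise), and the vertical differential $\delta:K^{pq}\to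 K^{p,q+1}$ is, for columns $x_j=(a_{1j},\dots,a_{pj},r_j)$, $0\le j\le q$, $$\delta f(x_0,\dots,x_q)=(-1)^p\Big[\Big(\prod_i a_{i0}\Big)r_0f(x_1,\dots,x_q)+\sum_{0\le j<q}(-1)^{j+1}f(x_0,\dots,x_jx_{j+1},\dots,x_q)+(-1)^{q+1}f(x_0,\dots,x_{q-1})\Big(\prod_i a_{iq}\Big)r_q\Big]$$ (products of columns are taken entrywise). Let $H^*(K,R,M)$ be the cohomology of its total complex. The kernel of $d:K^{0q}\to K^{1q}$ is $C^q(R/K,M)$, and the inclusion into the column $p=0$ induces homomorphisms $\alpha^n:H^n(R/K,M)\to H^n(K,R,M)$, $n\ge 0$. Shukla cohomology is defined by $\mathrm{Shukla}^n(R/K,M)=H^n(R^c_*,M)$. Here $R^c_*\to R$ is a cofibrant replacement in the category of non-negatively graded chain $K$-algebras: weak equivalences are the morphisms inducing an isomorphism in homology, fibrations are the morphisms surjective in all positive degrees, and a chain algebra is cofibrant if the map to it from the initial object $K$ has the left lifting property with respect to the fibrations that are weak equivalences. Moreover $H^*(R^c_*,M)$ is the cohomology of the total complex of the Hochschild cochains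 $\mathrm{Hom}_K((R^c_*)^{\otimes_K q},M)$, with $M$ in degree $0$ and $R^c_*$ acting on it through $R^c_*\to R$. Then the following hold. 1. $\alpha^0$ and $\alpha^1$ are isomorphisms, and $\alpha^2$ is a monomorphism. 2. If $R$ is projective as a $K$-module, then $\alpha^n$ is an isomorphism for all $n\ge 0$. 3. Every $R$ has a cofibrant replacement, and there are canonical isomorphisms of $K$-modules $\theta:H^n(K,R,M)\cong\mathrm{Shukla}^n(R/K,M)$ for all $n\ge 0$ and every choice of the cofibrant replacement. Canonical means: $\theta\circ\alpha^n$ is the natural map $H^n(R/K,M)\to\mathrm{Shukla}^n(R/K,M)$ induced by $R^c_*\to R$; and $\theta$ is natural with respect to all triples consisting of a $K$-algebra homomorphism $\varphi:R\to R'$, a $K$-linear map $g:M'\to M$ with $g(\varphi(r)m')=r\,g(m')$ and $g(m'\varphi(r))=g(m')\,r$, and a morphism $R^c_*\to R'^c_*$ of the cofibrant replacements over $\varphi$. -/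

import Mathlib

open CategoryTheory

universe u

/-- `f` is (the underlying function of) a `k`-multilinear map, that is, a `k`-linear map on the
tensor power of `V` over `k` indexed by `ι`. -/
def IsMultilin (k : Type*) [CommRing k] {ι V M : Type*} [AddCommGroup V] [Module k V]
    [AddCommGroup M] [Module k M] (f : (ι → V) → M) : Prop :=
  ∃ g : MultilinearMap k (fun _ : ι => V) M, ∀ x, g x = f x

section Multilin

variable {k ι V M : Type*} [CommRing k] [AddCommGroup V] [Module k V] [AddCommGroup M] [Module k M]

theorem isMultilin_iff [hdec : DecidableEq ι] {f : (ι → V) → M} :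
    IsMultilin k f ↔ ∀ x i, ∃ l : V →ₗ[k] M, ∀ v, f (Function.update x i v) = l v := by
  constructor
  · rintro ⟨g, hg⟩ x i
    exact ⟨g.toLinearMap x i, fun v => by simp [← hg]⟩
  · intro h
    refine ⟨⟨f, ?_, ?_⟩, fun _ => rfl⟩
    · intro hd x i v w
      obtain rfl : hd = hdec := Subsingleton.elim _ _
      obtain ⟨l, hl⟩ := h x i
      simp [hl]
    · intro hd x i c v
      obtain rfl : hd = hdec := Subsingleton.elim _ _
      obtain ⟨l, hl⟩ := h x i
      simp [hl]

theorem IsMultilin.zero : IsMultilin k (fun _ : ι → V => (0 : M)) := ⟨0, fun _ => rfl⟩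

theorem IsMultilin.add {f g : (ι → V) → M} (hf : IsMultilin k f) (hg : IsMultilin k g) :
    IsMultilin k (fun x => f x + g x) := by
  obtain ⟨f', hf⟩ := hf
  obtain ⟨g', hg⟩ := hg
  exact ⟨f' + g', fun x => by simp [hf, hg]⟩

theorem IsMultilin.sum {J : Type*} {s : Finset J} {f : J → (ι → V) → M}
    (hf : ∀ j, IsMultilin k (f j)) : IsMultilin k (fun x => ∑ j ∈ s, f j x) := by
  choose g hg using hf
  exact ⟨∑ j ∈ s, g j, fun x => by simp [hg]⟩

theorem IsMultilin.comp {M' : Type*} [AddCommGroup M'] [Module k M'] {f : (ι → V) → M}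
    (hf : IsMultilin k f) (l : M →ₗ[k] M') : IsMultilin k (fun x => l (f x)) := by
  obtain ⟨g, hg⟩ := hf
  exact ⟨l.compMultilinearMap g, fun x => by simp [hg]⟩

theorem IsMultilin.comp_linear {V' : Type*} [AddCommGroup V'] [Module k V'] {f : (ι → V) → M}
    (hf : IsMultilin k f) (l : ι → V' →ₗ[k] V) : IsMultilin k (fun x => f (fun i => l i (x i))) := by
  obtain ⟨g, hg⟩ := hf
  exact ⟨g.compLinearMap l, fun x => by simp [hg]⟩

theorem IsMultilin.zsmul {f : (ι → V) → M} (hf : IsMultilin k f) (c : ℤ) :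
    IsMultilin k (fun x => c • f x) := by
  obtain ⟨g, hg⟩ := hf
  exact ⟨c • g, fun x => by simp [hg]⟩

theorem IsMultilin.smul {K : Type*} [CommRing K] [Module K M] [SMulCommClass k K M]
    {f : (ι → V) → M} (hf : IsMultilin k f) (c : K) : IsMultilin k (fun x => c • f x) := by
  obtain ⟨g, hg⟩ := hf
  exact ⟨c • g, fun x => by simp [hg]⟩

theorem IsMultilin.of_isEmpty [IsEmpty ι] (f : (ι → V) → M) : IsMultilin k f := by
  classical
  exact isMultilin_iff.2 fun _ i => isEmptyElim i

theorem IsMultilin.restrictScalars {K : Type*} [CommRing K] [Algebra k K] [Module K V]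
    [Module K M] [IsScalarTower k K V] [IsScalarTower k K M] {f : (ι → V) → M}
    (hf : IsMultilin K f) : IsMultilin k f := by
  obtain ⟨g, hg⟩ := hf
  exact ⟨g.restrictScalars k, hg⟩

end Multilin

section Hoch

variable {K : Type*} [CommRing K]

/-- The Hochschild coboundary of functions `f : S ^ n → N`, where `S` acts on `N` from the left
through `L` and from the right through `Rt`:
`(b f)(x₀, …, xₙ) = x₀ f(x₁, …, xₙ) + ∑ (-1)^(i+1) f(…, xᵢ xᵢ₊₁, …) + (-1)^(n+1) f(x₀, …, xₙ₋₁) xₙ`. -/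
def hochB {S N : Type*} [Mul S] [AddCommGroup N] [Module K N] (L Rt : S → Module.End K N) (n : ℕ) :
    ((Fin n → S) → N) →ₗ[K] ((Fin (n + 1) → S) → N) where
  toFun f x := L (x 0) (f fun j => x j.succ)
    + ∑ i : Fin n, (-1 : ℤ) ^ ((i : ℕ) + 1) • f (Fin.contractNth i.castSucc (· * ·) x)
    + (-1 : ℤ) ^ (n + 1) • Rt (x (Fin.last n)) (f fun j => x j.castSucc)
  map_add' f g := by
    ext x
    simp only [Pi.add_apply, map_add, smul_add, Finset.sum_add_distrib]
    abel
  map_smul' c f := by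
    ext x
    simp only [Pi.smul_apply, map_smul, RingHom.id_apply, smul_add, Finset.smul_sum]
    congr 1
    · congr 1
      exact Finset.sum_congr rfl fun i _ => smul_comm _ _ _
    · exact smul_comm _ _ _

theorem hochB_apply {S N : Type*} [Mul S] [AddCommGroup N] [Module K N]
    (L Rt : S → Module.End K N) (n : ℕ) (f : (Fin n → S) → N) (x : Fin (n + 1) → S) :
    hochB L Rt n f x = L (x 0) (f fun j => x j.succ)
    + ∑ i : Fin n, (-1 : ℤ) ^ ((i : ℕ) + 1) • f (Fin.contractNth i.castSucc (· * ·) x)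
    + (-1 : ℤ) ^ (n + 1) • Rt (x (Fin.last n)) (f fun j => x j.castSucc) := rfl

theorem contractNth_succ {S : Type*} {n : ℕ} (op : S → S → S) (i : Fin (n + 1))
    (x : Fin (n + 2) → S) (k : Fin n) :
    Fin.contractNth i.succ op x k.succ = Fin.contractNth i op (fun j => x j.succ) k := by
  simp [Fin.contractNth, Fin.castSucc_succ]

theorem prod_contractNth {C : Type*} [CommMonoid C] {n : ℕ} (i : Fin n) (x : Fin (n + 1) → C) :
    ∏ j, Fin.contractNth i.castSucc (· * ·) x j = ∏ j, x j := by
  induction n with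
  | zero => exact i.elim0
  | succ n ih =>
    refine Fin.cases ?_ (fun i => ?_) i
    · rw [Fin.prod_univ_succ, Fin.prod_univ_succ x, Fin.prod_univ_succ fun j => x (Fin.succ j)]
      simp [Fin.contractNth, mul_assoc]
    · rw [Fin.prod_univ_succ, Fin.prod_univ_succ x, ← ih i fun j => x j.succ]
      congr 1
      exact Finset.prod_congr rfl fun k _ => contractNth_succ _ i.castSucc _ _

/-- Weighted pullbacks commute with the Hochschild coboundary. -/
theorem hochB_pull {S S' N N' : Type*} [Mul S] [Mul S'] [AddCommGroup N] [Module K N]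
    [AddCommGroup N'] [Module K N']
    {L Rt : S → Module.End K N} {L' Rt' : S' → Module.End K N'}
    (φ : S' → S) (c : S' → K) (T : N →ₗ[K] N')
    (hφ : ∀ s t, φ (s * t) = φ s * φ t) (hc : ∀ s t, c (s * t) = c s * c t)
    (hL : ∀ s m, c s • T (L (φ s) m) = L' s (T m))
    (hR : ∀ s m, c s • T (Rt (φ s) m) = Rt' s (T m))
    (n : ℕ) (f : (Fin n → S) → N) (x : Fin (n + 1) → S') :
    hochB L' Rt' n (fun y => (∏ i, c (y i)) • T (f fun i => φ (y i))) x =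
      (∏ i, c (x i)) • T (hochB L Rt n f fun i => φ (x i)) := by
  have h1 : ∀ i : Fin n, (∏ j, c (Fin.contractNth i.castSucc (· * ·) x j)) = ∏ j, c (x j) := by
    intro i
    have := Fin.comp_contractNth (· * ·) (· * ·) hc i.castSucc x
    rw [← prod_contractNth i fun j => c (x j)]
    exact Finset.prod_congr rfl fun j _ => congrFun this j
  have h2 : ∀ i : Fin n, (fun j => φ (Fin.contractNth i.castSucc (· * ·) x j)) =
      Fin.contractNth i.castSucc (· * ·) (fun j => φ (x j)) := by
    intro i
    exact Fin.comp_contractNth (· * ·) (· * ·) hφ i.castSucc x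
  simp only [hochB_apply, h1, h2, map_add, map_sum, map_zsmul, smul_add, Finset.smul_sum, map_smul,
    ← hL, ← hR]
  congr 1
  · congr 1
    · rw [Fin.prod_univ_succ, mul_comm, mul_smul]
    · exact Finset.sum_congr rfl fun i _ => smul_comm _ _ _
  · rw [Fin.prod_univ_castSucc, mul_smul, smul_comm _ ((-1 : ℤ) ^ (n + 1)),
      smul_comm _ ((-1 : ℤ) ^ (n + 1))]

/-- Unweighted case of `hochB_pull`. -/
theorem hochB_pull' {S S' N N' : Type*} [Mul S] [Mul S'] [AddCommGroup N] [Module K N]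
    [AddCommGroup N'] [Module K N']
    {L Rt : S → Module.End K N} {L' Rt' : S' → Module.End K N'}
    (φ : S' → S) (T : N →ₗ[K] N')
    (hφ : ∀ s t, φ (s * t) = φ s * φ t)
    (hL : ∀ s m, T (L (φ s) m) = L' s (T m))
    (hR : ∀ s m, T (Rt (φ s) m) = Rt' s (T m))
    (n : ℕ) (f : (Fin n → S) → N) (x : Fin (n + 1) → S') :
    hochB L' Rt' n (fun y => T (f fun i => φ (y i))) x =
      T (hochB L Rt n f fun i => φ (x i)) := by
  simpa using hochB_pull (L := L) (Rt := Rt) (L' := L') (Rt' := Rt') φ (fun _ => 1) T hφ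
    (by simp) (by simpa using hL) (by simpa using hR) n f x

/-- The recursive form of the Hochschild coboundary. -/
theorem hochB_succ {S N : Type*} [Mul S] [AddCommGroup N] [Module K N]
    (L Rt : S → Module.End K N) (n : ℕ) (f : (Fin (n + 1) → S) → N) (s : S)
    (y : Fin (n + 1) → S) :
    hochB L Rt (n + 1) f (Fin.cons s y) = L s (f y) -
      hochB (N := S → N) (fun t => LinearMap.funLeft K N (fun r => r * t))
        (fun t => LinearMap.compLeft (Rt t) S) n (fun z r => f (Fin.cons r z)) y s := by
  have h0 : Fin.contractNth (Fin.castSucc (0 : Fin (n + 1))) (· * ·) (Fin.cons s y : Fin (n + 2) → S)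
      = Fin.cons (s * y 0) fun j => y j.succ := by
    funext j
    refine Fin.cases ?_ (fun j => ?_) j
    · simp [Fin.contractNth]
    · simp [Fin.contractNth]
  have h1 : ∀ i : Fin n, Fin.contractNth i.succ.castSucc (· * ·) (Fin.cons s y : Fin (n + 2) → S)
      = Fin.cons s (Fin.contractNth i.castSucc (· * ·) y) := by
    intro i
    funext j
    refine Fin.cases ?_ (fun j => ?_) j
    · simp [Fin.contractNth]
    · rw [Fin.castSucc_succ, contractNth_succ]
      simp
  have h2 : (fun j : Fin (n + 1) => (Fin.cons s y : Fin (n + 2) → S) j.castSucc) =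
      Fin.cons s fun j => y j.castSucc := by
    funext j
    refine Fin.cases ?_ (fun j => ?_) j
    · simp
    · rw [← Fin.succ_castSucc]; simp
  rw [hochB_apply, hochB_apply, Fin.sum_univ_succ, h0, h2]
  simp only [h1, Fin.cons_zero, Fin.cons_succ, Pi.add_apply, Finset.sum_apply, Pi.smul_apply,
    LinearMap.funLeft_apply, LinearMap.compLeft_apply, Function.comp_apply, ← Fin.succ_last]
  simp only [Fin.val_zero, zero_add, neg_smul, Fin.val_succ, pow_succ (-1 : ℤ),
    mul_neg, mul_one, neg_neg, Finset.sum_neg_distrib]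
  abel

theorem hochB_hochB {S N : Type u} [Semigroup S] [AddCommGroup N] [Module K N]
    {L Rt : S → Module.End K N} (hL : ∀ s t m, L (s * t) m = L s (L t m))
    (hR : ∀ s t m, Rt (s * t) m = Rt t (Rt s m)) (hLR : ∀ s t m, L s (Rt t m) = Rt t (L s m))
    (n : ℕ) (f : (Fin n → S) → N) : hochB L Rt (n + 1) (hochB L Rt n f) = 0 := by
  induction n generalizing N with
  | zero =>
    funext x
    have h : Fin.contractNth (Fin.castSucc (0 : Fin 1)) (· * ·) x = fun _ => x 0 * x 1 := by
      funext j
      fin_cases j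
      simp [Fin.contractNth]
    have e : ∀ g : Fin 0 → S, f g = f default := fun g => congrArg f (Subsingleton.elim _ _)
    simp only [hochB_apply, Fin.sum_univ_succ, Fin.sum_univ_zero, h, e, Pi.zero_apply]
    simp [hL, hR, hLR]
    abel
  | succ n ih =>
    funext x
    rw [← Fin.cons_self_tail x]
    generalize x 0 = s
    generalize Fin.tail x = y
    rw [hochB_succ]
    have e : (fun (z : Fin (n + 1) → S) (r : S) => hochB L Rt (n + 1) f (Fin.cons r z)) =
        (fun z => (LinearMap.pi L : N →ₗ[K] (S → N)) (f z)) -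
        hochB (N := S → N) (fun t => LinearMap.funLeft K N (fun r => r * t))
          (fun t => LinearMap.compLeft (Rt t) S) n (fun z r => f (Fin.cons r z)) := by
      funext z r
      rw [hochB_succ]
      rfl
    rw [e, map_sub, ih]
    · have := hochB_pull' (L := L) (Rt := Rt)
        (L' := (fun t => LinearMap.funLeft K N (fun r => r * t)))
        (Rt' := (fun t => LinearMap.compLeft (Rt t) S)) id (LinearMap.pi L) (fun _ _ => rfl)
        (fun s m => by ext r; simp [hL]) (fun s m => by ext r; simp [hLR]) (n + 1) f y
      simp only [id] at this
      simp [this]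
    · intro s t m; ext r; simp [LinearMap.funLeft_apply, mul_assoc]
    · intro s t m; ext r; simp [hR]
    · intro s t m; ext r; simp [LinearMap.funLeft_apply]

theorem contractNth_update {S : Type*} {n : ℕ} (op : S → S → S) (l : Fin n) (x : Fin (n + 1) → S)
    (i : Fin (n + 1)) :
    (∃ t, ∀ s, Fin.contractNth l.castSucc op (Function.update x i s) =
      Function.update (Fin.contractNth l.castSucc op x) t s) ∨
    (∃ t w, ∀ s, Fin.contractNth l.castSucc op (Function.update x i s) =
      Function.update (Fin.contractNth l.castSucc op x) t (op s w)) ∨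
    (∃ t w, ∀ s, Fin.contractNth l.castSucc op (Function.update x i s) =
      Function.update (Fin.contractNth l.castSucc op x) t (op w s)) := by
  rcases lt_trichotomy (i : ℕ) l with h | h | h
  · refine Or.inl ⟨⟨i, by omega⟩, fun s => funext fun j => ?_⟩
    simp only [Fin.contractNth, Function.update_apply, Fin.ext_iff, Fin.val_castSucc, Fin.val_succ]
    split_ifs <;> first | rfl | omega
  · refine Or.inr (Or.inl ⟨l, x l.succ, fun s => funext fun j => ?_⟩)
    simp only [Fin.contractNth, Function.update_apply, Fin.ext_iff, Fin.val_castSucc, Fin.val_succ]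
    split_ifs <;> first | rfl | omega | skip
    congr 2
    ext
    simp
    omega
  · by_cases h' : (i : ℕ) = l + 1
    · refine Or.inr (Or.inr ⟨l, x l.castSucc, fun s => funext fun j => ?_⟩)
      simp only [Fin.contractNth, Function.update_apply, Fin.ext_iff, Fin.val_castSucc,
        Fin.val_succ]
      split_ifs <;> first | rfl | omega | skip
      congr 2
      ext
      simp
      omega
    · refine Or.inl ⟨⟨i - 1, by omega⟩, fun s => funext fun j => ?_⟩
      simp only [Fin.contractNth, Function.update_apply, Fin.ext_iff, Fin.val_castSucc,
        Fin.val_succ]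
      split_ifs <;> first | rfl | omega

/-- `f` agrees with a `k`-linear map. -/
def IsLin (k : Type*) [CommRing k] {V M : Type*} [AddCommGroup V] [Module k V]
    [AddCommGroup M] [Module k M] (f : V → M) : Prop :=
  ∃ l : V →ₗ[k] M, ∀ v, f v = l v

section IsLin

variable {k V M : Type*} [CommRing k] [AddCommGroup V] [Module k V] [AddCommGroup M] [Module k M]

theorem IsLin.add {f g : V → M} (hf : IsLin k f) (hg : IsLin k g) :
    IsLin k (fun x => f x + g x) := by
  obtain ⟨f', hf⟩ := hf
  obtain ⟨g', hg⟩ := hg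
  exact ⟨f' + g', fun x => by simp [hf, hg]⟩

theorem IsLin.sum {J : Type*} {s : Finset J} {f : J → V → M}
    (hf : ∀ j, IsLin k (f j)) : IsLin k (fun x => ∑ j ∈ s, f j x) := by
  choose g hg using hf
  exact ⟨∑ j ∈ s, g j, fun x => by simp [hg]⟩

theorem IsLin.zsmul {f : V → M} (hf : IsLin k f) (c : ℤ) : IsLin k (fun x => c • f x) := by
  obtain ⟨g, hg⟩ := hf
  exact ⟨c • g, fun x => by simp [hg]⟩

theorem IsLin.comp {M' : Type*} [AddCommGroup M'] [Module k M'] {f : V → M}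
    (hf : IsLin k f) (l : M →ₗ[k] M') : IsLin k (fun x => l (f x)) := by
  obtain ⟨g, hg⟩ := hf
  exact ⟨l ∘ₗ g, fun x => by simp [hg]⟩

theorem IsLin.precomp {V' : Type*} [AddCommGroup V'] [Module k V'] {f : V → M}
    (hf : IsLin k f) (l : V' →ₗ[k] V) : IsLin k (fun x => f (l x)) := by
  obtain ⟨g, hg⟩ := hf
  exact ⟨g ∘ₗ l, fun x => by simp [hg]⟩

theorem IsMultilin.isLin {ι : Type*} [DecidableEq ι] {f : (ι → V) → M} (hf : IsMultilin k f)
    (x : ι → V) (i : ι) : IsLin k fun v => f (Function.update x i v) :=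
  isMultilin_iff.1 hf x i

theorem isLin_prod {K ι : Type*} [CommRing K] [Algebra k K] [Fintype ι] [DecidableEq ι] (a : ι → K)
    (i : ι) : IsLin k fun v => ∏ j, Function.update a i v j :=
  ⟨(MultilinearMap.mkPiAlgebra k ι K).toLinearMap a i, fun v => by simp⟩

theorem IsLin.smul_right {K : Type*} [CommRing K] [Algebra k K] [Module K M] [IsScalarTower k K M]
    {f : V → K} (hf : IsLin k f) (m : M) : IsLin k fun v => f v • m := by
  obtain ⟨g, hg⟩ := hf
  exact ⟨(LinearMap.toSpanSingleton K M m).restrictScalars k ∘ₗ g, fun v => by simp [hg]⟩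

theorem isMultilin_pair {m n : Type*} [DecidableEq m] [DecidableEq n] {g : (m → n → V) → M} :
    IsMultilin k (fun x : m × n → V => g fun i j => x (i, j)) ↔
      ∀ a i j, IsLin k fun v => g (Function.update a i (Function.update (a i) j v)) := by
  have key : ∀ (x : m × n → V) (i : m) (j : n) (v : V),
      (fun i' j' => Function.update x (i, j) v (i', j')) =
      Function.update (fun i' j' => x (i', j')) i (Function.update (fun j' => x (i, j')) j v) := by
    intro x i j v
    funext i' j'
    simp only [Function.update_apply, Prod.mk.injEq]
    by_cases h : i' = i
    · subst h
      simp [Function.update_apply]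
    · simp [h]
  rw [isMultilin_iff]
  constructor
  · intro h a i j
    have := h (fun ij => a ij.1 ij.2) (i, j)
    simp only [key] at this
    exact this
  · rintro h x ⟨i, j⟩
    simp only [key]
    exact h _ i j

theorem isLin_pi {J : Type*} {f : V → J → M} (h : ∀ j, IsLin k fun v => f v j) : IsLin k f := by
  choose g hg using h
  exact ⟨LinearMap.pi g, fun v => funext fun j => hg j v⟩

end IsLin

/-- The Hochschild coboundary preserves linearity in each slot. -/
theorem hochB_isLin {k S N V : Type*} [CommRing k] [Algebra k K] [Mul S] [AddCommGroup N]
    [Module K N] [Module k N] [IsScalarTower k K N] [AddCommGroup V] [Module k V]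
    {L Rt : S → Module.End K N} (Γ : Set (V → S))
    (hl : ∀ γ ∈ Γ, ∀ s, (fun v => s * γ v) ∈ Γ) (hr : ∀ γ ∈ Γ, ∀ s, (fun v => γ v * s) ∈ Γ)
    (n : ℕ) (f : (Fin n → S) → N)
    (hL : ∀ γ ∈ Γ, ∀ y, IsLin k fun v => L (γ v) (f y))
    (hR : ∀ γ ∈ Γ, ∀ y, IsLin k fun v => Rt (γ v) (f y))
    (hf : ∀ γ ∈ Γ, ∀ x i, IsLin k fun v => f (Function.update x i (γ v)))
    (γ : V → S) (hγ : γ ∈ Γ) (x : Fin (n + 1) → S) (i : Fin (n + 1)) :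
    IsLin k fun v => hochB L Rt n f (Function.update x i (γ v)) := by
  simp only [hochB_apply]
  refine IsLin.add (IsLin.add ?_ (IsLin.sum fun l => IsLin.zsmul ?_ _)) (IsLin.zsmul ?_ _)
  · refine Fin.cases ?_ (fun i => ?_) i
    · simpa using hL γ hγ _
    · have : ∀ v, (fun j : Fin n => Function.update x i.succ (γ v) j.succ) =
          Function.update (fun j => x j.succ) i (γ v) := by
        intro v; funext j; simp [Function.update_apply]
      simp only [this, Function.update_of_ne (Fin.succ_ne_zero i).symm]
      exact (hf γ hγ _ _).comp ((L (x 0)).restrictScalars k)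
  · rcases contractNth_update (· * ·) l x i with ⟨t, h⟩ | ⟨t, w, h⟩ | ⟨t, w, h⟩
    · simp only [h]; exact hf γ hγ _ _
    · simp only [h]; exact hf _ (hr γ hγ w) _ _
    · simp only [h]; exact hf _ (hl γ hγ w) _ _
  · refine Fin.lastCases ?_ (fun i => ?_) i
    · have : ∀ v, (fun j : Fin n => Function.update x (Fin.last n) (γ v) j.castSucc) =
          (fun j => x j.castSucc) := by
        intro v; funext j; simp [(Fin.castSucc_lt_last j).ne]
      simpa [this] using hR γ hγ _
    · have : ∀ v, (fun j : Fin n => Function.update x i.castSucc (γ v) j.castSucc) =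
          Function.update (fun j => x j.castSucc) i (γ v) := by
        intro v; funext j; simp [Function.update_apply]
      simp only [this, Function.update_of_ne (Fin.castSucc_lt_last i).ne']
      exact (hf γ hγ _ _).comp ((Rt (x (Fin.last n))).restrictScalars k)

/-- The Hochschild coboundary preserves multilinearity. -/
theorem hochB_isMultilin {S N : Type*} [Ring S] [Algebra K S] [AddCommGroup N] [Module K N]
    {L Rt : S → Module.End K N} (hL : ∀ m, IsLin K fun v => L v m) (hR : ∀ m, IsLin K fun v => Rt v m)
    (n : ℕ) (f : (Fin n → S) → N) (hf : IsMultilin K f) : IsMultilin K (hochB L Rt n f) := by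
  rw [isMultilin_iff] at hf ⊢
  intro x i
  refine hochB_isLin (k := K) {γ : S → S | IsLin K γ} ?_ ?_ n f ?_ ?_ ?_ id ⟨LinearMap.id, fun _ => rfl⟩ x i
  · rintro γ ⟨g, hg⟩ s
    exact ⟨LinearMap.mulLeft K s ∘ₗ g, fun v => by simp [hg]⟩
  · rintro γ ⟨g, hg⟩ s
    exact ⟨LinearMap.mulRight K s ∘ₗ g, fun v => by simp [hg]⟩
  · rintro γ ⟨g, hg⟩ m
    obtain ⟨l, h⟩ := hL (f m)
    exact ⟨l ∘ₗ g, fun v => by simp [hg, h]⟩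
  · rintro γ ⟨g, hg⟩ m
    obtain ⟨l, h⟩ := hR (f m)
    exact ⟨l ∘ₗ g, fun v => by simp [hg, h]⟩
  · rintro γ ⟨g, hg⟩ y j
    obtain ⟨l, h⟩ := hf y j
    exact ⟨l ∘ₗ g, fun v => by simp [hg, h]⟩

end Hoch

/-- A pair `(R, M)`: a `K`-algebra `R` and an `R`-bimodule `M` over `K` (the two `K`-actions on `M`
agree), where `K` is itself a commutative `k`-algebra; `R` and `M` carry the induced structures
over `k`. -/
structure AlgBimod (k K : Type u) [Field k] [CommRing K] [Algebra k K] where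
  R : Type u
  M : Type u
  [ring : Ring R]
  [algebraK : Algebra K R]
  [algebrak : Algebra k R]
  [towerR : IsScalarTower k K R]
  [addCommGroup : AddCommGroup M]
  [moduleK : Module K M]
  [modulek : Module k M]
  [towerM : IsScalarTower k K M]
  [moduleLeft : Module R M]
  [moduleRight : Module Rᵐᵒᵖ M]
  [bimodule : SMulCommClass R Rᵐᵒᵖ M]
  [towerLeft : IsScalarTower K R M]
  [towerRight : IsScalarTower K Rᵐᵒᵖ M]

namespace AlgBimod

variable {k K : Type u} [Field k] [CommRing K] [Algebra k K]

attribute [instance] ring algebraK algebrak towerR addCommGroup moduleK modulek towerM moduleLeft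
  moduleRight bimodule towerLeft towerRight

variable (X : AlgBimod k K)

instance commk : SMulCommClass k K X.M := IsScalarTower.to_smulCommClass

/-- The left action of `R` on `M`. -/
def lact (r : X.R) : Module.End K X.M := Module.toModuleEnd K X.M r

/-- The right action of `R` on `M`. -/
def ract (r : X.R) : Module.End K X.M := Module.toModuleEnd K X.M (MulOpposite.op r)

@[simp] theorem lact_apply (r : X.R) (m : X.M) : X.lact r m = r • m := rfl
@[simp] theorem ract_apply (r : X.R) (m : X.M) : X.ract r m = MulOpposite.op r • m := rfl

theorem isLin_lact (m : X.M) : IsLin K fun r => X.lact r m :=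
  ⟨(LinearMap.toSpanSingleton X.R X.M m).restrictScalars K, fun _ => rfl⟩

theorem isLin_ract (m : X.M) : IsLin K fun r => X.ract r m :=
  ⟨(LinearMap.toSpanSingleton X.Rᵐᵒᵖ X.M m).restrictScalars K ∘ₗ
    (MulOpposite.opLinearEquiv K).toLinearMap, fun _ => rfl⟩

end AlgBimod

/-- The cochain complex with terms the submodules `C n` of `P` and with differential induced by an
endomorphism `D` of `P`. -/
noncomputable def subComplex {K : Type u} [CommRing K] {P : Type u} [AddCommGroup P] [Module K P]
    (C : ℕ → Submodule K P) (D : P →ₗ[K] P) (hD : ∀ n, ∀ f ∈ C n, D f ∈ C (n + 1))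
    (hDD : ∀ n, ∀ f ∈ C n, D (D f) = 0) : CochainComplex (ModuleCat.{u} K) ℕ :=
  CochainComplex.of (fun n => ModuleCat.of K (C n)) (fun n => ModuleCat.ofHom (D.restrict (hD n)))
    (fun n => by
      ext f
      exact hDD n f.1 f.2)

/-- The chain map between two complexes as in `subComplex` induced by a linear map. -/
noncomputable def subComplexMap {K : Type u} [CommRing K] {P P' : Type u} [AddCommGroup P]
    [Module K P] [AddCommGroup P'] [Module K P']
    {C : ℕ → Submodule K P} {D : P →ₗ[K] P} {hD : ∀ n, ∀ f ∈ C n, D f ∈ C (n + 1)}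
    {hDD : ∀ n, ∀ f ∈ C n, D (D f) = 0}
    {C' : ℕ → Submodule K P'} {D' : P' →ₗ[K] P'} {hD' : ∀ n, ∀ f ∈ C' n, D' f ∈ C' (n + 1)}
    {hDD' : ∀ n, ∀ f ∈ C' n, D' (D' f) = 0}
    (F : P →ₗ[K] P') (hF : ∀ n, ∀ f ∈ C n, F f ∈ C' n)
    (hc : ∀ n, ∀ f ∈ C n, D' (F f) = F (D f)) :
    subComplex C D hD hDD ⟶ subComplex C' D' hD' hDD' :=
  CochainComplex.ofHom (fun n => ModuleCat.ofHom (F.restrict (hF n))) (fun n => by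
    simp only [subComplex, CochainComplex.of_d]
    ext f
    exact hc n f.1 f.2)

namespace AlgBimod

variable {k K : Type u} [Field k] [CommRing K] [Algebra k K] (X : AlgBimod k K)

/-! Hochschild cochains of `R` over `K`. -/

/-- Families of functions `R ^ q → M`, `q ≥ 0`. -/
abbrev HochFam : Type u := ∀ q : ℕ, (Fin q → X.R) → X.M

/-- The Hochschild coboundary. -/
noncomputable def hochD : X.HochFam →ₗ[K] X.HochFam where
  toFun f
    | 0 => 0
    | q + 1 => hochB X.lact X.ract q (f q)
  map_add' f g := by funext q; cases q <;> simp
  map_smul' c f := by funext q; cases q <;> simp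

/-- `C ^ n(R/K, M) = Hom_K(R ⊗_K ⋯ ⊗_K R, M)`, as the space of families concentrated at `q = n` whose
member there is a `K`-multilinear map. -/
def hochCochains (n : ℕ) : Submodule K X.HochFam where
  carrier := {f | ∀ q, IsMultilin K (f q) ∧ (q ≠ n → f q = 0)}
  zero_mem' q := ⟨IsMultilin.zero, fun _ => rfl⟩
  add_mem' {f g} hf hg q := ⟨(hf q).1.add (hg q).1, fun h => by simp [(hf q).2 h, (hg q).2 h]⟩
  smul_mem' c f hf q := ⟨(hf q).1.smul c, fun h => by simp [(hf q).2 h]⟩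

theorem hochB_sq (n : ℕ) (f : (Fin n → X.R) → X.M) :
    hochB X.lact X.ract (n + 1) (hochB X.lact X.ract n f) = 0 :=
  hochB_hochB (fun s t m => by simp [mul_smul]) (fun s t m => by simp [mul_smul])
    (fun s t m => by simpa using smul_comm _ _ _) n f

/-- The Hochschild cochain complex `C ^ *(R/K, M)`. -/
noncomputable def hochComplex : CochainComplex (ModuleCat.{u} K) ℕ :=
  subComplex X.hochCochains X.hochD
    (by
      intro n f hf q
      cases q with
      | zero => exact ⟨IsMultilin.zero, fun _ => rfl⟩
      | succ q =>
        refine ⟨hochB_isMultilin X.isLin_lact X.isLin_ract q _ (hf q).1, fun h => ?_⟩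
        change hochB _ _ q (f q) = 0
        rw [(hf q).2 (by omega), map_zero])
    (by
      intro n f _
      funext q
      rcases q with _ | _ | q
      · rfl
      · change hochB _ _ 0 0 = 0
        exact map_zero _
      · exact X.hochB_sq q (f q))

/-! The bicomplex. -/

/-- Families of functions `K ^ (p q) × R ^ q → M`, `p, q ≥ 0`; the first argument is a matrix with
`p` rows and `q` columns. -/
abbrev BiFam : Type u := ∀ p q : ℕ, (Fin p → Fin q → K) → (Fin q → X.R) → X.M

/-- The left action of `K ^ ⊗q` on functions `R ^ q → M`: `(a g)(r) = a₁ ⋯ a_q g(r)`. -/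
def horizL (q : ℕ) (a : Fin q → K) : Module.End K ((Fin q → X.R) → X.M) :=
  (∏ j, a j) • LinearMap.id

/-- The right action of `K ^ ⊗q` on functions `R ^ q → M`: `(g b)(r) = g(b₁ r₁, …, b_q r_q)`. -/
def horizR (q : ℕ) (b : Fin q → K) : Module.End K ((Fin q → X.R) → X.M) :=
  LinearMap.funLeft K X.M fun r j => b j • r j

/-- The left action of `K ^ ⊗p ⊗ R` on `M`: `(a, r) m = a₁ ⋯ a_p r m`. -/
def vertL (p : ℕ) (s : (Fin p → K) × X.R) : Module.End K X.M := (∏ i, s.1 i) • X.lact s.2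

/-- The right action of `K ^ ⊗p ⊗ R` on `M`: `m (a, r) = a₁ ⋯ a_p m r`. -/
def vertR (p : ℕ) (s : (Fin p → K) × X.R) : Module.End K X.M := (∏ i, s.1 i) • X.ract s.2

@[simp] theorem horizL_apply (q : ℕ) (a : Fin q → K) (m) (r : Fin q → X.R) :
    X.horizL q a m r = (∏ j, a j) • m r := rfl
@[simp] theorem horizR_apply (q : ℕ) (a : Fin q → K) (m) (r : Fin q → X.R) :
    X.horizR q a m r = m fun j => a j • r j := rfl
@[simp] theorem vertL_apply (p : ℕ) (s : (Fin p → K) × X.R) (m : X.M) :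
    X.vertL p s m = (∏ i, s.1 i) • s.2 • m := rfl
@[simp] theorem vertR_apply (p : ℕ) (s : (Fin p → K) × X.R) (m : X.M) :
    X.vertR p s m = (∏ i, s.1 i) • MulOpposite.op s.2 • m := rfl

/-- The horizontal coboundary `K ^ (p, q) → K ^ (p + 1, q)`: the Hochschild coboundary of
`K ^ ⊗q` with coefficients in the functions `R ^ q → M`. -/
noncomputable def horiz (p q : ℕ) : ((Fin p → Fin q → K) → (Fin q → X.R) → X.M) →ₗ[K]
    ((Fin (p + 1) → Fin q → K) → (Fin q → X.R) → X.M) :=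
  hochB (X.horizL q) (X.horizR q) p

/-- The vertical coboundary `K ^ (p, q) → K ^ (p, q + 1)`, without sign: the Hochschild coboundary
of `K ^ ⊗p ⊗ R` with coefficients in `M`. -/
noncomputable def vert (p q : ℕ) : ((Fin p → Fin q → K) → (Fin q → X.R) → X.M) →ₗ[K]
    ((Fin p → Fin (q + 1) → K) → (Fin (q + 1) → X.R) → X.M) where
  toFun f a r := hochB (X.vertL p) (X.vertR p) q
    (fun x => f (fun i j => (x j).1 i) (fun j => (x j).2)) (fun j => (fun i => a i j, r j))
  map_add' f g := by
    funext a r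
    exact congrFun (map_add (hochB _ _ q) _ _) _
  map_smul' c f := by
    funext a r
    exact congrFun (map_smul (hochB _ _ q) c _) _

/-- The horizontal differential of the bicomplex. -/
noncomputable def biH : X.BiFam →ₗ[K] X.BiFam where
  toFun f
    | 0, _ => 0
    | p + 1, q => X.horiz p q (f p q)
  map_add' f g := by funext p q; cases p <;> simp
  map_smul' c f := by funext p q; cases p <;> simp

/-- The vertical differential of the bicomplex, with the sign `(-1) ^ p`. -/
noncomputable def biV : X.BiFam →ₗ[K] X.BiFam where
  toFun f
    | _, 0 => 0
    | p, q + 1 => (-1 : ℤ) ^ p • X.vert p q (f p q)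
  map_add' f g := by funext p q; cases q <;> simp
  map_smul' c f := by
    funext p q
    cases q
    · simp
    · simpa using smul_comm _ _ _

/-- The differential of the total complex. -/
noncomputable def biD : X.BiFam →ₗ[K] X.BiFam := X.biH + X.biV

/-- `⨁ K ^ (p, q)` over `p + q = n`, where `K ^ (p, q) = Hom_k(K ^ ⊗(p q) ⊗ R ^ ⊗q, M)` is the space
of functions which are `k`-multilinear in all the `p q + q` variables. -/
def biCochains (n : ℕ) : Submodule K X.BiFam where
  carrier := {f | ∀ p q, (∀ a, IsMultilin k (f p q a)) ∧
    (∀ r, IsMultilin k fun x : Fin p × Fin q → K => f p q (fun i j => x (i, j)) r) ∧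
    (p + q ≠ n → f p q = 0)}
  zero_mem' p q := ⟨fun _ => IsMultilin.zero, fun _ => IsMultilin.zero, fun _ => rfl⟩
  add_mem' {f g} hf hg p q := ⟨fun a => ((hf p q).1 a).add ((hg p q).1 a),
    fun r => ((hf p q).2.1 r).add ((hg p q).2.1 r),
    fun h => by simp [(hf p q).2.2 h, (hg p q).2.2 h]⟩
  smul_mem' c f hf p q := ⟨fun a => ((hf p q).1 a).smul c, fun r => ((hf p q).2.1 r).smul c,
    fun h => by simp [(hf p q).2.2 h]⟩

theorem vert_def (p q : ℕ) (f : (Fin p → Fin q → K) → (Fin q → X.R) → X.M) (a r) :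
    X.vert p q f a r = hochB (X.vertL p) (X.vertR p) q
      (fun x => f (fun i j => (x j).1 i) (fun j => (x j).2)) (fun j => (fun i => a i j, r j)) :=
  rfl

theorem horiz_sq (p q : ℕ) (f : (Fin p → Fin q → K) → (Fin q → X.R) → X.M) :
    X.horiz (p + 1) q (X.horiz p q f) = 0 := by
  refine hochB_hochB (L := X.horizL q) (Rt := X.horizR q) ?_ ?_ ?_ p f
  · intro s t m
    funext r
    simp [Finset.prod_mul_distrib, mul_smul]
  · intro s t m
    funext r
    simp [mul_smul]
  · intro s t m
    rfl

theorem vert_sq (p q : ℕ) (f : (Fin p → Fin q → K) → (Fin q → X.R) → X.M) :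
    X.vert p (q + 1) (X.vert p q f) = 0 := by
  funext a r
  rw [vert_def]
  refine congrFun (hochB_hochB (L := X.vertL p) (Rt := X.vertR p) ?_ ?_ ?_ q
    (fun x => f (fun i j => (x j).1 i) (fun j => (x j).2))) (fun j => (fun i => a i j, r j))
  · intro s t m
    simp only [vertL_apply, Prod.fst_mul, Prod.snd_mul, Pi.mul_apply, Finset.prod_mul_distrib,
      mul_smul]
    rw [smul_comm s.2 (∏ i, t.1 i)]
  · intro s t m
    simp only [vertR_apply, Prod.fst_mul, Prod.snd_mul, Pi.mul_apply, Finset.prod_mul_distrib,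
      mul_smul, MulOpposite.op_mul]
    rw [smul_comm (MulOpposite.op t.2) (∏ i, s.1 i), smul_comm (∏ i, s.1 i)]
  · intro s t m
    simp only [vertL_apply, vertR_apply]
    rw [smul_comm s.2 (∏ i, t.1 i), smul_comm (MulOpposite.op t.2) (∏ i, s.1 i),
      smul_comm s.2 (MulOpposite.op t.2), smul_comm (∏ i, s.1 i)]

theorem contractNth_fst {p q : ℕ} (l : Fin q) (a : Fin p → Fin (q + 1) → K)
    (r : Fin (q + 1) → X.R) (j : Fin q) : Fin.contractNth l.castSucc (· * ·)
      (fun j => ((fun i => a i j : Fin p → K), r j)) j =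
      (fun i => Fin.contractNth l.castSucc (· * ·) (a i) j,
        Fin.contractNth l.castSucc (· * ·) r j) := by
  unfold Fin.contractNth
  split_ifs <;> rfl

theorem vert_apply (p q : ℕ) (f : (Fin p → Fin q → K) → (Fin q → X.R) → X.M)
    (a : Fin p → Fin (q + 1) → K) (r : Fin (q + 1) → X.R) :
    X.vert p q f a r =
      (∏ i, a i 0) • r 0 • f (fun i j => a i j.succ) (fun j => r j.succ) +
      ∑ l : Fin q, (-1 : ℤ) ^ ((l : ℕ) + 1) • f (fun i => Fin.contractNth l.castSucc (· * ·) (a i))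
        (Fin.contractNth l.castSucc (· * ·) r) +
      (-1 : ℤ) ^ (q + 1) • (∏ i, a i (Fin.last q)) • MulOpposite.op (r (Fin.last q)) •
        f (fun i j => a i j.castSucc) (fun j => r j.castSucc) := by
  rw [vert_def, hochB_apply]
  simp only [contractNth_fst]
  rfl

theorem horiz_apply (p q : ℕ) (f : (Fin p → Fin q → K) → (Fin q → X.R) → X.M)
    (a : Fin (p + 1) → Fin q → K) (r : Fin q → X.R) :
    X.horiz p q f a r =
      (∏ j, a 0 j) • f (fun i => a i.succ) r +
      ∑ l : Fin p, (-1 : ℤ) ^ ((l : ℕ) + 1) • f (Fin.contractNth l.castSucc (· * ·) a) r +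
      (-1 : ℤ) ^ (p + 1) • f (fun i => a i.castSucc) (fun j => a (Fin.last p) j • r j) := by
  change hochB (X.horizL q) (X.horizR q) p _ _ _ = _
  rw [hochB_apply]
  simp

theorem contractNth_mul {C : Type*} [CommMonoid C] {q : ℕ} (l : Fin q) (s t : Fin (q + 1) → C) :
    Fin.contractNth l.castSucc (· * ·) (s * t) =
      Fin.contractNth l.castSucc (· * ·) s * Fin.contractNth l.castSucc (· * ·) t := by
  funext j
  simp only [Fin.contractNth, Pi.mul_apply]
  split_ifs
  · rfl
  · exact mul_mul_mul_comm _ _ _ _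
  · rfl

theorem contractNth_smul {q : ℕ} (l : Fin q) (s : Fin (q + 1) → K) (r : Fin (q + 1) → X.R) :
    Fin.contractNth l.castSucc (· * ·) (fun j => s j • r j) =
      fun j => Fin.contractNth l.castSucc (· * ·) s j • Fin.contractNth l.castSucc (· * ·) r j := by
  funext j
  simp only [Fin.contractNth]
  split_ifs
  · rfl
  · exact smul_mul_smul_comm _ _ _ _
  · rfl

theorem horiz_vert (p q : ℕ) (f : (Fin p → Fin q → K) → (Fin q → X.R) → X.M) :
    X.horiz p (q + 1) (X.vert p q f) = X.vert (p + 1) q (X.horiz p q f) := by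
  have key : X.vert p q f =
      (fun a => (∏ i, a i 0) • (LinearMap.pi fun r => X.lact (r 0) ∘ₗ
        LinearMap.proj (fun j => r j.succ) : ((Fin q → X.R) → X.M) →ₗ[K] _)
        (f fun i => (fun j => a i j.succ))) +
      ∑ l : Fin q, (-1 : ℤ) ^ ((l : ℕ) + 1) • (fun a =>
        (LinearMap.funLeft K X.M (Fin.contractNth l.castSucc (· * ·)))
        (f fun i => Fin.contractNth l.castSucc (· * ·) (a i))) +
      (-1 : ℤ) ^ (q + 1) • (fun a => (∏ i, a i (Fin.last q)) •
        (LinearMap.pi fun r => X.ract (r (Fin.last q)) ∘ₗ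
        LinearMap.proj (fun j => r j.castSucc) : ((Fin q → X.R) → X.M) →ₗ[K] _)
        (f fun i => (fun j => a i j.castSucc))) := by
    funext a r
    rw [vert_apply]
    simp [Finset.sum_apply, LinearMap.funLeft_apply]
  rw [key, map_add, map_add, map_sum, map_zsmul]
  funext a r
  rw [vert_apply]
  simp only [map_zsmul, Pi.add_apply, Finset.sum_apply, Pi.smul_apply]
  congr 1
  · congr 1
    · refine (congrFun (hochB_pull (L := X.horizL q) (Rt := X.horizR q)
        (L' := X.horizL (q + 1)) (Rt' := X.horizR (q + 1)) (fun s : Fin (q + 1) → K => fun j : Fin q => s j.succ)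
        (fun s => s 0) _ (fun _ _ => rfl) (fun _ _ => rfl) ?_ ?_ p f a) r).trans rfl
      · intro s m
        funext r
        simp [Fin.prod_univ_succ, mul_smul]
      · intro s m
        funext r
        simp
    · refine Finset.sum_congr rfl fun l _ => ?_
      congr 1
      refine (congrFun (hochB_pull' (L := X.horizL q) (Rt := X.horizR q)
        (L' := X.horizL (q + 1)) (Rt' := X.horizR (q + 1))
        (fun s : Fin (q + 1) → K => Fin.contractNth l.castSucc (· * ·) s)
        _ (contractNth_mul l) ?_ ?_ p f a) r).trans rfl
      · intro s m
        funext r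
        simp [prod_contractNth, LinearMap.funLeft_apply]
      · intro s m
        funext r
        simp [LinearMap.funLeft_apply, contractNth_smul]
  · congr 1
    refine (congrFun (hochB_pull (L := X.horizL q) (Rt := X.horizR q)
        (L' := X.horizL (q + 1)) (Rt' := X.horizR (q + 1)) (fun s : Fin (q + 1) → K => fun j : Fin q => s j.castSucc)
        (fun s => s (Fin.last q)) _ (fun _ _ => rfl) (fun _ _ => rfl) ?_ ?_ p f a) r).trans rfl
    · intro s m
      funext r
      simp [Fin.prod_univ_castSucc, mul_smul]
      exact smul_comm _ _ _
    · intro s m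
      funext r
      simp

theorem biD_sq (f : X.BiFam) : X.biD (X.biD f) = 0 := by
  have hH : X.biH (X.biH f) = 0 := by
    funext p q
    rcases p with _ | _ | p
    · rfl
    · exact map_zero (X.horiz 0 q)
    · exact X.horiz_sq p q _
  have hV : X.biV (X.biV f) = 0 := by
    funext p q
    rcases q with _ | _ | q
    · rfl
    · change (-1 : ℤ) ^ p • X.vert p 0 0 = 0
      simp
    · change (-1 : ℤ) ^ p • X.vert p (q + 1) ((-1 : ℤ) ^ p • X.vert p q (f p q)) = 0
      simp [vert_sq]
  have hHV : X.biH (X.biV f) + X.biV (X.biH f) = 0 := by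
    funext p q
    rcases p with _ | p <;> rcases q with _ | q
    · exact add_zero _
    · change 0 + (-1 : ℤ) ^ 0 • X.vert 0 q 0 = 0
      simp
    · change X.horiz p 0 0 + 0 = 0
      simp
    · change X.horiz p (q + 1) ((-1 : ℤ) ^ p • X.vert p q (f p q)) +
        (-1 : ℤ) ^ (p + 1) • X.vert (p + 1) q (X.horiz p q (f p q)) = 0
      rw [map_zsmul, horiz_vert, pow_succ]
      simp
  simp only [biD, LinearMap.add_apply, map_add]
  rw [hH, hV, zero_add, add_zero, add_comm, hHV]

end AlgBimod

namespace AlgBimod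

variable {k K : Type u} [Field k] [CommRing K] [Algebra k K] (X : AlgBimod k K)

theorem horiz_multilin {p q : ℕ} {f : (Fin p → Fin q → K) → (Fin q → X.R) → X.M}
    (h1 : ∀ a, IsMultilin k (f a))
    (h2 : ∀ r, IsMultilin k fun x : Fin p × Fin q → K => f (fun i j => x (i, j)) r) :
    (∀ a, IsMultilin k (X.horiz p q f a)) ∧ ∀ r, IsMultilin k
      fun x : Fin (p + 1) × Fin q → K => X.horiz p q f (fun i j => x (i, j)) r := by
  constructor
  · intro a
    have : X.horiz p q f a = fun r => X.horiz p q f a r := rfl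
    rw [this]
    simp only [horiz_apply]
    refine ((IsMultilin.smul (h1 _) _).add (IsMultilin.sum fun l => (h1 _).zsmul _)).add
      (IsMultilin.zsmul ?_ _)
    exact (h1 fun i => a i.castSucc).comp_linear
      fun j => (LinearMap.lsmul K X.R (a (Fin.last p) j)).restrictScalars k
  · intro r
    refine (isMultilin_pair (g := fun a => X.horiz p q f a r)).2 fun a i j => ?_
    have := hochB_isLin (k := k) (V := K) (L := X.horizL q) (Rt := X.horizR q)
      {γ : K → Fin q → K | ∃ s c, ∀ v, γ v = Function.update s j (c * v)} ?_ ?_ p f ?_ ?_ ?_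
      (fun v => Function.update (a i) j v) ⟨a i, 1, by simp⟩ a i
    · exact this.comp (LinearMap.proj r)
    · rintro γ ⟨s, c, h⟩ t
      refine ⟨t * s, t j * c, fun v => funext fun j' => ?_⟩
      by_cases hj : j' = j
      · subst hj; simp [h, mul_assoc]
      · simp [h, hj]
    · rintro γ ⟨s, c, h⟩ t
      refine ⟨s * t, t j * c, fun v => funext fun j' => ?_⟩
      by_cases hj : j' = j
      · subst hj; simp [h]; ring
      · simp [h, hj]
    · rintro γ ⟨s, c, h⟩ y
      refine isLin_pi fun r => ?_
      simp only [h, horizL_apply]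
      exact ((isLin_prod s j).precomp (LinearMap.mulLeft k c)).smul_right _
    · rintro γ ⟨s, c, h⟩ y
      refine isLin_pi fun r => ?_
      simp only [h, horizR_apply]
      have e : ∀ v, (fun j' => Function.update s j (c * v) j' • r j') =
          Function.update (fun j' => s j' • r j') j ((c * v) • r j) := by
        intro v
        funext j'
        by_cases hj : j' = j
        · subst hj; simp
        · simp [hj]
      simp only [e]
      exact ((h1 y).isLin _ j).precomp
        ((LinearMap.toSpanSingleton K X.R (r j)).restrictScalars k ∘ₗ LinearMap.mulLeft k c)
    · rintro γ ⟨s, c, h⟩ x i'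
      refine isLin_pi fun r => ?_
      simp only [h]
      have := (isMultilin_pair (g := fun a => f a r)).1 (h2 r) (Function.update x i' s) i' j
      simp only [Function.update_idem, Function.update_self] at this
      exact this.precomp (LinearMap.mulLeft k c)

theorem vert_multilin {p q : ℕ} {f : (Fin p → Fin q → K) → (Fin q → X.R) → X.M}
    (h1 : ∀ a, IsMultilin k (f a))
    (h2 : ∀ r, IsMultilin k fun x : Fin p × Fin q → K => f (fun i j => x (i, j)) r) :
    (∀ a, IsMultilin k (X.vert p q f a)) ∧ ∀ r, IsMultilin k
      fun x : Fin p × Fin (q + 1) → K => X.vert p q f (fun i j => x (i, j)) r := by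
  constructor
  · intro a
    rw [isMultilin_iff]
    intro r j
    have := hochB_isLin (k := k) (V := X.R) (L := X.vertL p) (Rt := X.vertR p)
      {γ : X.R → (Fin p → K) × X.R | ∃ (s : Fin p → K) (l : X.R →ₗ[k] X.R), ∀ v, γ v = (s, l v)}
      ?_ ?_ q (fun x => f (fun i j => (x j).1 i) (fun j => (x j).2)) ?_ ?_ ?_
      (fun v => ((fun i => a i j), v)) ⟨_, LinearMap.id, fun _ => rfl⟩ (fun j => (fun i => a i j, r j)) j
    · have e : ∀ v, (fun j' => ((fun i => a i j' : Fin p → K), Function.update r j v j')) =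
          Function.update (fun j => ((fun i => a i j : Fin p → K), r j)) j ((fun i => a i j), v) := by
        intro v
        funext j'
        by_cases hj : j' = j
        · subst hj; simp
        · simp [hj]
      have this : IsLin k fun v => X.vert p q f a (Function.update r j v) := by
        simp only [vert_def, e]
        exact this
      exact this
    · rintro γ ⟨s, l, h⟩ t
      exact ⟨t.1 * s, LinearMap.mulLeft k t.2 ∘ₗ l, fun v => by simp [h, Prod.mul_def]⟩
    · rintro γ ⟨s, l, h⟩ t
      exact ⟨s * t.1, LinearMap.mulRight k t.2 ∘ₗ l, fun v => by simp [h, Prod.mul_def]⟩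
    · rintro γ ⟨s, l, h⟩ y
      obtain ⟨g, hg⟩ := X.isLin_lact (f (fun i j => (y j).1 i) fun j => (y j).2)
      exact ⟨((∏ i, s i) • g).restrictScalars k ∘ₗ l, fun v => by simp [h, ← hg]⟩
    · rintro γ ⟨s, l, h⟩ y
      obtain ⟨g, hg⟩ := X.isLin_ract (f (fun i j => (y j).1 i) fun j => (y j).2)
      exact ⟨((∏ i, s i) • g).restrictScalars k ∘ₗ l, fun v => by simp [h, ← hg]⟩
    · rintro γ ⟨s, l, h⟩ y j
      have e1 : ∀ v, (fun i' j' => (Function.update y j (γ v) j').1 i') =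
          fun i' j' => (Function.update y j (s, 0) j').1 i' := by
        intro v
        funext i' j'
        by_cases hj : j' = j
        · subst hj; simp [h]
        · simp [hj]
      have e2 : ∀ v, (fun j' => (Function.update y j (γ v) j').2) =
          Function.update (fun j' => (y j').2) j (l v) := by
        intro v
        funext j'
        by_cases hj : j' = j
        · subst hj; simp [h]
        · simp [hj]
      simp only [e1, e2]
      exact ((h1 _).isLin _ j).precomp l
  · intro r
    refine (isMultilin_pair (g := fun a => X.vert p q f a r)).2 fun a i j => ?_
    have := hochB_isLin (k := k) (V := K) (L := X.vertL p) (Rt := X.vertR p)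
      {γ : K → (Fin p → K) × X.R | ∃ s c t, ∀ v, γ v = (Function.update s i (c * v), t)}
      ?_ ?_ q (fun x => f (fun i j => (x j).1 i) (fun j => (x j).2)) ?_ ?_ ?_
      (fun v => (Function.update (fun i => a i j) i v, r j)) ⟨_, 1, r j, fun v => by rw [one_mul]⟩
      (fun j => (fun i => a i j, r j)) j
    · have e : ∀ v, (fun j' => ((fun i' => Function.update a i (Function.update (a i) j v) i' j' :
            Fin p → K), r j')) =
          Function.update (fun j => ((fun i => a i j : Fin p → K), r j)) j
            (Function.update (fun i => a i j) i v, r j) := by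
        intro v
        funext j'
        by_cases hj : j' = j
        · subst hj
          simp only [Function.update_self, Prod.mk.injEq, and_true]
          funext i'
          by_cases hi : i' = i
          · subst hi; simp
          · simp [hi]
        · simp only [Function.update_of_ne hj, Prod.mk.injEq, and_true]
          funext i'
          by_cases hi : i' = i
          · subst hi; simp [hj]
          · simp [hi]
      simp only [vert_def, e]
      exact this
    · rintro γ ⟨s, c, t, h⟩ w
      refine ⟨w.1 * s, w.1 i * c, w.2 * t, fun v => Prod.ext (funext fun j' => ?_) (by simp [h])⟩
      by_cases hj : j' = i
      · subst hj; simp [h, mul_assoc]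
      · simp [h, hj]
    · rintro γ ⟨s, c, t, h⟩ w
      refine ⟨s * w.1, w.1 i * c, t * w.2, fun v => Prod.ext (funext fun j' => ?_) (by simp [h])⟩
      by_cases hj : j' = i
      · subst hj; simp [h]; ring
      · simp [h, hj]
    · rintro γ ⟨s, c, t, h⟩ y
      simp only [h, vertL_apply]
      exact ((isLin_prod s i).precomp (LinearMap.mulLeft k c)).smul_right _
    · rintro γ ⟨s, c, t, h⟩ y
      simp only [h, vertR_apply]
      exact ((isLin_prod s i).precomp (LinearMap.mulLeft k c)).smul_right _
    · rintro γ ⟨s, c, t, h⟩ y j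
      have e1 : ∀ v, (fun i' j' => (Function.update y j (γ v) j').1 i') =
          Function.update (fun i' j' => (Function.update y j (s, t) j').1 i') i
            (Function.update (fun j' => (Function.update y j (s, t) j').1 i) j (c * v)) := by
        intro v
        funext i' j'
        by_cases hj : j' = j
        · subst hj
          by_cases hi : i' = i
          · subst hi; simp [h]
          · simp [h, hi]
        · by_cases hi : i' = i
          · subst hi; simp [hj]
          · simp [hj, hi]
      have e2 : ∀ v, (fun j' => (Function.update y j (γ v) j').2) =
          fun j' => (Function.update y j (s, t) j').2 := by
        intro v
        funext j'
        by_cases hj : j' = j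
        · subst hj; simp [h]
        · simp [hj]
      simp only [e1, e2]
      exact ((isMultilin_pair (g := fun a => f a fun j' => (Function.update y j (s, t) j').2)).1
        (h2 _) _ i j).precomp (LinearMap.mulLeft k c)

theorem biD_mem (n : ℕ) (f : X.BiFam) (hf : f ∈ X.biCochains n) : X.biD f ∈ X.biCochains (n + 1) := by
  refine Submodule.add_mem _ (fun p q => ?_) (fun p q => ?_)
  · cases p with
    | zero => exact ⟨fun _ => IsMultilin.zero, fun _ => IsMultilin.zero, fun _ => rfl⟩
    | succ p =>
      obtain ⟨h1, h2, h3⟩ := hf p q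
      obtain ⟨h4, h5⟩ := X.horiz_multilin h1 h2
      refine ⟨h4, h5, fun h => ?_⟩
      change X.horiz p q (f p q) = 0
      rw [h3 (by omega), map_zero]
  · cases q with
    | zero => exact ⟨fun _ => IsMultilin.zero, fun _ => IsMultilin.zero, fun _ => rfl⟩
    | succ q =>
      obtain ⟨h1, h2, h3⟩ := hf p q
      obtain ⟨h4, h5⟩ := X.vert_multilin h1 h2
      refine ⟨fun a => (h4 a).zsmul _, fun r => (h5 r).zsmul _, fun h => ?_⟩
      change (-1 : ℤ) ^ p • X.vert p q (f p q) = 0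
      rw [h3 (by omega), map_zero, smul_zero]

/-- The total complex of the bicomplex `K ^ **(K, R, M)`. -/
noncomputable def biComplex : CochainComplex (ModuleCat.{u} K) ℕ :=
  subComplex X.biCochains X.biD X.biD_mem fun _ f _ => X.biD_sq f

/-- `α` on cochains: the inclusion of the cochains of `R` over `K` into the column `p = 0`. -/
def alphaFam : X.HochFam →ₗ[K] X.BiFam where
  toFun f
    | 0, q => fun _ r => f q r
    | _ + 1, _ => 0
  map_add' f g := by
    funext p q
    cases p
    · rfl
    · simp
  map_smul' c f := by
    funext p q
    cases p
    · rfl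
    · simp

theorem alphaFam_mem (n : ℕ) (f : X.HochFam) (hf : f ∈ X.hochCochains n) :
    X.alphaFam f ∈ X.biCochains n := by
  intro p q
  cases p with
  | zero =>
    refine ⟨fun _ => (hf q).1.restrictScalars, fun r => IsMultilin.of_isEmpty _, fun h => ?_⟩
    funext a r
    exact congrFun ((hf q).2 (by omega)) r
  | succ p => exact ⟨fun _ => IsMultilin.zero, fun _ => IsMultilin.zero, fun _ => rfl⟩

theorem alphaFam_comm (n : ℕ) (f : X.HochFam) (hf : f ∈ X.hochCochains n) :
    X.biD (X.alphaFam f) = X.alphaFam (X.hochD f) := by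
  have hH : X.biH (X.alphaFam f) = 0 := by
    funext p q
    rcases p with _ | _ | p
    · rfl
    · funext a r
      change X.horiz 0 q (X.alphaFam f 0 q) a r = 0
      obtain ⟨g, hg⟩ := (hf q).1
      rw [horiz_apply]
      change (∏ j, a 0 j) • f q r + _ + (-1 : ℤ) ^ (0 + 1) • f q (fun j => a (Fin.last 0) j • r j) = 0
      rw [← hg, ← hg, MultilinearMap.map_smul_univ]
      simp
    · exact map_zero (X.horiz (p + 1) q)
  have hV : X.biV (X.alphaFam f) = X.alphaFam (X.hochD f) := by
    funext p q
    rcases p with _ | p <;> rcases q with _ | q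
    · rfl
    · funext a r
      change (-1 : ℤ) ^ 0 • X.vert 0 q (X.alphaFam f 0 q) a r = hochB X.lact X.ract q (f q) r
      rw [pow_zero, one_smul, vert_apply, hochB_apply]
      simp
      rfl
    · rfl
    · change (-1 : ℤ) ^ (p + 1) • X.vert (p + 1) q 0 = 0
      simp
  rw [biD, LinearMap.add_apply, hH, hV, zero_add]

/-- The chain map inducing `α`. -/
noncomputable def alphaHom : X.hochComplex ⟶ X.biComplex :=
  subComplexMap X.alphaFam X.alphaFam_mem X.alphaFam_comm

/-- The Hochschild cohomology `H ^ n(R/K, M)` of `R` over `K`. -/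
noncomputable abbrev hochCohomology (n : ℕ) : ModuleCat.{u} K := X.hochComplex.homology n

/-- The cohomology `H ^ n(K, R, M)` of the bicomplex. -/
noncomputable abbrev biCohomology (n : ℕ) : ModuleCat.{u} K := X.biComplex.homology n

/-- The comparison homomorphism `α ^ n : H ^ n(R/K, M) → H ^ n(K, R, M)`. -/
noncomputable abbrev alpha (n : ℕ) : X.hochCohomology n ⟶ X.biCohomology n :=
  HomologicalComplex.homologyMap X.alphaHom n

/-- A morphism from `(R, M)` to `(R', M')`: an algebra homomorphism `R → R'` together with an
`R`-bimodule homomorphism `M' → M`. -/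
structure Hom (X Y : AlgBimod k K) where
  alg : X.R →ₐ[K] Y.R
  mod : Y.M →ₗ[K] X.M
  map_left : ∀ (r : X.R) (m : Y.M), mod (alg r • m) = r • mod m
  map_right : ∀ (r : X.R) (m : Y.M), mod (MulOpposite.op (alg r) • m) = MulOpposite.op r • mod m

variable {X} {Y : AlgBimod k K}

/-- The map induced on families of functions. -/
def Hom.biFam (F : Hom X Y) : Y.BiFam →ₗ[K] X.BiFam where
  toFun f p q a r := F.mod (f p q a fun j => F.alg (r j))
  map_add' f g := by funext p q a r; simp
  map_smul' c f := by funext p q a r; simp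

theorem Hom.biFam_mem (F : Hom X Y) (n : ℕ) (f : Y.BiFam) (hf : f ∈ Y.biCochains n) :
    F.biFam f ∈ X.biCochains n := by
  intro p q
  obtain ⟨h1, h2, h3⟩ := hf p q
  refine ⟨fun a => ?_, fun r => (h2 _).comp (F.mod.restrictScalars k), fun h => ?_⟩
  · exact ((h1 a).comp_linear fun _ => F.alg.toLinearMap.restrictScalars k).comp
      (F.mod.restrictScalars k)
  · funext a r
    change F.mod (f p q a _) = 0
    rw [h3 h]
    exact map_zero _

theorem map_contractNth {S T : Type*} [Mul S] [Mul T] {n : ℕ} (g : S → T)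
    (hg : ∀ x y, g (x * y) = g x * g y) (l : Fin n) (x : Fin (n + 1) → S) :
    (fun j => g (Fin.contractNth l.castSucc (· * ·) x j)) =
      Fin.contractNth l.castSucc (· * ·) fun j => g (x j) :=
  Fin.comp_contractNth (· * ·) (· * ·) hg l.castSucc x

theorem Hom.biFam_comm (F : Hom X Y) (f : Y.BiFam) : X.biD (F.biFam f) = F.biFam (Y.biD f) := by
  have hH : X.biH (F.biFam f) = F.biFam (Y.biH f) := by
    funext p q
    cases p with
    | zero => funext a r; exact (map_zero F.mod).symm
    | succ p =>
      funext a r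
      change X.horiz p q (F.biFam f p q) a r = F.mod (Y.horiz p q (f p q) a fun j => F.alg (r j))
      rw [horiz_apply, horiz_apply]
      simp only [biFam, LinearMap.coe_mk, AddHom.coe_mk, map_add, map_sum, map_smul, map_zsmul]
  have hV : X.biV (F.biFam f) = F.biFam (Y.biV f) := by
    funext p q
    cases q with
    | zero => funext a r; exact (map_zero F.mod).symm
    | succ q =>
      funext a r
      change (-1 : ℤ) ^ p • X.vert p q (F.biFam f p q) a r =
        F.mod ((-1 : ℤ) ^ p • Y.vert p q (f p q) a fun j => F.alg (r j))
      rw [vert_apply, vert_apply]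
      simp only [biFam, LinearMap.coe_mk, AddHom.coe_mk, map_add, map_sum, map_smul, map_zsmul,
        F.map_left, F.map_right, map_contractNth F.alg (map_mul F.alg)]
  rw [biD, biD, LinearMap.add_apply, LinearMap.add_apply, hH, hV, map_add]

/-- The homomorphism `H ^ n(K, R', M') → H ^ n(K, R, M)` induced by a morphism of pairs. -/
noncomputable def Hom.biCohomologyMap (F : Hom X Y) (n : ℕ) : Y.biCohomology n ⟶ X.biCohomology n :=
  HomologicalComplex.homologyMap
    (subComplexMap F.biFam F.biFam_mem fun _ f _ => F.biFam_comm f : Y.biComplex ⟶ X.biComplex) n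

end AlgBimod

/-- A chain algebra over `K`: a graded algebra `A = ⨁ Aₙ`, `n ≥ 0`, with a differential `d` of degree
`-1` satisfying the Leibniz rule. -/
structure ChainAlgebra (K : Type u) [CommRing K] where
  carrier : Type u
  [ring : Ring carrier]
  [algebra : Algebra K carrier]
  gr : ℕ → Submodule K carrier
  [graded : GradedAlgebra gr]
  d : carrier →ₗ[K] carrier
  d_mem : ∀ n, ∀ x ∈ gr (n + 1), d x ∈ gr n
  d_zero : ∀ x ∈ gr 0, d x = 0
  d_d : ∀ x, d (d x) = 0
  leibniz : ∀ n, ∀ x ∈ gr n, ∀ y, d (x * y) = d x * y + (-1 : ℤ) ^ n • (x * d y)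

namespace ChainAlgebra

attribute [instance] ring algebra graded

variable {K : Type u} [CommRing K]

/-- A morphism of chain algebras. -/
structure Hom (A B : ChainAlgebra K) where
  alg : A.carrier →ₐ[K] B.carrier
  map_mem : ∀ n, ∀ x ∈ A.gr n, alg x ∈ B.gr n
  map_d : ∀ x, alg (A.d x) = B.d (alg x)

/-- The composition of morphisms. -/
def Hom.comp {A B C : ChainAlgebra K} (g : Hom B C) (f : Hom A B) : Hom A C where
  alg := g.alg.comp f.alg
  map_mem n x hx := g.map_mem n _ (f.map_mem n x hx)
  map_d x := by simp [f.map_d, g.map_d]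

/-- The homology `Ker d / Im d` of a chain algebra (the sum of the homology modules in all degrees). -/
abbrev homology (A : ChainAlgebra K) : Type u :=
  LinearMap.ker A.d ⧸ (LinearMap.range A.d).submoduleOf (LinearMap.ker A.d)

/-- The map induced in homology. -/
def Hom.homologyMap {A B : ChainAlgebra K} (f : Hom A B) : A.homology →ₗ[K] B.homology :=
  Submodule.mapQ _ _
    (f.alg.toLinearMap.restrict (p := LinearMap.ker A.d) (q := LinearMap.ker B.d) fun x hx => by
      simp only [LinearMap.mem_ker] at hx ⊢
      simp [← f.map_d, hx])
    (by
      rintro ⟨x, hx⟩ ⟨y, hy⟩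
      exact ⟨f.alg y, by simpa [← f.map_d] using congrArg f.alg hy⟩)

/-- A weak equivalence is a morphism which induces an isomorphism in homology. -/
def Hom.IsWeakEquiv {A B : ChainAlgebra K} (f : Hom A B) : Prop := Function.Bijective f.homologyMap

/-- A fibration is a morphism which is surjective in all positive degrees. -/
def Hom.IsFibration {A B : ChainAlgebra K} (f : Hom A B) : Prop :=
  ∀ n, 0 < n → ∀ y ∈ B.gr n, ∃ x ∈ A.gr n, f.alg x = y

/-- A chain algebra is cofibrant if the morphism from the initial chain algebra `K` to it has the left
lifting property with respect to all morphisms which are fibrations and weak equivalences. -/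
def IsCofibrant (A : ChainAlgebra K) : Prop :=
  ∀ (E B : ChainAlgebra K) (p : Hom E B), p.IsFibration → p.IsWeakEquiv →
    ∀ g : Hom A B, ∃ h : Hom A E, p.comp h = g

/-- The grading concentrated in degree zero. -/
def zeroGrading (K R : Type u) [CommRing K] [Ring R] [Algebra K R] : ℕ → Submodule K R
  | 0 => ⊤
  | _ + 1 => ⊥

noncomputable instance zeroGradingGraded (R : Type u) [Ring R] [Algebra K R] : GradedAlgebra (zeroGrading K R) where
  one_mem := Submodule.mem_top
  mul_mem := by
    rintro (_ | i) (_ | j) x y hx hy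
    · exact Submodule.mem_top
    · rw [show y = 0 from hy, mul_zero]
      exact Submodule.zero_mem _
    · rw [show x = 0 from hx, zero_mul]
      exact Submodule.zero_mem _
    · rw [show x = 0 from hx, zero_mul]
      exact Submodule.zero_mem _
  decompose' r := DirectSum.of (fun i => zeroGrading K R i) 0 ⟨r, Submodule.mem_top⟩
  left_inv r := by simp
  right_inv x := by
    induction x using DirectSum.induction_on with
    | zero =>
      rw [map_zero]
      exact map_zero (DirectSum.of (fun i => zeroGrading K R i) 0)
    | of i x =>
      rcases i with _ | i
      · simp
      · have : x = 0 := Subtype.ext x.2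
        rw [this, map_zero, map_zero]
        exact map_zero (DirectSum.of (fun i => zeroGrading K R i) 0)
    | add x y hx hy =>
      rw [map_add]
      conv_rhs => rw [← hx, ← hy, ← map_add]
      rfl

/-- An algebra, regarded as a chain algebra concentrated in degree zero. -/
noncomputable abbrev ofAlgebra (K R : Type u) [CommRing K] [Ring R] [Algebra K R] :
    ChainAlgebra K where
  carrier := R
  gr := zeroGrading K R
  d := 0
  d_mem n x _ := Submodule.zero_mem _
  d_zero _ _ := rfl
  d_d _ := rfl
  leibniz n x _ y := by simp

/-- A cofibrant replacement of the `K`-algebra `R`: a weak equivalence to `R` from a cofibrant chain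
algebra. -/
structure CofibrantReplacement (K R : Type u) [CommRing K] [Ring R] [Algebra K R] where
  alg : ChainAlgebra K
  aug : Hom alg (ofAlgebra K R)
  cofibrant : alg.IsCofibrant
  weakEquiv : aug.IsWeakEquiv

variable (A : ChainAlgebra K)

/-- The sign automorphism, multiplication by `(-1) ^ n` in degree `n`. -/
noncomputable def sgn : A.carrier →ₗ[K] A.carrier :=
  DirectSum.toModule K ℕ A.carrier (fun n => (-1 : ℤ) ^ n • (A.gr n).subtype) ∘ₗ
    (DirectSum.decomposeLinearEquiv A.gr).toLinearMap

theorem sgn_of_mem {n : ℕ} {x : A.carrier} (hx : x ∈ A.gr n) : A.sgn x = (-1 : ℤ) ^ n • x := by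
  lift x to A.gr n using hx
  simp only [sgn, LinearMap.comp_apply, LinearEquiv.coe_coe, DirectSum.decomposeLinearEquiv_apply,
    DirectSum.decompose_coe]
  exact DirectSum.toModule_lof (M := fun n => A.gr n) K n x

theorem sgn_mem {n : ℕ} {x : A.carrier} (hx : x ∈ A.gr n) : A.sgn x ∈ A.gr n := by
  rw [A.sgn_of_mem hx]
  exact zsmul_mem hx _

theorem sgn_mul (x y : A.carrier) : A.sgn (x * y) = A.sgn x * A.sgn y := by
  induction x using DirectSum.Decomposition.inductionOn A.gr with
  | zero => simp
  | add a b ha hb => simp [add_mul, ha, hb]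
  | @homogeneous i a =>
    induction y using DirectSum.Decomposition.inductionOn A.gr with
    | zero => simp
    | add c e hc he => simp [mul_add, hc, he]
    | @homogeneous j c =>
      rw [A.sgn_of_mem a.2, A.sgn_of_mem c.2, A.sgn_of_mem (SetLike.mul_mem_graded a.2 c.2),
        smul_mul_smul_comm, pow_add]

theorem d_sgn (x : A.carrier) : A.d (A.sgn x) = -A.sgn (A.d x) := by
  induction x using DirectSum.Decomposition.inductionOn A.gr with
  | zero => simp
  | add a b ha hb => simp [ha, hb, add_comm]
  | @homogeneous i a =>
    rw [A.sgn_of_mem a.2, map_zsmul]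
    rcases i with _ | i
    · rw [A.d_zero _ a.2]; simp
    · rw [A.sgn_of_mem (A.d_mem _ _ a.2), pow_succ]; simp

theorem d_mul (x y : A.carrier) : A.d (x * y) = A.d x * y + A.sgn x * A.d y := by
  induction x using DirectSum.Decomposition.inductionOn A.gr with
  | zero => simp
  | add a b ha hb => simp only [add_mul, map_add, ha, hb]; abel
  | @homogeneous i a => rw [A.leibniz i a.1 a.2, A.sgn_of_mem a.2, smul_mul_assoc]

variable {A} in
theorem Hom.map_sgn {B : ChainAlgebra K} (f : Hom A B) (x : A.carrier) :
    f.alg (A.sgn x) = B.sgn (f.alg x) := by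
  induction x using DirectSum.Decomposition.inductionOn A.gr with
  | zero => simp
  | add a b ha hb => simp [ha, hb]
  | @homogeneous i a => rw [A.sgn_of_mem a.2, B.sgn_of_mem (f.map_mem _ _ a.2), map_zsmul]

variable {A} in
/-- The algebra homomorphism `A → R` underlying a morphism to `R` concentrated in degree zero. -/
def Hom.toAlg {R : Type u} [Ring R] [Algebra K R] (f : Hom A (ofAlgebra K R)) : A.carrier →ₐ[K] R :=
  f.alg

variable {A} in
theorem Hom.aug_of_pos {R : Type u} [Ring R] [Algebra K R] (f : Hom A (ofAlgebra K R)) {n : ℕ}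
    (hn : n ≠ 0) {x : A.carrier} (hx : x ∈ A.gr n) : f.toAlg x = 0 := by
  obtain ⟨n, rfl⟩ := Nat.exists_eq_succ_of_ne_zero hn
  exact f.map_mem _ x hx

variable {A} in
theorem Hom.aug_d {R : Type u} [Ring R] [Algebra K R] (f : Hom A (ofAlgebra K R))
    (x : A.carrier) : f.toAlg (A.d x) = 0 := f.map_d x

variable {A} in
theorem Hom.aug_sgn {R : Type u} [Ring R] [Algebra K R] (f : Hom A (ofAlgebra K R))
    (x : A.carrier) : f.toAlg (A.sgn x) = f.toAlg x := by
  induction x using DirectSum.Decomposition.inductionOn A.gr with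
  | zero => simp
  | add a b ha hb => simp [ha, hb]
  | @homogeneous i a =>
    rcases i with _ | i
    · rw [A.sgn_of_mem a.2, pow_zero, one_smul]
    · rw [f.aug_of_pos (by omega) a.2, f.aug_of_pos (by omega) (A.sgn_mem a.2)]

/-- `(x₁, …, x_q) ↦ (±x₁, …, ±xᵢ₋₁, d xᵢ, xᵢ₊₁, …, x_q)`, where the sign of an element of degree `e` is
`(-1) ^ e`. The sum of these tuples over `i` represents the differential of `x₁ ⊗ ⋯ ⊗ x_q`. -/
noncomputable def slotL {q : ℕ} (i j : Fin q) : A.carrier →ₗ[K] A.carrier :=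
  if j < i then A.sgn else if j = i then A.d else LinearMap.id

/-- Composition of a function on `A ^ q` with the differential of the tensor power. -/
noncomputable def codiff {M : Type u} [AddCommGroup M] [Module K M] (q : ℕ) :
    ((Fin q → A.carrier) → M) →ₗ[K] ((Fin q → A.carrier) → M) where
  toFun f x := ∑ i : Fin q, f fun j => A.slotL i j (x j)
  map_add' f g := by funext x; simp [Finset.sum_add_distrib]
  map_smul' c f := by funext x; simp [Finset.smul_sum]

section codiff

variable {A} {M : Type u} [AddCommGroup M] [Module K M]

theorem codiff_apply (q : ℕ) (f : (Fin q → A.carrier) → M) (x : Fin q → A.carrier) :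
    A.codiff q f x = ∑ i : Fin q, f fun j => A.slotL i j (x j) := rfl

theorem codiff_multilin {q : ℕ} {f : (Fin q → A.carrier) → M} (hf : IsMultilin K f) :
    IsMultilin K (A.codiff q f) :=
  IsMultilin.sum (s := Finset.univ) (f := fun i x => f fun j => A.slotL i j (x j))
    fun i => hf.comp_linear fun j => A.slotL i j

theorem codiff_sq {q : ℕ} {f : (Fin q → A.carrier) → M} (hf : IsMultilin K f) :
    A.codiff q (A.codiff q f) = 0 := by
  have key : ∀ (x : Fin q → A.carrier) (i i' : Fin q), i' < i →
      f (fun j => A.slotL i' j (A.slotL i j (x j))) +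
        f (fun j => A.slotL i j (A.slotL i' j (x j))) = 0 := by
    intro x i i' h
    obtain ⟨l, hl⟩ := isMultilin_iff.1 hf (fun j => A.slotL i j (A.slotL i' j (x j))) i'
    have e1 : (fun j => A.slotL i j (A.slotL i' j (x j))) =
        Function.update (fun j => A.slotL i j (A.slotL i' j (x j))) i' (A.sgn (A.d (x i'))) := by
      funext j
      by_cases hj : j = i'
      · subst hj; simp [slotL, h]
      · simp [hj]
    have e2 : (fun j => A.slotL i' j (A.slotL i j (x j))) =
        Function.update (fun j => A.slotL i j (A.slotL i' j (x j))) i' (A.d (A.sgn (x i'))) := by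
      funext j
      by_cases hj : j = i'
      · subst hj; simp [slotL, h]
      · rcases lt_trichotomy j i' with h1 | h1 | h1
        · simp [hj, slotL, h1, h1.trans h]
        · exact absurd h1 hj
        · simp [hj, slotL, h1.not_gt]
    rw [e1, e2, hl, hl, d_sgn, map_neg, neg_add_cancel]
  funext x
  simp only [codiff_apply, Pi.zero_apply]
  rw [← Finset.sum_product']
  refine Finset.sum_involution (fun ij _ => (ij.2, ij.1)) ?_ ?_ ?_ ?_
  · rintro ⟨i, i'⟩ _
    rcases lt_trichotomy i' i with h | h | h
    · exact key x i i' h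
    · subst h
      have : f (fun j => A.slotL i' j (A.slotL i' j (x j))) = 0 := by
        obtain ⟨g, hg⟩ := hf
        rw [← hg]
        exact g.map_coord_zero i' (by simp [slotL, d_d])
      simp [this]
    · exact (add_comm _ _).trans (key x i' i h)
  · rintro ⟨i, i'⟩ _ h1 h2
    obtain rfl : i' = i := by simpa using congrArg Prod.fst h2
    apply h1
    obtain ⟨g, hg⟩ := hf
    change f _ = 0
    rw [← hg]
    exact g.map_coord_zero i' (by simp [slotL, d_d])
  · simp
  · simp

theorem codiff_hochB {L Rt : A.carrier → Module.End K M} (hLd : ∀ x, L (A.d x) = 0)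
    (hRd : ∀ x, Rt (A.d x) = 0) (hLs : ∀ x, L (A.sgn x) = L x) {q : ℕ}
    {f : (Fin q → A.carrier) → M} (hf : IsMultilin K f) :
    A.codiff (q + 1) (hochB L Rt q f) = hochB L Rt q (A.codiff q f) := by
  funext x
  simp only [codiff_apply, hochB_apply, Finset.sum_add_distrib, map_sum]
  congr 1
  · congr 1
    · rw [Fin.sum_univ_succ]
      simp only [slotL, lt_self_iff_false, if_false, if_true, hLd, LinearMap.zero_apply, zero_add,
        Fin.succ_pos, hLs, Fin.succ_lt_succ_iff, Fin.succ_inj]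
    · rw [Finset.sum_comm]
      refine Finset.sum_congr rfl fun l _ => ?_
      rw [← Finset.smul_sum]
      congr 1
      rw [Fin.sum_univ_succAbove _ l.castSucc]
      have key : ∀ i : Fin q,
          f (fun j => A.slotL i j (Fin.contractNth l.castSucc (· * ·) x j)) =
          f (Fin.contractNth l.castSucc (· * ·)
            fun j => A.slotL (l.castSucc.succAbove i) j (x j)) +
          if i = l then f (Fin.contractNth l.castSucc (· * ·) fun j => A.slotL l.castSucc j (x j))
          else 0 := by
        intro i
        rcases lt_trichotomy i l with h | h | h
        · rw [if_neg h.ne, add_zero, Fin.succAbove_of_castSucc_lt _ _ (by simpa using h)]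
          congr 1
          funext j
          simp only [Fin.contractNth, slotL, Fin.lt_def, Fin.ext_iff, Fin.val_castSucc,
            Fin.val_succ] at h ⊢
          split_ifs <;> first | rfl | omega
        · subst h
          rw [if_pos rfl, Fin.succAbove_castSucc_self]
          obtain ⟨g, hg⟩ := isMultilin_iff.1 hf
            (fun j => A.slotL i j (Fin.contractNth i.castSucc (· * ·) x j)) i
          have e0 : (fun j => A.slotL i j (Fin.contractNth i.castSucc (· * ·) x j)) =
              Function.update (fun j => A.slotL i j (Fin.contractNth i.castSucc (· * ·) x j)) i
                (A.d (x i.castSucc * x i.succ)) := by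
            rw [eq_comm, Function.update_eq_self_iff]
            simp [slotL, Fin.contractNth]
          have e1 : (Fin.contractNth i.castSucc (· * ·) fun j => A.slotL i.succ j (x j)) =
              Function.update (fun j => A.slotL i j (Fin.contractNth i.castSucc (· * ·) x j)) i
                (A.sgn (x i.castSucc) * A.d (x i.succ)) := by
            funext j
            simp only [Fin.contractNth, slotL, Function.update_apply, Fin.lt_def, Fin.ext_iff,
              Fin.val_castSucc, Fin.val_succ]
            split_ifs <;> first | rfl | omega | skip
            have hji : j = i := by ext; omega
            subst hji
            rfl
          have e2 : (Fin.contractNth i.castSucc (· * ·) fun j => A.slotL i.castSucc j (x j)) =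
              Function.update (fun j => A.slotL i j (Fin.contractNth i.castSucc (· * ·) x j)) i
                (A.d (x i.castSucc) * x i.succ) := by
            funext j
            simp only [Fin.contractNth, slotL, Function.update_apply, Fin.lt_def, Fin.ext_iff,
              Fin.val_castSucc, Fin.val_succ]
            split_ifs <;> first | rfl | omega | skip
            have hji : j = i := by ext; omega
            subst hji
            rfl
          rw [e0, e1, e2, hg, hg, hg, d_mul, map_add, add_comm]
        · rw [if_neg h.ne', add_zero, Fin.succAbove_of_le_castSucc _ _ (by simpa using h.le)]
          congr 1
          funext j
          simp only [Fin.contractNth, slotL, Fin.lt_def, Fin.ext_iff, Fin.val_castSucc,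
            Fin.val_succ] at h ⊢
          split_ifs <;> first | rfl | omega | exact A.sgn_mul _ _
      simp only [key, Finset.sum_add_distrib, Finset.sum_ite_eq', Finset.mem_univ, if_true]
      exact add_comm _ _
  · rw [← Finset.smul_sum]
    congr 1
    rw [Fin.sum_univ_castSucc]
    simp only [slotL, lt_self_iff_false, if_false, if_true, hRd, LinearMap.zero_apply, add_zero,
      Fin.castSucc_lt_castSucc_iff, Fin.castSucc_inj, (Fin.castSucc_lt_last _).not_gt,
      (Fin.castSucc_lt_last _).ne', LinearMap.id_apply]

/-- `f` vanishes on the elementary tensors of degree different from `n - q`, that is, `f` has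
cohomological degree `n` in the total complex. -/
def HasDegree (A : ChainAlgebra K) (n q : ℕ) (f : (Fin q → A.carrier) → M) : Prop :=
  ∀ (e : Fin q → ℕ) (x : Fin q → A.carrier), (∀ j, x j ∈ A.gr (e j)) → q + ∑ j, e j ≠ n → f x = 0

theorem codiff_hasDegree {n q : ℕ} {f : (Fin q → A.carrier) → M} (hf : IsMultilin K f)
    (h : A.HasDegree n q f) : A.HasDegree (n + 1) q (A.codiff q f) := by
  intro e x hx hn
  rw [codiff_apply]
  refine Finset.sum_eq_zero fun i _ => ?_
  rcases hi : e i with _ | m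
  · obtain ⟨g, hg⟩ := hf
    rw [← hg]
    refine g.map_coord_zero i ?_
    have := hx i
    rw [hi] at this
    simpa [slotL] using A.d_zero _ this
  · refine h (Function.update e i m) _ (fun j => ?_) ?_
    · rcases lt_trichotomy j i with hj | hj | hj
      · simpa [slotL, hj, hj.ne] using A.sgn_mem (hx j)
      · subst hj
        have := hx j
        rw [hi] at this
        simpa [slotL] using A.d_mem _ _ this
      · simpa [slotL, hj.not_gt, hj.ne'] using hx j
    · have h1 := Finset.sum_update_of_mem (Finset.mem_univ i) e m
      have h2 := Finset.sum_update_of_mem (Finset.mem_univ i) e (e i)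
      rw [Function.update_eq_self] at h2
      omega

theorem hochB_hasDegree {L Rt : A.carrier → Module.End K M}
    (hL : ∀ n, n ≠ 0 → ∀ x ∈ A.gr n, L x = 0) (hR : ∀ n, n ≠ 0 → ∀ x ∈ A.gr n, Rt x = 0)
    {n q : ℕ} {f : (Fin q → A.carrier) → M} (h : A.HasDegree n q f) :
    A.HasDegree (n + 1) (q + 1) (hochB L Rt q f) := by
  intro e x hx hn
  rw [hochB_apply]
  have h1 : L (x 0) (f fun j => x j.succ) = 0 := by
    by_cases h0 : e 0 = 0
    · rw [h (fun j => e j.succ) _ (fun j => hx j.succ), map_zero]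
      rw [Fin.sum_univ_succ] at hn
      omega
    · rw [hL _ h0 _ (hx 0), LinearMap.zero_apply]
  have h2 : Rt (x (Fin.last q)) (f fun j => x j.castSucc) = 0 := by
    by_cases h0 : e (Fin.last q) = 0
    · rw [h (fun j => e j.castSucc) _ (fun j => hx j.castSucc), map_zero]
      rw [Fin.sum_univ_castSucc] at hn
      omega
    · rw [hR _ h0 _ (hx _), LinearMap.zero_apply]
  have h3 : ∀ l : Fin q, f (Fin.contractNth l.castSucc (· * ·) x) = 0 := by
    intro l
    refine h (Fin.contractNth l.castSucc (· + ·) e) _ (fun j => ?_) ?_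
    · simp only [Fin.contractNth]
      split_ifs
      · exact hx _
      · exact SetLike.mul_mem_graded (hx _) (hx _)
      · exact hx _
    · have := prod_contractNth (C := Multiplicative ℕ) l e
      change ∑ j, Fin.contractNth l.castSucc (· + ·) e j = ∑ j, e j at this
      omega
  simp [h1, h2, h3]

end codiff

section Hochschild

variable {k : Type u} [Field k] [Algebra k K] {A} (X : AlgBimod k K) (ε : Hom A (ofAlgebra K X.R))

/-- Families of functions `A ^ q → M`, `q ≥ 0`. -/
abbrev Fam (A : ChainAlgebra K) (X : AlgBimod k K) : Type u := ∀ q : ℕ, (Fin q → A.carrier) → X.M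

/-- The left action of `A` on `M` through `ε : A → R`. -/
def lactOf (x : A.carrier) : Module.End K X.M := X.lact (ε.toAlg x)

/-- The right action of `A` on `M` through `ε : A → R`. -/
def ractOf (x : A.carrier) : Module.End K X.M := X.ract (ε.toAlg x)

/-- The part of the differential given by the Hochschild coboundary of `A`. -/
noncomputable def chainH : A.Fam X →ₗ[K] A.Fam X where
  toFun f
    | 0 => 0
    | q + 1 => hochB (lactOf X ε) (ractOf X ε) q (f q)
  map_add' f g := by funext q; cases q <;> simp
  map_smul' c f := by funext q; cases q <;> simp

/-- The part of the differential given by the differential of `A`, with the sign `(-1) ^ q`. -/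
noncomputable def chainV : A.Fam X →ₗ[K] A.Fam X where
  toFun f q := (-1 : ℤ) ^ q • A.codiff q (f q)
  map_add' f g := by funext q; simp
  map_smul' c f := by
    funext q
    simpa using smul_comm _ _ _

/-- The differential of the Hochschild complex of a chain algebra. -/
noncomputable def chainD : A.Fam X →ₗ[K] A.Fam X := chainH X ε + chainV X

/-- `⨁ Hom_K((A ⊗_K ⋯ ⊗_K A)ₘ, M)` over `q + m = n`, where there are `q` tensor factors and the index
`m` denotes the part of degree `m`: families of `K`-multilinear maps `A ^ q → M`, `q ≥ 0`, the `q`-th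
of which vanishes on elementary tensors of degree different from `n - q`. -/
def chainCochains (A : ChainAlgebra K) (X : AlgBimod k K) (n : ℕ) : Submodule K (A.Fam X) where
  carrier := {f | ∀ q, IsMultilin K (f q) ∧ A.HasDegree n q (f q)}
  zero_mem' q := ⟨IsMultilin.zero, fun _ _ _ _ => rfl⟩
  add_mem' {f g} hf hg q := ⟨(hf q).1.add (hg q).1, fun e x hx h => by
    simp [(hf q).2 e x hx h, (hg q).2 e x hx h]⟩
  smul_mem' c f hf q := ⟨(hf q).1.smul c, fun e x hx h => by simp [(hf q).2 e x hx h]⟩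

theorem chainD_mem (n : ℕ) (f : A.Fam X) (hf : f ∈ A.chainCochains X n) :
    chainD X ε f ∈ A.chainCochains X (n + 1) := by
  refine Submodule.add_mem _ (fun q => ?_) (fun q => ?_)
  · cases q with
    | zero => exact ⟨IsMultilin.zero, fun _ _ _ _ => rfl⟩
    | succ q =>
      refine ⟨hochB_isMultilin (fun m => ?_) (fun m => ?_) q _ (hf q).1,
        hochB_hasDegree (fun n hn x hx => ?_) (fun n hn x hx => ?_) (hf q).2⟩
      · exact (X.isLin_lact m).precomp ε.toAlg.toLinearMap
      · exact (X.isLin_ract m).precomp ε.toAlg.toLinearMap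
      · ext m; simp [lactOf, ε.aug_of_pos hn hx]
      · ext m; simp [ractOf, ε.aug_of_pos hn hx]
  · refine ⟨(codiff_multilin (hf q).1).zsmul _, fun e x hx h => ?_⟩
    change (-1 : ℤ) ^ q • A.codiff q (f q) x = 0
    rw [codiff_hasDegree (hf q).1 (hf q).2 e x hx h, smul_zero]

theorem chainD_sq (n : ℕ) (f : A.Fam X) (hf : f ∈ A.chainCochains X n) :
    chainD X ε (chainD X ε f) = 0 := by
  have hH : chainH X ε (chainH X ε f) = 0 := by
    funext q
    rcases q with _ | _ | q
    · rfl
    · exact map_zero (hochB (lactOf X ε) (ractOf X ε) 0)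
    · refine hochB_hochB (fun s t m => ?_) (fun s t m => ?_) (fun s t m => ?_) q (f q)
      · simp [lactOf, mul_smul]
      · simp [ractOf, mul_smul]
      · simpa [lactOf, ractOf] using smul_comm _ _ _
  have hV : chainV X (chainV X f) = 0 := by
    funext q
    change (-1 : ℤ) ^ q • A.codiff q ((-1 : ℤ) ^ q • A.codiff q (f q)) = 0
    rw [map_zsmul, codiff_sq (hf q).1, smul_zero, smul_zero]
  have hHV : chainH X ε (chainV X f) + chainV X (chainH X ε f) = 0 := by
    funext q
    rcases q with _ | q
    · change 0 + (-1 : ℤ) ^ 0 • A.codiff 0 (0 : (Fin 0 → A.carrier) → X.M) = 0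
      simp
    · change hochB (lactOf X ε) (ractOf X ε) q ((-1 : ℤ) ^ q • A.codiff q (f q)) +
        (-1 : ℤ) ^ (q + 1) • A.codiff (q + 1) (hochB (lactOf X ε) (ractOf X ε) q (f q)) = 0
      rw [map_zsmul, codiff_hochB (fun x => ?_) (fun x => ?_) (fun x => ?_) (hf q).1, pow_succ]
      · simp
      · ext m; simp [lactOf, ε.aug_d]
      · ext m; simp [ractOf, ε.aug_d]
      · ext m; simp [lactOf, ε.aug_sgn]
  simp only [chainD, LinearMap.add_apply, map_add]
  rw [hH, hV, zero_add, add_zero, add_comm, hHV]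

/-- The Hochschild cochain complex of the chain algebra `A` with coefficients in the bimodule `M`, on
which `A` acts through `ε : A → R`. -/
noncomputable def chainComplex : CochainComplex (ModuleCat.{u} K) ℕ :=
  subComplex (A.chainCochains X) (chainD X ε) (chainD_mem X ε) (chainD_sq X ε)

/-- The pullback of Hochschild cochains of `R` along `ε : A → R`. -/
def compareFam : X.HochFam →ₗ[K] A.Fam X where
  toFun f q x := f q fun j => ε.toAlg (x j)
  map_add' _ _ := rfl
  map_smul' _ _ := rfl

theorem compareFam_mem (n : ℕ) (f : X.HochFam) (hf : f ∈ X.hochCochains n) :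
    compareFam X ε f ∈ A.chainCochains X n := by
  intro q
  refine ⟨(hf q).1.comp_linear fun _ => ε.toAlg.toLinearMap, fun e x hx h => ?_⟩
  change f q (fun j => ε.toAlg (x j)) = 0
  by_cases hq : q = n
  · have : ∃ j, e j ≠ 0 := by
      by_contra! h'
      simp [h', hq] at h
    obtain ⟨j, hj⟩ := this
    obtain ⟨g, hg⟩ := (hf q).1
    rw [← hg]
    exact g.map_coord_zero j (ε.aug_of_pos hj (hx j))
  · rw [(hf q).2 hq]; rfl

theorem compareFam_comm (n : ℕ) (f : X.HochFam) (hf : f ∈ X.hochCochains n) :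
    chainD X ε (compareFam X ε f) = compareFam X ε (X.hochD f) := by
  have hV : chainV X (compareFam X ε f) = 0 := by
    funext q x
    change (-1 : ℤ) ^ q • (∑ i : Fin q, f q fun j => ε.toAlg (A.slotL i j (x j))) = 0
    rw [Finset.sum_eq_zero, smul_zero]
    intro i _
    obtain ⟨g, hg⟩ := (hf q).1
    rw [← hg]
    exact g.map_coord_zero i (by simp [slotL, ε.aug_d])
  have hH : chainH X ε (compareFam X ε f) = compareFam X ε (X.hochD f) := by
    funext q
    rcases q with _ | q
    · rfl
    · funext x
      exact hochB_pull' (L := X.lact) (Rt := X.ract) (L' := lactOf X ε) (Rt' := ractOf X ε) ε.toAlg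
        LinearMap.id (map_mul ε.toAlg) (fun _ _ => rfl) (fun _ _ => rfl) q (f q) x
  rw [chainD, LinearMap.add_apply, hV, hH, add_zero]

variable {X} {Y : AlgBimod k K} {B : ChainAlgebra K} {η : Hom B (ofAlgebra K Y.R)}

/-- The map induced on families of functions by a morphism of pairs `(R, M) → (R', M')` and a morphism
of chain algebras over it. -/
def mapFam (F : X.Hom Y) (ψ : Hom A B) : B.Fam Y →ₗ[K] A.Fam X where
  toFun f q x := F.mod (f q fun j => ψ.alg (x j))
  map_add' f g := by funext q x; simp
  map_smul' c f := by funext q x; simp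

theorem mapFam_mem (F : X.Hom Y) (ψ : Hom A B) (n : ℕ) (f : B.Fam Y)
    (hf : f ∈ B.chainCochains Y n) : mapFam F ψ f ∈ A.chainCochains X n := by
  intro q
  refine ⟨((hf q).1.comp_linear fun _ => ψ.alg.toLinearMap).comp F.mod, fun e x hx h => ?_⟩
  change F.mod (f q fun j => ψ.alg (x j)) = 0
  rw [(hf q).2 e _ (fun j => ψ.map_mem _ _ (hx j)) h, map_zero]

variable {ε}

theorem mapFam_comm (F : X.Hom Y) (ψ : Hom A B)
    (h : ∀ x, η.toAlg (ψ.alg x) = F.alg (ε.toAlg x)) (f : B.Fam Y) :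
    chainD X ε (mapFam F ψ f) = mapFam F ψ (chainD Y η f) := by
  have hV : chainV X (mapFam F ψ f) = mapFam F ψ (chainV Y f) := by
    funext q x
    have : ∀ i : Fin q, (fun j => ψ.alg (A.slotL i j (x j))) =
        fun j => B.slotL i j (ψ.alg (x j)) := by
      intro i
      funext j
      simp only [slotL]
      split_ifs
      · exact ψ.map_sgn _
      · exact ψ.map_d _
      · rfl
    change (-1 : ℤ) ^ q • (∑ i : Fin q, F.mod (f q fun j => ψ.alg (A.slotL i j (x j)))) =
      F.mod ((-1 : ℤ) ^ q • ∑ i : Fin q, f q fun j => B.slotL i j (ψ.alg (x j)))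
    rw [map_zsmul, map_sum]
    simp only [this]
  have hH : chainH X ε (mapFam F ψ f) = mapFam F ψ (chainH Y η f) := by
    funext q
    rcases q with _ | q
    · funext x; exact (map_zero F.mod).symm
    · funext x
      refine hochB_pull' (L := lactOf Y η) (Rt := ractOf Y η) (L' := lactOf X ε)
        (Rt' := ractOf X ε) ψ.alg F.mod (map_mul ψ.alg) (fun s m => ?_) (fun s m => ?_) q (f q) x
      · simp only [lactOf, AlgBimod.lact_apply, h]; exact F.map_left _ _
      · simp only [ractOf, AlgBimod.ract_apply, h]; exact F.map_right _ _
  rw [chainD, chainD, LinearMap.add_apply, LinearMap.add_apply, hV, hH, map_add]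

end Hochschild

end ChainAlgebra

section Shukla

open ChainAlgebra

variable {k K : Type u} [Field k] [CommRing K] [Algebra k K]

/-- The Shukla cohomology `Shukla ^ n(R/K, M)`, computed with the cofibrant replacement `Q` of `R`: the
Hochschild cohomology of the chain algebra `Q` with coefficients in `M`. -/
noncomputable abbrev shukla (X : AlgBimod k K) (Q : CofibrantReplacement K X.R) (n : ℕ) :
    ModuleCat.{u} K := (chainComplex X Q.aug).homology n

/-- The natural homomorphism `H ^ n(R/K, M) → Shukla ^ n(R/K, M)` induced by `Q → R`. -/
noncomputable abbrev hochToShukla (X : AlgBimod k K) (Q : CofibrantReplacement K X.R) (n : ℕ) :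
    X.hochCohomology n ⟶ shukla X Q n :=
  HomologicalComplex.homologyMap
    (subComplexMap (compareFam X Q.aug) (compareFam_mem X Q.aug) (compareFam_comm X Q.aug) :
      X.hochComplex ⟶ chainComplex X Q.aug) n

/-- The homomorphism in Shukla cohomology induced by a morphism of pairs `(R, M) → (R', M')` and a
morphism between the cofibrant replacements lying over `R → R'`. -/
noncomputable abbrev shuklaMap {X Y : AlgBimod k K} (F : X.Hom Y) {Q : CofibrantReplacement K X.R}
    {Q' : CofibrantReplacement K Y.R} (ψ : ChainAlgebra.Hom Q.alg Q'.alg)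
    (h : ∀ x, Q'.aug.toAlg (ψ.alg x) = F.alg (Q.aug.toAlg x)) (n : ℕ) :
    shukla Y Q' n ⟶ shukla X Q n :=
  HomologicalComplex.homologyMap
    (subComplexMap (mapFam F ψ) (mapFam_mem F ψ) (fun _ f _ => mapFam_comm F ψ h f) :
      chainComplex Y Q'.aug ⟶ chainComplex X Q.aug) n

end Shukla

/-! For a chain algebra $A$ with augmentation to $R$, the bicomplex has a version with $A$ in place
of $R$: its components are $\mathrm{Hom}_k(K^{\otimes pq}\otimes (A^{\otimes q})_m, M)$, and the
differential of $A$ gives a third direction. The total complex `triComplex` receives two maps. The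
augmentation induces `biToTri` from the bicomplex of $R$, and `alphaTri` embeds the Hochschild
complex of $A$ over $K$ as the $K$-multilinear cochains in the column $p=0$.

If $A\to R$ is a weak equivalence, then `biToTri` is a quasi-isomorphism. All tensor powers are over
the field $k$, so a $k$-linear contraction of $A$ onto $R$ (`nonempty_contraction`) passes to
$A^{\otimes q}$ (`Contraction.sum_slot`) and contracts the third direction (`isIso_biFam`).

If $A$ is projective over $K$, then `alphaTri` is a quasi-isomorphism. For fixed $q$ the row in the
direction of $p$ computes $\mathrm{Ext}$ over $K^{\otimes q}$ from the projective module $A^{\otimes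
q}$ to $M$, so only $\mathrm{Hom}_K(A^{\otimes_K q},M)$ in $p=0$ survives. A homogeneous dual basis
of $A$ makes this an explicit contraction of the rows (`rowHomotopy_biH_succ`,
`DGStructure.isIso_alpha`).

Both statements are instances of `isIso_homologyMap_subComplexMap`: a homotopy that contracts one
direction only deforms the identity to an endomorphism that moves a cochain closer to the image
along a finite filtration, so a power of it ends in the image.

A cofibrant replacement satisfies both conditions, because a cofibrant chain algebra is a retract of
one that is free as a module (`IsCofibrant.projective`). Hence $\theta$ is `biToTri` followed by the
inverse of `alphaTri`, and its canonicity reduces to commuting squares of cochain maps. If $R$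
itself is projective, the choice $A=R$ in degree $0$ turns $\theta\alpha$ into an isomorphism, so
$\alpha$ is one.

Cofibrant replacements are free algebras with one generator for every lifting problem to be solved;
differential, augmentation and lifts are defined by recursion on the degree of the generators
(`exists_free_resolution`, `freeChain_isCofibrant`).

In low degrees the statement on $\alpha$ is a direct computation (`exists_alphaFam_eq`): a cochain
of total degree at most $1$ whose coboundary lies in the column $p=0$ is already a Hochschild
cochain. -/

section ElementCriteria

/-! ### Cohomology of complexes of modules in terms of elements -/

variable {K : Type u} [CommRing K] {C C' : CochainComplex (ModuleCat.{u} K) ℕ}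

/-- Homology is the cokernel of the map from cochains to cycles, and cycles embed into cochains. -/
theorem homologyπ_eq_zero_iff (n : ℕ) (z : C.cycles n) :
    C.homologyπ n z = 0 ↔ ∃ y, C.d ((ComplexShape.up ℕ).prev n) n y = C.iCycles n z := by
  have hex : (ShortComplex.mk (C.toCycles ((ComplexShape.up ℕ).prev n) n) (C.homologyπ n)
      (by simp)).Exact :=
    ShortComplex.exact_of_g_is_cokernel _ (C.homologyIsCokernel _ n rfl)
  rw [ShortComplex.moduleCat_exact_iff] at hex
  have hi : Function.Injective (C.iCycles n) :=
    (ModuleCat.mono_iff_injective _).1 inferInstance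
  have ht : ∀ y, C.iCycles n (C.toCycles ((ComplexShape.up ℕ).prev n) n y) =
      C.d ((ComplexShape.up ℕ).prev n) n y := fun y => by
    rw [← C.toCycles_i]; rfl
  constructor
  · intro h
    obtain ⟨y, hy⟩ := hex z h
    exact ⟨y, by rw [← ht]; exact congrArg _ hy⟩
  · rintro ⟨y, hy⟩
    rw [← ht] at hy
    rw [← hi hy, ← ModuleCat.comp_apply]
    simp

theorem exists_cycle (n : ℕ) (x : C.X n) (hx : C.d n (n + 1) x = 0) :
    ∃ z : C.cycles n, C.iCycles n z = x := by
  have hex : (ShortComplex.mk (C.iCycles n) (C.d n (n + 1)) (by simp)).Exact :=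
    ShortComplex.exact_of_f_is_kernel _ (C.cyclesIsKernel n (n + 1) (by simp))
  rw [ShortComplex.moduleCat_exact_iff] at hex
  exact hex x hx

theorem homologyπ_surjective (n : ℕ) : Function.Surjective (C.homologyπ n) :=
  (ModuleCat.epi_iff_surjective _).1 inferInstance

variable (φ : C ⟶ C') (n : ℕ)

theorem homologyMap_homologyπ (z : C.cycles n) :
    HomologicalComplex.homologyMap φ n (C.homologyπ n z) =
      C'.homologyπ n (HomologicalComplex.cyclesMap φ n z) := by
  rw [← ModuleCat.comp_apply, HomologicalComplex.homologyπ_naturality, ModuleCat.comp_apply]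

theorem iCycles_cyclesMap (z : C.cycles n) :
    C'.iCycles n (HomologicalComplex.cyclesMap φ n z) = φ.f n (C.iCycles n z) := by
  rw [← ModuleCat.comp_apply, HomologicalComplex.cyclesMap_i, ModuleCat.comp_apply]

theorem d_iCycles (z : C.cycles n) : C.d n (n + 1) (C.iCycles n z) = 0 := by
  rw [← ModuleCat.comp_apply, HomologicalComplex.iCycles_d]
  rfl

theorem mono_homologyMap_of_elements
    (h : ∀ x, C.d n (n + 1) x = 0 → ∀ y, C'.d ((ComplexShape.up ℕ).prev n) n y = φ.f n x →
      ∃ y, C.d ((ComplexShape.up ℕ).prev n) n y = x) :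
    Mono (HomologicalComplex.homologyMap φ n) := by
  rw [ModuleCat.mono_iff_injective, injective_iff_map_eq_zero]
  intro a ha
  obtain ⟨z, rfl⟩ := homologyπ_surjective n a
  rw [homologyMap_homologyπ, homologyπ_eq_zero_iff] at ha
  obtain ⟨y, hy⟩ := ha
  rw [homologyπ_eq_zero_iff]
  exact h _ (d_iCycles n z) y (hy.trans (iCycles_cyclesMap φ n z))

theorem epi_homologyMap_of_elements
    (h : ∀ t, C'.d n (n + 1) t = 0 → ∃ x, C.d n (n + 1) x = 0 ∧
      ∃ y, C'.d ((ComplexShape.up ℕ).prev n) n y = t - φ.f n x) :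
    Epi (HomologicalComplex.homologyMap φ n) := by
  rw [ModuleCat.epi_iff_surjective]
  intro b
  obtain ⟨w, rfl⟩ := homologyπ_surjective n b
  obtain ⟨x, hx, y, hy⟩ := h _ (d_iCycles n w)
  obtain ⟨z, rfl⟩ := exists_cycle n x hx
  refine ⟨C.homologyπ n z, ?_⟩
  rw [homologyMap_homologyπ, eq_comm, ← sub_eq_zero, ← map_sub, homologyπ_eq_zero_iff]
  exact ⟨y, by rw [hy, map_sub, iCycles_cyclesMap]⟩

end ElementCriteria

/-! ### A criterion for quasi-isomorphisms -/

section SubComplex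

variable {K : Type u} [CommRing K] {P P' : Type u} [AddCommGroup P]
    [Module K P] [AddCommGroup P'] [Module K P']
    {C : ℕ → Submodule K P} {D : P →ₗ[K] P} {hD : ∀ n, ∀ f ∈ C n, D f ∈ C (n + 1)}
    {hDD : ∀ n, ∀ f ∈ C n, D (D f) = 0}
    {C' : ℕ → Submodule K P'} {D' : P' →ₗ[K] P'} {hD' : ∀ n, ∀ f ∈ C' n, D' f ∈ C' (n + 1)}
    {hDD' : ∀ n, ∀ f ∈ C' n, D' (D' f) = 0}
    (F : P →ₗ[K] P') (hF : ∀ n, ∀ f ∈ C n, F f ∈ C' n)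
    (hc : ∀ n, ∀ f ∈ C n, D' (F f) = F (D f))

/-- `t` is the coboundary of an element of degree `n - 1`. -/
def IsCoboundary (C : ℕ → Submodule K P) (D : P →ₗ[K] P) : ℕ → P → Prop
  | 0, t => t = 0
  | n + 1, t => ∃ y ∈ C n, D y = t

theorem subComplex_d_apply (n : ℕ) (x : (subComplex C D hD hDD).X n) :
    ((subComplex C D hD hDD).d n (n + 1) x : C (n + 1)) = D.restrict (hD n) x := by
  simp only [subComplex, CochainComplex.of_d]
  rfl

theorem isCoboundary_iff (n : ℕ) (x : C n) :
    (∃ y, (subComplex C D hD hDD).d ((ComplexShape.up ℕ).prev n) n y = x) ↔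
      IsCoboundary C D n x := by
  rcases n with _ | n
  -- Degree 0 has no predecessor: `prev 0` is 0 by convention and the differential from 0 to 0
  -- vanishes, so only 0 is a coboundary.
  · have h0 : (subComplex C D hD hDD).d ((ComplexShape.up ℕ).prev 0) 0 = 0 :=
      HomologicalComplex.shape _ _ _ (by simp)
    rw [h0]
    constructor
    · rintro ⟨y, hy⟩
      rw [← hy]
      rfl
    · intro h
      exact ⟨0, (Subtype.ext h : x = 0).symm⟩
  · have : (ComplexShape.up ℕ).prev (n + 1) = n := by simp
    rw [this]
    constructor
    · rintro ⟨y, hy⟩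
      rw [subComplex_d_apply] at hy
      exact ⟨_, y.2, congrArg Subtype.val hy⟩
    · rintro ⟨y, hy, h⟩
      refine ⟨(⟨y, hy⟩ : C n), ?_⟩
      exact (subComplex_d_apply n _).trans (Subtype.ext h)

theorem subComplex_d_eq_zero_iff (n : ℕ) (x : C n) :
    (subComplex C D hD hDD).d n (n + 1) x = 0 ↔ D (x : P) = 0 := by
  exact (Eq.congr (subComplex_d_apply n _) rfl).trans Subtype.ext_iff

variable {F hF hc} in
theorem mono_homologyMap_subComplexMap (n : ℕ)
    (h : ∀ x ∈ C n, D x = 0 → IsCoboundary C' D' n (F x) → IsCoboundary C D n x) :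
    Mono (HomologicalComplex.homologyMap (subComplexMap F hF hc :
      subComplex C D hD hDD ⟶ subComplex C' D' hD' hDD') n) := by
  refine mono_homologyMap_of_elements _ n fun x hx y hy => ?_
  refine (isCoboundary_iff n x).2 (h _ x.2 ((subComplex_d_eq_zero_iff n x).1 hx) ?_)
  exact (isCoboundary_iff (hD := hD') (hDD := hDD') n (F.restrict (hF n) x)).1 ⟨y, hy⟩

variable {F hF hc} in
theorem epi_homologyMap_subComplexMap (n : ℕ)
    (h : ∀ t ∈ C' n, D' t = 0 → ∃ x ∈ C n, D x = 0 ∧ IsCoboundary C' D' n (t - F x)) :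
    Epi (HomologicalComplex.homologyMap (subComplexMap F hF hc :
      subComplex C D hD hDD ⟶ subComplex C' D' hD' hDD') n) := by
  refine epi_homologyMap_of_elements _ n fun t ht => ?_
  obtain ⟨x, hx, hDx, hb⟩ := h _ t.2 ((subComplex_d_eq_zero_iff n t).1 ht)
  refine ⟨(⟨x, hx⟩ : C n), (subComplex_d_eq_zero_iff (hD := hD) (hDD := hDD) n ⟨x, hx⟩).2 hDx, ?_⟩
  exact (isCoboundary_iff (hD := hD') (hDD := hDD') n (_ - F.restrict (hF n) ⟨x, hx⟩)).2 hb

/-- A map of complexes which is injective on cochains induces isomorphisms in cohomology if there is a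
homotopy `H`, vanishing on its image, such that the endomorphism `1 - D H - H D` lowers
a filtration `V`, the lowest step of which it moves into the image. -/
theorem isIso_homologyMap_subComplexMap (H : P' →ₗ[K] P')
    (hinj : ∀ n, ∀ x ∈ C n, F x = 0 → x = 0)
    (hH : ∀ n, ∀ f ∈ C' (n + 1), H f ∈ C' n) (hH0 : ∀ f ∈ C' 0, H f = 0)
    (hHF : ∀ n, ∀ x ∈ C n, H (F x) = 0)
    (V : ℕ → ℕ → P' → Prop) (hV : ∀ n, ∃ N, ∀ f ∈ C' n, V n N f)
    (hstep : ∀ n j, ∀ f ∈ C' n, V n (j + 1) f → V n j (f - D' (H f) - H (D' f)))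
    (hlast : ∀ n, ∀ f ∈ C' n, V n 0 f → ∃ x ∈ C n, F x = f - D' (H f) - H (D' f)) (n : ℕ) :
    IsIso (HomologicalComplex.homologyMap (subComplexMap F hF hc :
      subComplex C D hD hDD ⟶ subComplex C' D' hD' hDD') n) := by
  -- `Φ` is a chain map homotopic to the identity which fixes the image of `F`; it remains to show
  -- that its powers eventually land in that image.
  set Φ : Module.End K P' := 1 - D' * H - H * D' with hΦ
  have hΦapp : ∀ f, Φ f = f - D' (H f) - H (D' f) := fun f => rfl
  have hΦmem : ∀ n, ∀ f ∈ C' n, Φ f ∈ C' n := by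
    intro n f hf
    rw [hΦapp]
    refine sub_mem (sub_mem hf ?_) (hH _ _ (hD' _ _ hf))
    rcases n with _ | n
    · rw [hH0 f hf, map_zero]
      exact zero_mem _
    · exact hD' _ _ (hH _ _ hf)
  have hΦD : ∀ n, ∀ f ∈ C' n, D' (Φ f) = Φ (D' f) := by
    intro n f hf
    rw [hΦapp, hΦapp, map_sub, map_sub, hDD' n f hf, map_zero, sub_zero]
    rcases n with _ | n
    · rw [hH0 f hf, map_zero, map_zero, sub_zero]
    · rw [hDD' _ _ (hH _ _ hf), sub_zero]
  have hpow : ∀ N n, ∀ f ∈ C' n, (Φ ^ N) f ∈ C' n ∧ D' ((Φ ^ N) f) = (Φ ^ N) (D' f) := by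
    intro N
    induction N with
    | zero => intro n f hf; exact ⟨hf, rfl⟩
    | succ N ih =>
      intro n f hf
      rw [pow_succ', Module.End.mul_apply, Module.End.mul_apply]
      obtain ⟨h1, h2⟩ := ih n f hf
      exact ⟨hΦmem n _ h1, by rw [hΦD n _ h1, h2]⟩
  have hN : ∀ n, ∀ f ∈ C' n, ∃ N, ∃ x ∈ C n, F x = (Φ ^ N) f := by
    intro n f hf
    obtain ⟨N, hN⟩ := hV n
    -- The exponent is `j + 1`: `j` applications descend the filtration to step 0, and one more
    -- moves into the image.
    have hj : ∀ j, ∀ f ∈ C' n, V n j f → ∃ x ∈ C n, F x = (Φ ^ (j + 1)) f := by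
      intro j
      induction j with
      | zero => intro f hf hv; simpa [hΦapp] using hlast n f hf hv
      | succ j ih =>
        intro f hf hv
        obtain ⟨x, hx, e⟩ := ih _ (hΦmem n f hf) (hstep n j f hf hv)
        exact ⟨x, hx, by rw [e, pow_succ _ (j + 1), Module.End.mul_apply]⟩
    exact ⟨N + 1, hj N f hf (hN f hf)⟩
  have hΦF : ∀ N n, ∀ x ∈ C n, (Φ ^ N) (F x) = F x := by
    intro N n x hx
    induction N with
    | zero => rfl
    | succ N ih =>
      rw [pow_succ', Module.End.mul_apply, ih, hΦapp, hHF n x hx, hc n x hx,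
        hHF _ _ (hD n x hx), map_zero, sub_zero, sub_zero]
  -- On cocycles `1 - Φ` is `D' H`, so the differences telescope to a coboundary. In degree 0 `H`
  -- vanishes and `Φ` fixes cocycles.
  have hcob : ∀ N n, ∀ f ∈ C' n, D' f = 0 → IsCoboundary C' D' n (f - (Φ ^ N) f) := by
    intro N n f hf h0
    rcases n with _ | n
    · have : Φ f = f := by rw [hΦapp, hH0 f hf, h0]; simp
      change f - (Φ ^ N) f = 0
      rw [sub_eq_zero]
      induction N with
      | zero => rfl
      | succ N ih => rw [pow_succ, Module.End.mul_apply, this]; exact ih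
    · induction N with
      | zero => exact ⟨0, zero_mem _, by simp⟩
      | succ N ih =>
        obtain ⟨y, hy, e⟩ := ih
        obtain ⟨h1, h2⟩ := hpow N _ f hf
        refine ⟨y + H ((Φ ^ N) f), add_mem hy (hH _ _ h1), ?_⟩
        rw [pow_succ', Module.End.mul_apply, hΦapp, h2, h0, map_add, e]
        simp only [map_zero, sub_zero]
        abel
  have hm : Mono (HomologicalComplex.homologyMap (subComplexMap F hF hc :
      subComplex C D hD hDD ⟶ subComplex C' D' hD' hDD') n) := by
    refine mono_homologyMap_subComplexMap n fun x hx _ hb => ?_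
    rcases n with _ | n
    · exact hinj 0 x hx hb
    · obtain ⟨y, hy, e⟩ := hb
      -- If `D' y = F x`, applying `Φ ^ N` leaves `F x` unchanged and replaces `y` by some `F x'`;
      -- injectivity of `F` then gives `D x' = x`.
      obtain ⟨N, x', hx', e'⟩ := hN n y hy
      refine ⟨x', hx', sub_eq_zero.1 (hinj _ _ (sub_mem (hD _ _ hx') hx) ?_)⟩
      rw [map_sub, ← hc n x' hx', e', (hpow N n y hy).2, e, hΦF N _ x hx, sub_self]
  have he : Epi (HomologicalComplex.homologyMap (subComplexMap F hF hc :
      subComplex C D hD hDD ⟶ subComplex C' D' hD' hDD') n) := by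
    refine epi_homologyMap_subComplexMap n fun t ht h0 => ?_
    obtain ⟨N, x, hx, e⟩ := hN n t ht
    refine ⟨x, hx, hinj _ _ (hD n x hx) ?_, ?_⟩
    · rw [← hc n x hx, e, (hpow N n t ht).2, h0, map_zero]
    · rw [e]
      exact hcob N n t ht h0
  exact isIso_of_mono_of_epi _

end SubComplex

/-! ### Free algebras on graded sets and their skew derivations -/

section FreeGraded

variable (K : Type u) [CommRing K] {G : Type u} (deg : G → ℕ)

/-- The homogeneous component of degree `n` of the free algebra on a graded set. -/
def freeGr (n : ℕ) : Submodule K (FreeAlgebra K G) :=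
  Submodule.span K {x | ∃ l : List G, (l.map deg).sum = n ∧ (l.map (FreeAlgebra.ι K)).prod = x}

variable {K deg}

theorem list_prod_mem_freeGr (l : List G) :
    (l.map (FreeAlgebra.ι K)).prod ∈ freeGr K deg (l.map deg).sum :=
  Submodule.subset_span ⟨l, rfl, rfl⟩

theorem ι_mem_freeGr (g : G) : FreeAlgebra.ι K g ∈ freeGr K deg (deg g) := by
  simpa using list_prod_mem_freeGr (K := K) (deg := deg) [g]

@[elab_as_elim]
theorem freeGr_induction {n : ℕ} {p : FreeAlgebra K G → Prop}
    (hl : ∀ l : List G, (l.map deg).sum = n → p (l.map (FreeAlgebra.ι K)).prod) (h0 : p 0)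
    (ha : ∀ x y, p x → p y → p (x + y)) (hs : ∀ (c : K) x, p x → p (c • x))
    {x : FreeAlgebra K G} (hx : x ∈ freeGr K deg n) : p x := by
  induction hx using Submodule.span_induction with
  | mem x h => obtain ⟨l, h, rfl⟩ := h; exact hl l h
  | zero => exact h0
  | add x y _ _ hx hy => exact ha x y hx hy
  | smul c x _ hx => exact hs c x hx

instance : SetLike.GradedMonoid (freeGr K deg) where
  one_mem := by simpa using list_prod_mem_freeGr (K := K) (deg := deg) []
  mul_mem i j x y hx hy := by
    refine freeGr_induction (fun l hl => ?_) ?_ (fun x y hx hy => ?_) (fun c x hx => ?_) hx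
    · refine freeGr_induction (fun l' hl' => ?_) ?_ (fun x y hx hy => ?_) (fun c x hx => ?_) hy
      · rw [← List.prod_append, ← List.map_append]
        convert list_prod_mem_freeGr (l ++ l')
        simp [hl, hl']
      · simp
      · rw [mul_add]; exact add_mem hx hy
      · rw [mul_smul_comm]; exact Submodule.smul_mem _ _ hx
    · simp
    · rw [add_mul]; exact add_mem hx hy
    · rw [smul_mul_assoc]; exact Submodule.smul_mem _ _ hx

/-- The decomposition of the free algebra on a graded set into homogeneous components. -/
noncomputable def freeDecompose :
    FreeAlgebra K G →ₐ[K] DirectSum ℕ fun n => freeGr K deg n :=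
  FreeAlgebra.lift K fun g =>
    DirectSum.of (fun n => freeGr K deg n) (deg g) ⟨FreeAlgebra.ι K g, ι_mem_freeGr g⟩

theorem freeDecompose_list (l : List G) : freeDecompose (l.map (FreeAlgebra.ι K)).prod =
    DirectSum.of (fun n => freeGr K deg n) (l.map deg).sum ⟨_, list_prod_mem_freeGr l⟩ := by
  induction l with
  | nil => exact map_one freeDecompose
  | cons g l ih =>
    have : freeDecompose ((g :: l).map (FreeAlgebra.ι K)).prod =
        freeDecompose (deg := deg) (FreeAlgebra.ι K g) *
          freeDecompose (l.map (FreeAlgebra.ι K)).prod := by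
      rw [List.map_cons, List.prod_cons, map_mul]
    rw [this, ih, freeDecompose, FreeAlgebra.lift_ι_apply, DirectSum.of_mul_of]
    refine DirectSum.of_eq_of_gradedMonoid_eq (Sigma.subtype_ext ?_ ?_)
    · exact List.sum_cons.symm
    · exact List.prod_cons.symm

noncomputable instance : GradedAlgebra (freeGr K deg) :=
  GradedAlgebra.ofAlgHom _ freeDecompose
    (by
      ext g
      simp [freeDecompose])
    (by
      rintro i ⟨x, hx⟩
      -- The membership proof is part of the claim, so that the induction runs over elements of the
      -- algebra and not of the submodule.
      suffices ∃ h : x ∈ freeGr K deg i, freeDecompose x =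
          DirectSum.of (fun n => freeGr K deg n) i ⟨x, h⟩ from this.2
      refine freeGr_induction (p := fun x => ∃ h : x ∈ freeGr K deg i, freeDecompose x =
          DirectSum.of (fun n => freeGr K deg n) i ⟨x, h⟩)
        (fun l hl => ?_) ?_ (fun x y hx hy => ?_) (fun c x hx => ?_) hx
      · subst hl
        exact ⟨list_prod_mem_freeGr l, freeDecompose_list l⟩
      · exact ⟨zero_mem _, by rw [map_zero]; exact (map_zero _).symm⟩
      · obtain ⟨hx, ex⟩ := hx
        obtain ⟨hy, ey⟩ := hy
        exact ⟨add_mem hx hy, by rw [map_add, ex, ey, ← map_add]; rfl⟩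
      · obtain ⟨hx, ex⟩ := hx
        refine ⟨Submodule.smul_mem _ c hx, ?_⟩
        rw [map_smul, ex]
        exact ((DirectSum.lof K ℕ (fun n => freeGr K deg n) i).map_smul c ⟨x, hx⟩).symm)

/-- Degrees are nonnegative, so a word of degree `n` contains no generator of larger degree. This
locality is what permits definitions by recursion on the degree of generators. -/
theorem freeGr_le_adjoin (n : ℕ) : freeGr K deg n ≤
    Subalgebra.toSubmodule (Algebra.adjoin K (FreeAlgebra.ι K '' {g | deg g ≤ n})) := by
  intro x hx
  refine freeGr_induction (fun l hl => ?_) (zero_mem _) (fun x y => add_mem)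
    (fun c x => Submodule.smul_mem _ c) hx
  refine Subalgebra.list_prod_mem _ fun y hy => ?_
  obtain ⟨g, hg, rfl⟩ := List.mem_map.1 hy
  refine Algebra.subset_adjoin ⟨g, ?_, rfl⟩
  rw [← hl]
  exact List.single_le_sum (fun _ _ => Nat.zero_le _) _ (List.mem_map_of_mem hg)

theorem lift_eq_of_mem_freeGr {B : Type*} [Ring B] [Algebra K B] {f f' : G → B} {n : ℕ}
    (h : ∀ g, deg g ≤ n → f g = f' g) {x : FreeAlgebra K G} (hx : x ∈ freeGr K deg n) :
    FreeAlgebra.lift K f x = FreeAlgebra.lift K f' x := by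
  have hx' := freeGr_le_adjoin n hx
  refine Algebra.adjoin_induction (fun x hx => ?_) (fun r => by simp)
    (fun x y _ _ hx hy => by simp [hx, hy]) (fun x y _ _ hx hy => by simp [hx, hy]) hx'
  obtain ⟨g, hg, rfl⟩ := hx
  simpa using h g hg

theorem lift_mem_of_mem_freeGr {B : Type*} [Ring B] [Algebra K B] {gr : ℕ → Submodule K B}
    [SetLike.GradedMonoid gr] {f : G → B} {n : ℕ}
    (h : ∀ g, deg g ≤ n → f g ∈ gr (deg g)) {x : FreeAlgebra K G} (hx : x ∈ freeGr K deg n) :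
    FreeAlgebra.lift K f x ∈ gr n := by
  refine freeGr_induction (fun l hl => ?_) (by simp)
    (fun x y hx hy => by rw [map_add]; exact add_mem hx hy)
    (fun c x hx => by rw [map_smul]; exact Submodule.smul_mem _ c hx) hx
  have key : ∀ l : List G, (∀ g ∈ l, deg g ≤ n) →
      FreeAlgebra.lift K f (l.map (FreeAlgebra.ι K)).prod ∈ gr (l.map deg).sum := by
    intro l
    induction l with
    | nil => intro _; simpa using SetLike.GradedOne.one_mem (A := gr)
    | cons g l ih =>
      intro hg
      simp only [List.map_cons, List.prod_cons, map_mul, FreeAlgebra.lift_ι_apply, List.sum_cons]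
      exact SetLike.mul_mem_graded (h g (hg g (by simp))) (ih fun g' h' => hg g' (by simp [h']))
  rw [← hl]
  refine key l fun g hg => ?_
  rw [← hl]
  exact List.single_le_sum (fun _ _ => Nat.zero_le _) _ (List.mem_map_of_mem hg)

variable (K deg)

/-- The sign automorphism of the free algebra on a graded set. -/
noncomputable def freeSgn : FreeAlgebra K G →ₐ[K] FreeAlgebra K G :=
  FreeAlgebra.lift K fun g => (-1 : ℤ) ^ deg g • FreeAlgebra.ι K g

theorem freeSgn_of_mem {n : ℕ} {x : FreeAlgebra K G} (hx : x ∈ freeGr K deg n) :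
    freeSgn K deg x = (-1 : ℤ) ^ n • x := by
  refine freeGr_induction (fun l hl => ?_) (by simp)
    (fun x y hx hy => by rw [map_add, hx, hy, smul_add])
    (fun c x hx => by rw [map_smul, hx, smul_comm]) hx
  subst hl
  clear hx
  induction l with
  | nil => simp
  | cons g l ih =>
    simp only [List.map_cons, List.prod_cons, map_mul, List.sum_cons, pow_add]
    rw [ih, freeSgn, FreeAlgebra.lift_ι_apply, smul_mul_smul_comm]

/-- The matrix representation whose upper right entry is the skew derivation extending `δ`. -/
noncomputable def skewMat (δ : G → FreeAlgebra K G) :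
    FreeAlgebra K G →ₐ[K] Matrix (Fin 2) (Fin 2) (FreeAlgebra K G) :=
  FreeAlgebra.lift K fun g =>
    !![freeSgn K deg (FreeAlgebra.ι K g), δ g; 0, FreeAlgebra.ι K g]

/-- The skew derivation of the free algebra on a graded set which extends `δ`. -/
noncomputable def freeD (δ : G → FreeAlgebra K G) : FreeAlgebra K G →ₗ[K] FreeAlgebra K G :=
  Matrix.entryLinearMap K _ 0 1 ∘ₗ (skewMat K deg δ).toLinearMap

variable {K deg} {δ : G → FreeAlgebra K G}

theorem freeD_eq (x : FreeAlgebra K G) : freeD K deg δ x = skewMat K deg δ x 0 1 := rfl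

@[simp] theorem freeD_ι (g : G) : freeD K deg δ (FreeAlgebra.ι K g) = δ g := by
  simp [freeD_eq, skewMat]

/-- Upper triangular matrices with diagonal `(s(x), x)` multiply so that the corner of a product is
`s(x) δ(y) + δ(x) y`. An algebra homomorphism into matrices of this form is therefore the same as a
skew derivation, and the universal property of the free algebra supplies it. -/
theorem skewMat_apply (x : FreeAlgebra K G) : skewMat K deg δ x =
    !![freeSgn K deg x, freeD K deg δ x; 0, x] := by
  suffices skewMat K deg δ x 0 0 = freeSgn K deg x ∧ skewMat K deg δ x 1 0 = 0 ∧
      skewMat K deg δ x 1 1 = x by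
    ext i j
    fin_cases i <;> fin_cases j <;> simp [this, freeD_eq]
  induction x using FreeAlgebra.induction with
  | grade0 r => simp [Matrix.algebraMap_matrix_apply]
  | grade1 g => simp [skewMat]
  | mul a b ha hb => simp [Matrix.mul_apply, Fin.sum_univ_two, ha, hb]
  | add a b ha hb => simp [ha, hb]

theorem freeD_mul (x y : FreeAlgebra K G) : freeD K deg δ (x * y) =
    freeD K deg δ x * y + freeSgn K deg x * freeD K deg δ y := by
  rw [freeD_eq, map_mul, skewMat_apply, skewMat_apply]
  simp [Matrix.mul_apply, Fin.sum_univ_two, add_comm]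

@[simp] theorem freeD_algebraMap (r : K) : freeD K deg δ (algebraMap K _ r) = 0 := by
  simp [freeD_eq, Matrix.algebraMap_matrix_apply]

theorem freeD_eq_of_mem_freeGr {δ' : G → FreeAlgebra K G} {n : ℕ}
    (h : ∀ g, deg g ≤ n → δ g = δ' g) {x : FreeAlgebra K G} (hx : x ∈ freeGr K deg n) :
    freeD K deg δ x = freeD K deg δ' x := by
  rw [freeD_eq, freeD_eq, skewMat, skewMat]
  rw [lift_eq_of_mem_freeGr (fun g hg => ?_) hx]
  rw [h g hg]

/-- The elements of degree `n` which may occur as differentials of elements of degree `n`. -/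
def shiftGr (n : ℕ) : Submodule K (FreeAlgebra K G) := n.casesOn ⊥ (freeGr K deg)

/-- Since `shiftGr` is zero at 0 and is the component of degree `n` at `n + 1`, this contains both
that the differential lowers degrees by one and that it vanishes in degree 0. -/
theorem freeD_mem_shiftGr (hδ : ∀ g, δ g ∈ shiftGr (K := K) (deg := deg) (deg g)) {n : ℕ}
    {x : FreeAlgebra K G} (hx : x ∈ freeGr K deg n) :
    freeD K deg δ x ∈ shiftGr (K := K) (deg := deg) n := by
  refine freeGr_induction (fun l hl => ?_) (by simp)
    (fun x y hx hy => by rw [map_add]; exact add_mem hx hy)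
    (fun c x hx => by rw [map_smul]; exact Submodule.smul_mem _ c hx) hx
  subst hl
  clear hx
  have hr : ∀ (i j : ℕ) (x y : FreeAlgebra K G), x ∈ shiftGr (K := K) (deg := deg) i →
      y ∈ freeGr K deg j → x * y ∈ shiftGr (K := K) (deg := deg) (i + j) := by
    rintro (_ | i) j x y hx hy
    · rw [show x = 0 from hx, zero_mul]; exact zero_mem _
    · rw [Nat.succ_add]; exact SetLike.mul_mem_graded (A := freeGr K deg) hx hy
  have hl : ∀ (i j : ℕ) (x y : FreeAlgebra K G), x ∈ freeGr K deg i →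
      y ∈ shiftGr (K := K) (deg := deg) j → x * y ∈ shiftGr (K := K) (deg := deg) (i + j) := by
    rintro i (_ | j) x y hx hy
    · rw [show y = 0 from hy, mul_zero]; exact zero_mem _
    · rw [Nat.add_succ]; exact SetLike.mul_mem_graded (A := freeGr K deg) hx hy
  induction l with
  | nil =>
    have := freeD_algebraMap (deg := deg) (δ := δ) (1 : K)
    rw [map_one] at this
    simp [this]
  | cons g l ih =>
    simp only [List.map_cons, List.prod_cons, List.sum_cons]
    rw [freeD_mul, freeD_ι, freeSgn_of_mem K deg (ι_mem_freeGr g)]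
    exact add_mem (hr _ _ _ _ (hδ g) (list_prod_mem_freeGr l))
      (hl _ _ _ _ (zsmul_mem (ι_mem_freeGr g) _) ih)

/-- The differential changes the parity of the degree. -/
theorem freeD_freeSgn (hδ : ∀ g, δ g ∈ shiftGr (K := K) (deg := deg) (deg g))
    (x : FreeAlgebra K G) :
    freeD K deg δ (freeSgn K deg x) = -freeSgn K deg (freeD K deg δ x) := by
  induction x using FreeAlgebra.induction with
  | grade0 r => simp
  | grade1 g =>
    rw [freeSgn_of_mem K deg (ι_mem_freeGr g), map_zsmul, freeD_ι]
    have := hδ g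
    rcases hg : deg g with _ | n
    · rw [hg] at this
      rw [show δ g = 0 from this]; simp
    · rw [hg] at this
      rw [freeSgn_of_mem K deg (n := n) this, pow_succ]
      simp
  | mul a b ha hb =>
    simp only [map_mul, freeD_mul, map_add, ha, hb]
    noncomm_ring
  | add a b ha hb => simp only [map_add, ha, hb]; abel

/-- In `d(d(ab))` the two mixed terms cancel because `d` anticommutes with the sign, so the
vanishing of `d d` passes from generators to products. -/
theorem freeD_freeD (hδ : ∀ g, δ g ∈ shiftGr (K := K) (deg := deg) (deg g))
    (hδδ : ∀ g, freeD K deg δ (δ g) = 0) (x : FreeAlgebra K G) :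
    freeD K deg δ (freeD K deg δ x) = 0 := by
  induction x using FreeAlgebra.induction with
  | grade0 r => simp
  | grade1 g => rw [freeD_ι, hδδ]
  | mul a b ha hb =>
    simp only [freeD_mul, map_add, ha, hb, freeD_freeSgn hδ]
    simp
  | add a b ha hb => simp only [map_add, ha, hb, add_zero]

/-- The chain algebra which is free as a graded algebra on a graded set of generators, with
differential extending `δ`. -/
noncomputable abbrev freeChain (δ : G → FreeAlgebra K G)
    (hδ : ∀ g, δ g ∈ shiftGr (K := K) (deg := deg) (deg g))
    (hδδ : ∀ g, freeD K deg δ (δ g) = 0) : ChainAlgebra K where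
  carrier := FreeAlgebra K G
  gr := freeGr K deg
  d := freeD K deg δ
  d_mem n x hx := freeD_mem_shiftGr hδ hx
  d_zero x hx := freeD_mem_shiftGr hδ hx
  d_d := freeD_freeD hδ hδδ
  leibniz n x hx y := by rw [freeD_mul, freeSgn_of_mem K deg hx, smul_mul_assoc]

end FreeGraded

/-! ### Homogeneous components and lifting along trivial fibrations -/

namespace ChainAlgebra

variable {K : Type u} [CommRing K] (A : ChainAlgebra K)

/-- The projection onto the component of degree `n`. -/
noncomputable def proj (n : ℕ) : A.carrier →ₗ[K] A.carrier :=
  (A.gr n).subtype ∘ₗ DirectSum.component K ℕ (fun n => A.gr n) n ∘ₗ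
    (DirectSum.decomposeLinearEquiv A.gr).toLinearMap

theorem proj_mem (n : ℕ) (x : A.carrier) : A.proj n x ∈ A.gr n :=
  (DirectSum.decompose A.gr x n).2

theorem proj_of_mem {n : ℕ} {x : A.carrier} (hx : x ∈ A.gr n) : A.proj n x = x :=
  DirectSum.decompose_of_mem_same _ hx

theorem proj_of_mem_ne {m n : ℕ} {x : A.carrier} (hx : x ∈ A.gr m) (h : m ≠ n) :
    A.proj n x = 0 :=
  DirectSum.decompose_of_mem_ne _ hx h

theorem mem_of_proj_mem {S : AddSubmonoid A.carrier} {x : A.carrier}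
    (h : ∀ n, A.proj n x ∈ S) : x ∈ S := by
  classical
  rw [← DirectSum.sum_support_decompose A.gr x]
  exact sum_mem fun n _ => h n

variable {A} in
-- Stated for additive maps so that it serves linear maps over `K` and over `k` alike.
theorem linearMap_ext {N : Type*} [AddCommMonoid N] {f g : A.carrier →+ N}
    (h : ∀ n, ∀ x ∈ A.gr n, f x = g x) (x : A.carrier) : f x = g x := by
  induction x using DirectSum.Decomposition.inductionOn A.gr with
  | zero => rw [map_zero, map_zero]
  | add a b ha hb => rw [map_add, map_add, ha, hb]
  | @homogeneous i a => exact h i a a.2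

theorem d_proj (n : ℕ) (x : A.carrier) : A.d (A.proj (n + 1) x) = A.proj n (A.d x) := by
  refine linearMap_ext (f := (A.d ∘ₗ A.proj (n + 1)).toAddMonoidHom)
    (g := (A.proj n ∘ₗ A.d).toAddMonoidHom) (fun m x hx => ?_) x
  change A.d (A.proj (n + 1) x) = A.proj n (A.d x)
  rcases m with _ | m
  · rw [A.d_zero x hx, A.proj_of_mem_ne hx (by omega), map_zero, map_zero]
  · by_cases h : m = n
    · subst h
      rw [A.proj_of_mem hx, A.proj_of_mem (A.d_mem _ _ hx)]
    · rw [A.proj_of_mem_ne hx (by omega), A.proj_of_mem_ne (A.d_mem _ _ hx) h, map_zero]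

theorem d_proj_eq_zero {x : A.carrier} (hx : A.d x = 0) (n : ℕ) : A.d (A.proj n x) = 0 := by
  rcases n with _ | n
  · exact A.d_zero _ (A.proj_mem 0 x)
  · rw [d_proj, hx, map_zero]

variable {A} {B : ChainAlgebra K}

theorem Hom.map_proj (f : Hom A B) (n : ℕ) (x : A.carrier) :
    f.alg (A.proj n x) = B.proj n (f.alg x) := by
  refine linearMap_ext (f := (f.alg.toLinearMap ∘ₗ A.proj n).toAddMonoidHom)
    (g := (B.proj n ∘ₗ f.alg.toLinearMap).toAddMonoidHom) (fun m x hx => ?_) x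
  change f.alg (A.proj n x) = B.proj n (f.alg x)
  by_cases h : m = n
  · subst h
    rw [A.proj_of_mem hx, B.proj_of_mem (f.map_mem _ _ hx)]
  · rw [A.proj_of_mem_ne hx h, B.proj_of_mem_ne (f.map_mem _ _ hx) h, map_zero]

theorem exists_homogeneous_primitive {n : ℕ} {x : A.carrier} (hx : x ∈ A.gr n)
    (h : ∃ y, A.d y = x) : ∃ y ∈ A.gr (n + 1), A.d y = x := by
  obtain ⟨y, rfl⟩ := h
  exact ⟨A.proj (n + 1) y, A.proj_mem _ _, by rw [d_proj, A.proj_of_mem hx]⟩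

/-- Injectivity and surjectivity on total homology, spelled out on representatives; these need not
be homogeneous. -/
theorem Hom.isWeakEquiv_iff (f : Hom A B) : f.IsWeakEquiv ↔
    (∀ x, A.d x = 0 → (∃ b, B.d b = f.alg x) → ∃ y, A.d y = x) ∧
    ∀ b, B.d b = 0 → ∃ x, A.d x = 0 ∧ ∃ b', B.d b' = f.alg x - b := by
  have hmk : ∀ x (hx : A.d x = 0), f.homologyMap (Submodule.Quotient.mk ⟨x, hx⟩) =
      Submodule.Quotient.mk ⟨f.alg x, by rw [LinearMap.mem_ker, ← f.map_d, hx, map_zero]⟩ :=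
    fun _ _ => rfl
  refine and_congr ?_ ?_
  · rw [injective_iff_map_eq_zero]
    constructor
    · intro h x hx hb
      have := h (Submodule.Quotient.mk ⟨x, hx⟩) (by
        rw [hmk, Submodule.Quotient.mk_eq_zero]
        exact hb)
      rw [Submodule.Quotient.mk_eq_zero] at this
      exact this
    · intro h a ha
      obtain ⟨⟨x, hx⟩, rfl⟩ := Submodule.Quotient.mk_surjective _ a
      rw [hmk x hx, Submodule.Quotient.mk_eq_zero] at ha
      rw [Submodule.Quotient.mk_eq_zero]
      exact h x hx ha
  · constructor
    · intro h b hb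
      obtain ⟨a, ha⟩ := h (Submodule.Quotient.mk ⟨b, hb⟩)
      obtain ⟨⟨x, hx⟩, rfl⟩ := Submodule.Quotient.mk_surjective _ a
      rw [hmk x hx, Submodule.Quotient.eq] at ha
      exact ⟨x, hx, ha⟩
    · intro h a
      obtain ⟨⟨b, hb⟩, rfl⟩ := Submodule.Quotient.mk_surjective _ a
      obtain ⟨x, hx, hb'⟩ := h b hb
      refine ⟨Submodule.Quotient.mk ⟨x, hx⟩, ?_⟩
      rw [hmk x hx, Submodule.Quotient.eq]
      exact hb'

/-- Homogeneous cycles lift along trivial fibrations. -/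
theorem Hom.exists_lift_cycle {p : Hom A B} (hp : p.IsFibration) (hw : p.IsWeakEquiv) {n : ℕ}
    {b : B.carrier} (hb : b ∈ B.gr n) (hd : B.d b = 0) :
    ∃ a ∈ A.gr n, A.d a = 0 ∧ p.alg a = b := by
  obtain ⟨x, hx, b', hb'⟩ := ((p.isWeakEquiv_iff).1 hw).2 b hd
  -- The weak equivalence lifts `b` only up to the boundary of some `b'`. The component of `b'` that
  -- matters has degree `n + 1 > 0`, so it lifts along the fibration and its boundary corrects the
  -- error; this works for `n = 0` as well.
  obtain ⟨y, hy, e⟩ := hp (n + 1) n.succ_pos (B.proj (n + 1) b') (B.proj_mem _ _)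
  refine ⟨A.proj n x - A.d y, sub_mem (A.proj_mem _ _) (A.d_mem _ _ hy), ?_, ?_⟩
  · rw [map_sub, A.d_d, A.d_proj_eq_zero hx, sub_zero]
  · rw [map_sub, p.map_proj, p.map_d, e, d_proj, hb', map_sub, B.proj_of_mem hb]
    abel

/-- Elements with prescribed boundary lift along trivial fibrations. -/
theorem Hom.exists_lift {p : Hom A B} (hp : p.IsFibration) (hw : p.IsWeakEquiv) {n : ℕ}
    {b : B.carrier} (hb : b ∈ B.gr (n + 1)) {z : A.carrier} (hz : z ∈ A.gr n) (hdz : A.d z = 0)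
    (hpz : p.alg z = B.d b) : ∃ a ∈ A.gr (n + 1), A.d a = z ∧ p.alg a = b := by
  obtain ⟨y, hy, hyz⟩ := exists_homogeneous_primitive hz
    (((p.isWeakEquiv_iff).1 hw).1 z hdz ⟨b, hpz.symm⟩)
  -- A primitive `y` of `z` has the right boundary, and its image differs from `b` by a cycle, which
  -- lifts to a cycle.
  obtain ⟨x, hx, hdx, hpx⟩ := p.exists_lift_cycle hp hw (sub_mem hb (p.map_mem _ _ hy))
    (by rw [map_sub, ← p.map_d, hyz, hpz, sub_self])
  exact ⟨y + x, add_mem hy hx, by rw [map_add, hdx, hyz, add_zero],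
    by rw [map_add, hpx, add_sub_cancel]⟩

end ChainAlgebra

/-! ### Recursion on the degree; free chain algebras are cofibrant -/

/-- An operator on functions whose values on a point depend only on the values of its argument on points
of smaller degree has a fixed point. -/
theorem exists_fixed_of_local {G Y : Type*} [Nonempty Y] (deg : G → ℕ) (T : (G → Y) → G → Y)
    (hT : ∀ u v g, (∀ g', deg g' < deg g → u g' = v g') → T u g = T v g) : ∃ u, T u = u := by
  inhabit Y
  -- The iterates of `T` become constant at `g` after `deg g + 1` steps; the stable values form the
  -- fixed point.
  have key : ∀ m n g, deg g < m → deg g < n → T^[m] default g = T^[n] default g := by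
    intro m
    induction m with
    | zero => intro n g h; omega
    | succ m ih =>
      rintro (_ | n) g h1 h2
      · omega
      · rw [Function.iterate_succ_apply', Function.iterate_succ_apply']
        exact hT _ _ _ fun g' h => ih n g' (by omega) (by omega)
  refine ⟨fun g => T^[deg g + 1] default g, funext fun g => ?_⟩
  rw [Function.iterate_succ_apply']
  exact hT _ _ _ fun g' h => key _ _ _ (by omega) h

section FreeChain

open ChainAlgebra

variable {K : Type u} [CommRing K] {G : Type u} {deg : G → ℕ} {δ : G → FreeAlgebra K G}
  {hδ : ∀ g, δ g ∈ shiftGr (K := K) (deg := deg) (deg g)} {hδδ : ∀ g, freeD K deg δ (δ g) = 0}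

theorem lift_freeSgn {B : ChainAlgebra K} {φ : G → B.carrier} {n : ℕ}
    (hφ : ∀ g, deg g ≤ n → φ g ∈ B.gr (deg g))
    {x : FreeAlgebra K G} (hx : x ∈ Algebra.adjoin K (FreeAlgebra.ι K '' {g | deg g ≤ n})) :
    FreeAlgebra.lift K φ (freeSgn K deg x) = B.sgn (FreeAlgebra.lift K φ x) := by
  have h1 : B.sgn 1 = 1 := by
    rw [B.sgn_of_mem (n := 0) SetLike.GradedOne.one_mem]; simp
  refine Algebra.adjoin_induction (fun x hx => ?_) (fun r => ?_)
    (fun x y _ _ hx hy => by simp [hx, hy]) (fun x y _ _ hx hy => ?_) hx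
  · obtain ⟨g, hg, rfl⟩ := hx
    rw [freeSgn_of_mem K deg (ι_mem_freeGr g), map_zsmul, FreeAlgebra.lift_ι_apply,
      B.sgn_of_mem (hφ g hg)]
  · rw [AlgHom.commutes, AlgHom.commutes, Algebra.algebraMap_eq_smul_one, map_smul, h1]
  · rw [map_mul, map_mul, hx, hy, map_mul, B.sgn_mul]

theorem ChainAlgebra.d_one (B : ChainAlgebra K) : B.d 1 = 0 :=
  B.d_zero _ SetLike.GradedOne.one_mem

/-- Both sides are skew derivations along the lift, so it suffices to compare them on generators.
The bound on the degrees allows the use of this while a morphism is under construction and only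
generators of smaller degree are controlled. -/
theorem lift_freeD {B : ChainAlgebra K} {φ : G → B.carrier} {n : ℕ}
    (hφ : ∀ g, deg g ≤ n → φ g ∈ B.gr (deg g))
    (hφd : ∀ g, deg g ≤ n → FreeAlgebra.lift K φ (δ g) = B.d (φ g))
    {x : FreeAlgebra K G} (hx : x ∈ freeGr K deg n) :
    FreeAlgebra.lift K φ (freeD K deg δ x) = B.d (FreeAlgebra.lift K φ x) := by
  refine Algebra.adjoin_induction (fun x hx => ?_) (fun r => ?_)
    (fun x y _ _ hx hy => by simp [hx, hy]) (fun x y hx' _ hx hy => ?_) (freeGr_le_adjoin n hx)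
  · obtain ⟨g, hg, rfl⟩ := hx
    rw [freeD_ι, FreeAlgebra.lift_ι_apply, hφd g hg]
  · rw [freeD_algebraMap, map_zero, AlgHom.commutes, Algebra.algebraMap_eq_smul_one, map_smul,
      B.d_one, smul_zero]
  · rw [freeD_mul, map_add, map_mul, map_mul, hx, hy, lift_freeSgn hφ hx', map_mul, B.d_mul]

/-- The morphism from a free chain algebra determined by the images of the generators. -/
noncomputable def freeChainLift {B : ChainAlgebra K} (φ : G → B.carrier)
    (hφ : ∀ g, φ g ∈ B.gr (deg g)) (hφd : ∀ g, FreeAlgebra.lift K φ (δ g) = B.d (φ g)) :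
    Hom (freeChain δ hδ hδδ) B where
  alg := FreeAlgebra.lift K φ
  map_mem n x hx := lift_mem_of_mem_freeGr (fun g _ => hφ g) hx
  map_d x := by
    refine linearMap_ext (A := freeChain δ hδ hδδ)
      (f := ((FreeAlgebra.lift K φ).toLinearMap ∘ₗ freeD K deg δ).toAddMonoidHom)
      (g := (B.d ∘ₗ (FreeAlgebra.lift K φ).toLinearMap).toAddMonoidHom) (fun n x hx => ?_) x
    exact lift_freeD (fun g _ => hφ g) (fun g _ => hφd g) hx

theorem shiftGr_succ_eq (n : ℕ) : shiftGr (K := K) (deg := deg) (n + 1) = freeGr K deg n := rfl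

/-- A lift is built in the order of the degrees of the generators. The boundary of a generator
involves only smaller generators, hence is already lifted, to a cycle; a trivial fibration allows a
lift of the generator with this prescribed boundary. -/
theorem freeChain_isCofibrant : (freeChain δ hδ hδδ).IsCofibrant := by
  classical
  intro E B p hp hw f
  -- `P h g e`: the value `e` at `g` is admissible, given the values of `h` on the generators
  -- occurring in `δ g`.
  set P : (G → E.carrier) → G → E.carrier → Prop := fun h g e =>
    e ∈ E.gr (deg g) ∧ E.d e = FreeAlgebra.lift K h (δ g) ∧ p.alg e = f.alg (FreeAlgebra.ι K g)
    with hP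
  -- The default value 0 only serves to make the recursion total; `key` shows that an admissible
  -- value always exists for the fixed point.
  obtain ⟨h, hh⟩ := exists_fixed_of_local (Y := E.carrier) deg
    (fun h g => if H : ∃ e, P h g e then H.choose else 0) (fun u v g huv => by
      have : P u g = P v g := by
        funext e
        have h1 : FreeAlgebra.lift K u (δ g) = FreeAlgebra.lift K v (δ g) := by
          have := hδ g
          rcases hg : deg g with _ | n
          · rw [hg] at this
            rw [show δ g = 0 from this, map_zero, map_zero]
          · rw [hg, shiftGr_succ_eq] at this
            exact lift_eq_of_mem_freeGr (fun g' h' => huv g' (by omega)) this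
        simp only [hP, h1]
      simp only [this])
  have key : ∀ n g, deg g = n → P h g (h g) := by
    intro n
    induction n using Nat.strong_induction_on with
    | _ n ih =>
      intro g hg
      suffices H : ∃ e, P h g e by
        have : h g = H.choose := by
          conv_lhs => rw [← hh]
          exact dif_pos H
        rw [this]
        exact H.choose_spec
      have hfg : f.alg (FreeAlgebra.ι K g) ∈ B.gr (deg g) := f.map_mem _ _ (ι_mem_freeGr g)
      have hfd : f.alg (δ g) = B.d (f.alg (FreeAlgebra.ι K g)) := by
        exact (congrArg f.alg (freeD_ι g).symm).trans (f.map_d _)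
      have hm := hδ g
      rcases n with _ | n
      · rw [hg] at hm
        have h0 : δ g = 0 := hm
        rw [h0, map_zero] at hfd
        obtain ⟨e, he, hde, hpe⟩ := p.exists_lift_cycle hp hw hfg hfd.symm
        exact ⟨e, he, by rw [hde, h0, map_zero], hpe⟩
      · rw [hg, shiftGr_succ_eq] at hm
        have hg1 : ∀ g', deg g' ≤ n → h g' ∈ E.gr (deg g') := fun g' h' =>
          (ih _ (by omega) g' rfl).1
        have hg2 : ∀ g', deg g' ≤ n → FreeAlgebra.lift K h (δ g') = E.d (h g') := fun g' h' =>
          (ih _ (by omega) g' rfl).2.1.symm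
        -- The partial lift is compatible with `p` on generators of degree at most `n`, hence on `δ
        -- g`, which lies in the subalgebra that they generate.
        have hp' : p.alg (FreeAlgebra.lift K h (δ g)) = f.alg (δ g) := by
          refine Algebra.adjoin_induction (p := fun x _ => p.alg (FreeAlgebra.lift K h x) = f.alg x)
            (fun x hx => ?_) (fun r => ?_) (fun x y _ _ hx hy => ?_)
            (fun x y _ _ hx hy => ?_) (freeGr_le_adjoin n hm)
          · obtain ⟨g', h', rfl⟩ := hx
            rw [FreeAlgebra.lift_ι_apply]
            exact (ih _ (Nat.lt_succ_of_le h') g' rfl).2.2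
          · rw [AlgHom.commutes, AlgHom.commutes]
            exact (f.alg.commutes r).symm
          · rw [map_add, map_add, hx, hy]
            exact (map_add f.alg x y).symm
          · rw [map_mul, map_mul, hx, hy]
            exact (map_mul f.alg x y).symm
        obtain ⟨e, he, hde, hpe⟩ := p.exists_lift hp hw (n := n) (hg ▸ hfg)
          (lift_mem_of_mem_freeGr hg1 hm)
          (by rw [← lift_freeD hg1 hg2 hm, hδδ, map_zero]) (hp'.trans hfd)
        exact ⟨e, by rw [hg]; exact he, hde, hpe⟩
  refine ⟨freeChainLift h (fun g => (key _ g rfl).1) (fun g => (key _ g rfl).2.1.symm), ?_⟩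
  have : (p.comp (freeChainLift (hδ := hδ) (hδδ := hδδ) h (fun g => (key _ g rfl).1)
      (fun g => (key _ g rfl).2.1.symm))).alg = f.alg := by
    refine FreeAlgebra.hom_ext (funext fun g => ?_)
    change p.alg (FreeAlgebra.lift K h (FreeAlgebra.ι K g)) = f.alg (FreeAlgebra.ι K g)
    rw [FreeAlgebra.lift_ι_apply]
    exact (key _ g rfl).2.2
  cases f
  simp only [Hom.comp] at this ⊢
  congr

end FreeChain

/-! ### Existence of cofibrant replacements; cofibrant algebras are projective -/

open ChainAlgebra

/-- A set `G` that is infinite and at least as large as `K` and `B` has the cardinality of its own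
free algebra over `K`, up to inequality, so `G` can index all triples of a degree, an element of
that free algebra and an element of `B`. All generators of a resolution can thus be adjoined at
once. -/
theorem exists_surjective_code (K B : Type u) [CommRing K] [Nonempty B] :
    ∃ (G : Type u) (code : G → ℕ × FreeAlgebra K G × B), Function.Surjective code := by
  refine ⟨ULift.{u} ℕ ⊕ K ⊕ B, ?_⟩
  have hG : Cardinal.aleph0 ≤ Cardinal.mk (ULift.{u} ℕ ⊕ K ⊕ B) := by simp
  have hK : Cardinal.mk K ≤ Cardinal.mk (ULift.{u} ℕ ⊕ K ⊕ B) :=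
    Cardinal.mk_le_of_injective (f := fun x => Sum.inr (Sum.inl x)) fun x y h => by simpa using h
  have hB : Cardinal.mk B ≤ Cardinal.mk (ULift.{u} ℕ ⊕ K ⊕ B) :=
    Cardinal.mk_le_of_injective (f := fun x => Sum.inr (Sum.inr x)) fun x y h => by simpa using h
  have hF : Cardinal.mk (FreeAlgebra K (ULift.{u} ℕ ⊕ K ⊕ B)) ≤
      Cardinal.mk (ULift.{u} ℕ ⊕ K ⊕ B) :=
    (FreeAlgebra.cardinalMk_le_max K _).trans (max_le (max_le hK le_rfl) hG)
  have h : Cardinal.mk (ULift.{u} ℕ × FreeAlgebra K (ULift.{u} ℕ ⊕ K ⊕ B) × B) ≤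
      Cardinal.mk (ULift.{u} ℕ ⊕ K ⊕ B) := by
    rw [Cardinal.mk_prod, Cardinal.mk_prod, Cardinal.lift_id, Cardinal.lift_id, Cardinal.lift_id,
      Cardinal.lift_id]
    refine Cardinal.mul_le_of_le hG (by simp) (Cardinal.mul_le_of_le hG hF hB)
  obtain ⟨f⟩ := Cardinal.le_def _ _ |>.1 h
  refine ⟨Prod.map ULift.down id ∘ Function.invFun f, Function.Surjective.comp ?_
    (Function.invFun_surjective f.injective)⟩
  rintro ⟨n, z, b⟩
  exact ⟨⟨⟨n⟩, z, b⟩, rfl⟩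

variable {K : Type u} [CommRing K]

/-- Every chain algebra is the target of a trivial fibration from a cofibrant chain algebra which is
free as a module. -/
theorem exists_free_resolution (B : ChainAlgebra K) :
    ∃ (A : ChainAlgebra K) (p : Hom A B), p.IsFibration ∧ p.IsWeakEquiv ∧ A.IsCofibrant ∧
      Module.Free K A.carrier := by
  classical
  obtain ⟨G, code, hcode⟩ := exists_surjective_code K B.carrier
  set deg : G → ℕ := fun g => (code g).1 with hdeg
  -- The function `u` assigns to a generator its boundary and its image in `B`. A generator with
  -- code `(n, z, b)` is good if these may be `z` and `b`: `z` is a cycle in the degree below `n`,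
  -- `b` has degree `n`, and the image of `z` is `d b`.
  set Good : (G → FreeAlgebra K G × B.carrier) → G → Prop := fun u g =>
    (code g).2.1 ∈ shiftGr (K := K) (deg := deg) (deg g) ∧
      freeD K deg (fun g => (u g).1) (code g).2.1 = 0 ∧ (code g).2.2 ∈ B.gr (deg g) ∧
      FreeAlgebra.lift K (fun g => (u g).2) (code g).2.1 = B.d (code g).2.2 with hGood
  -- Whether a code is good depends only on smaller generators. Generators with a bad code get
  -- boundary 0 and image 0, which is harmless.
  obtain ⟨u, hu⟩ := exists_fixed_of_local deg (fun u g => if Good u g then (code g).2 else 0)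
    (fun u v g huv => by
      have : Good u g ↔ Good v g := by
        refine and_congr_right fun hz => ?_
        rcases hg : deg g with _ | n
        · rw [hg] at hz
          rw [show (code g).2.1 = 0 from hz]
          simp
        · rw [hg, shiftGr_succ_eq] at hz
          rw [freeD_eq_of_mem_freeGr (fun g' h' => ?_) hz, lift_eq_of_mem_freeGr (fun g' h' => ?_) hz]
          · rw [huv g' (by omega)]
          · rw [huv g' (by omega)]
      simp only [this])
  have hgood : ∀ g, Good u g → u g = (code g).2 := fun g h => by
    conv_lhs => rw [← hu]
    exact if_pos h
  have hbad : ∀ g, ¬ Good u g → u g = 0 := fun g h => by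
    conv_lhs => rw [← hu]
    exact if_neg h
  have hδ : ∀ g, (u g).1 ∈ shiftGr (K := K) (deg := deg) (deg g) := by
    intro g
    by_cases h : Good u g
    · rw [hgood g h]; exact h.1
    · rw [hbad g h]; exact zero_mem _
  have hδδ : ∀ g, freeD K deg (fun g => (u g).1) (u g).1 = 0 := by
    intro g
    by_cases h : Good u g
    · rw [hgood g h]; exact h.2.1
    · rw [hbad g h]; exact map_zero _
  have hφ : ∀ g, (u g).2 ∈ B.gr (deg g) := by
    intro g
    by_cases h : Good u g
    · rw [hgood g h]; exact h.2.2.1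
    · rw [hbad g h]; exact zero_mem _
  have hφd : ∀ g, FreeAlgebra.lift K (fun g => (u g).2) (u g).1 = B.d (u g).2 := by
    intro g
    by_cases h : Good u g
    · rw [hgood g h]; exact h.2.2.2
    · rw [hbad g h]; exact (map_zero _).trans (map_zero _).symm
  set A : ChainAlgebra K := freeChain (fun g => (u g).1) hδ hδδ with hA
  set p : Hom A B := freeChainLift (fun g => (u g).2) hφ hφd with hp
  -- Every such lifting problem is solved by the generator that codes it.
  have hcyc : ∀ n, ∀ z ∈ shiftGr (K := K) (deg := deg) n, A.d z = 0 → ∀ b ∈ B.gr n,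
      p.alg z = B.d b → ∃ x ∈ A.gr n, A.d x = z ∧ p.alg x = b := by
    intro n z hz hdz b hb hpz
    obtain ⟨g, hg⟩ := hcode (n, z, b)
    have hn : deg g = n := congrArg Prod.fst hg
    have h : Good u g := by
      simp only [hGood, hn, hg]
      exact ⟨hz, hdz, hb, hpz⟩
    have hug := (hgood g h).trans (congrArg Prod.snd hg)
    refine ⟨FreeAlgebra.ι K g, hn ▸ ι_mem_freeGr g, ?_, ?_⟩
    · exact (freeD_ι g).trans (congrArg Prod.fst hug)
    · exact (FreeAlgebra.lift_ι_apply _ g).trans (congrArg Prod.snd hug)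
  have hsurj : ∀ n, ∀ b ∈ B.gr n, B.d b = 0 → ∃ x ∈ A.gr n, A.d x = 0 ∧ p.alg x = b :=
    fun n b hb hdb => hcyc n 0 (zero_mem _) (map_zero _) b hb ((map_zero _).trans hdb.symm)
  refine ⟨A, p, ?_, ?_, freeChain_isCofibrant, inferInstanceAs (Module.Free K (FreeAlgebra K G))⟩
  · rintro (_ | n) hn b hb
    · omega
    -- For surjectivity in positive degree, `d b` is first lifted to a cycle `z`; then `b` lifts to
    -- an element with boundary `z`.
    · obtain ⟨z, hz, hdz, hpz⟩ := hsurj n (B.d b) (B.d_mem _ _ hb) (B.d_d b)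
      obtain ⟨x, hx, -, hpx⟩ := hcyc (n + 1) z hz hdz b hb hpz
      exact ⟨x, hx, hpx⟩
  · rw [Hom.isWeakEquiv_iff]
    constructor
    · rintro x hx ⟨b, hb⟩
      refine A.mem_of_proj_mem (S := (LinearMap.range A.d).toAddSubmonoid) (x := x) fun n => ?_
      -- A cycle whose image bounds is bounded, in each degree, by a generator with this cycle as
      -- prescribed boundary.
      obtain ⟨y, -, hy, -⟩ := hcyc (n + 1) (A.proj n x) (A.proj_mem n x) (d_proj_eq_zero A hx n)
        (B.proj (n + 1) b) (B.proj_mem _ _) (by rw [p.map_proj, d_proj, hb])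
      exact ⟨y, hy⟩
    · intro b hb
      suffices b ∈ Submodule.map p.alg.toLinearMap (LinearMap.ker A.d) by
        obtain ⟨x, hx, rfl⟩ := this
        exact ⟨x, hx, 0, by simp⟩
      refine B.mem_of_proj_mem (S := (Submodule.map p.alg.toLinearMap
        (LinearMap.ker A.d)).toAddSubmonoid) fun n => ?_
      obtain ⟨x, -, hx, hpx⟩ := hsurj n _ (B.proj_mem n b) (d_proj_eq_zero B hb n)
      exact ⟨x, hx, hpx⟩

/-- Lifting the identity through a trivial fibration from a free chain algebra exhibits the module
as a retract of a free one. -/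
theorem ChainAlgebra.IsCofibrant.projective {A : ChainAlgebra K} (hA : A.IsCofibrant) :
    Module.Projective K A.carrier := by
  obtain ⟨E, p, hp, hw, -, hE⟩ := exists_free_resolution A
  let i : Hom A A := ⟨AlgHom.id K A.carrier, fun _ _ h => h, fun _ => rfl⟩
  obtain ⟨s, hs⟩ := hA E A p hp hw i
  refine Module.Projective.of_split s.alg.toLinearMap p.alg.toLinearMap ?_
  ext x
  exact congrArg (fun f : Hom A A => f.alg x) hs

theorem nonempty_cofibrantReplacement (R : Type u) [Ring R] [Algebra K R] :
    Nonempty (CofibrantReplacement K R) := by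
  obtain ⟨A, p, -, hw, hA, -⟩ := exists_free_resolution (ofAlgebra K R)
  exact ⟨⟨A, p, hA, hw⟩⟩

/-! ### Change of scalars and the Leibniz rule on tensor powers -/

namespace ChainAlgebra

section RestrictScalars

variable (k : Type u) {K : Type u} [CommRing k] [CommRing K] [Algebra k K] (A : ChainAlgebra K)

/-- A chain algebra over `K`, regarded as a chain algebra over `k`. -/
noncomputable abbrev restrictScalars [Algebra k A.carrier] [IsScalarTower k K A.carrier] :
    ChainAlgebra k where
  carrier := A.carrier
  gr n := (A.gr n).restrictScalars k
  d := A.d.restrictScalars k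
  d_mem := A.d_mem
  d_zero := A.d_zero
  d_d := A.d_d
  leibniz := A.leibniz

variable [Algebra k A.carrier] [IsScalarTower k K A.carrier]

/-- The sign depends on the grading only. Together with the next two facts this makes the results on
`codiff` available for cochains that are multilinear over `k` only. -/
theorem restrictScalars_sgn (x : A.carrier) : (A.restrictScalars k).sgn x = A.sgn x := by
  refine linearMap_ext (f := ((A.restrictScalars k).sgn.toAddMonoidHom : A.carrier →+ A.carrier))
    (g := A.sgn.toAddMonoidHom) (fun n x hx => ?_) x
  exact ((A.restrictScalars k).sgn_of_mem hx).trans (A.sgn_of_mem hx).symm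

theorem restrictScalars_slotL {q : ℕ} (i j : Fin q) (x : A.carrier) :
    (A.restrictScalars k).slotL i j x = A.slotL i j x := by
  simp only [slotL]
  split_ifs
  · exact restrictScalars_sgn k A x
  · rfl
  · rfl

variable {M : Type u} [AddCommGroup M] [Module k M] [Module K M]

theorem restrictScalars_codiff {q : ℕ} (f : (Fin q → A.carrier) → M) :
    (A.restrictScalars k).codiff q f = A.codiff q f := by
  funext x
  exact Finset.sum_congr (s₁ := Finset.univ) rfl fun i _ =>
    congrArg f (funext fun j => restrictScalars_slotL k A i j (x j))

end RestrictScalars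

variable {K : Type u} [CommRing K] {A : ChainAlgebra K}

/-- Multiplication of two adjacent factors is a chain map, by the Leibniz rule. -/
theorem sum_contractNth_slotL {κ M : Type*} [CommRing κ] [Module κ A.carrier] [AddCommGroup M]
    [Module κ M] {q : ℕ} {f : (Fin q → A.carrier) → M} (hf : IsMultilin κ f) (l : Fin q)
    (x : Fin (q + 1) → A.carrier) :
    ∑ i, f (Fin.contractNth l.castSucc (· * ·) fun j => A.slotL i j (x j)) =
      ∑ i, f fun j => A.slotL i j (Fin.contractNth l.castSucc (· * ·) x j) := by
  rw [Fin.sum_univ_succAbove _ l.castSucc]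
  -- After the slot `l` has been split off, `succAbove` matches the other slots with those after
  -- multiplication. Slot `i = l` on the right stands for the product and accounts for both slots
  -- `l` and `l + 1` on the left, whence the extra term.
  have key : ∀ i : Fin q,
      f (fun j => A.slotL i j (Fin.contractNth l.castSucc (· * ·) x j)) =
      f (Fin.contractNth l.castSucc (· * ·)
        fun j => A.slotL (l.castSucc.succAbove i) j (x j)) +
      if i = l then f (Fin.contractNth l.castSucc (· * ·) fun j => A.slotL l.castSucc j (x j))
      else 0 := by
    intro i
    rcases lt_trichotomy i l with h | h | h
    · rw [if_neg h.ne, add_zero, Fin.succAbove_of_castSucc_lt _ _ (by simpa using h)]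
      congr 1
      funext j
      simp only [Fin.contractNth, slotL, Fin.lt_def, Fin.ext_iff, Fin.val_castSucc,
        Fin.val_succ] at h ⊢
      split_ifs <;> first | rfl | omega
    · subst h
      rw [if_pos rfl, Fin.succAbove_castSucc_self]
      obtain ⟨g, hg⟩ := isMultilin_iff.1 hf
        (fun j => A.slotL i j (Fin.contractNth i.castSucc (· * ·) x j)) i
      have e0 : (fun j => A.slotL i j (Fin.contractNth i.castSucc (· * ·) x j)) =
          Function.update (fun j => A.slotL i j (Fin.contractNth i.castSucc (· * ·) x j)) i
            (A.d (x i.castSucc * x i.succ)) := by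
        rw [eq_comm, Function.update_eq_self_iff]
        simp [slotL, Fin.contractNth]
      have e1 : (Fin.contractNth i.castSucc (· * ·) fun j => A.slotL i.succ j (x j)) =
          Function.update (fun j => A.slotL i j (Fin.contractNth i.castSucc (· * ·) x j)) i
            (A.sgn (x i.castSucc) * A.d (x i.succ)) := by
        funext j
        simp only [Fin.contractNth, slotL, Function.update_apply, Fin.lt_def, Fin.ext_iff,
          Fin.val_castSucc, Fin.val_succ]
        split_ifs <;> first | rfl | omega | skip
        have hji : j = i := by ext; omega
        subst hji
        rfl
      have e2 : (Fin.contractNth i.castSucc (· * ·) fun j => A.slotL i.castSucc j (x j)) =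
          Function.update (fun j => A.slotL i j (Fin.contractNth i.castSucc (· * ·) x j)) i
            (A.d (x i.castSucc) * x i.succ) := by
        funext j
        simp only [Fin.contractNth, slotL, Function.update_apply, Fin.lt_def, Fin.ext_iff,
          Fin.val_castSucc, Fin.val_succ]
        split_ifs <;> first | rfl | omega | skip
        have hji : j = i := by ext; omega
        subst hji
        rfl
      rw [e0, e1, e2, hg, hg, hg, d_mul, map_add, add_comm]
    · rw [if_neg h.ne', add_zero, Fin.succAbove_of_le_castSucc _ _ (by simpa using h.le)]
      congr 1
      funext j
      simp only [Fin.contractNth, slotL, Fin.lt_def, Fin.ext_iff, Fin.val_castSucc,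
        Fin.val_succ] at h ⊢
      split_ifs <;> first | rfl | omega | exact A.sgn_mul _ _
  simp only [key, Finset.sum_add_distrib, Finset.sum_ite_eq', Finset.mem_univ, if_true]
  exact add_comm _ _

/-- A multilinear map which vanishes on homogeneous arguments is zero. -/
theorem eq_zero_of_homogeneous {κ M : Type*} [CommRing κ] [Module κ A.carrier] [AddCommGroup M]
    [Module κ M] {q : ℕ} {f : (Fin q → A.carrier) → M} (hf : IsMultilin κ f)
    (h : ∀ (e : Fin q → ℕ) x, (∀ j, x j ∈ A.gr (e j)) → f x = 0) : f = 0 := by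
  classical
  obtain ⟨g, hg⟩ := hf
  funext x
  have hx : x = fun j => ∑ n ∈ (DirectSum.decompose A.gr (x j)).support,
      (DirectSum.decompose A.gr (x j) n : A.carrier) :=
    funext fun j => (DirectSum.sum_support_decompose A.gr (x j)).symm
  rw [← hg, hx, MultilinearMap.map_sum_finset]
  exact Finset.sum_eq_zero fun e _ => (hg _).trans (h e _ fun j => SetLike.coe_mem _)

end ChainAlgebra

/-! ### The triple complex of a chain algebra -/

namespace AlgBimod

variable {k K : Type u} [Field k] [CommRing K] [Algebra k K]

/-- The structure of a chain algebra on `R` such that elements of positive degree and boundaries act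
trivially on `M`. -/
structure DGStructure (Y : AlgBimod k K) where
  gr : ℕ → Submodule K Y.R
  [graded : GradedAlgebra gr]
  d : Y.R →ₗ[K] Y.R
  d_mem : ∀ n, ∀ x ∈ gr (n + 1), d x ∈ gr n
  d_zero : ∀ x ∈ gr 0, d x = 0
  d_d : ∀ x, d (d x) = 0
  leibniz : ∀ n, ∀ x ∈ gr n, ∀ y, d (x * y) = d x * y + (-1 : ℤ) ^ n • (x * d y)
  smul_of_pos : ∀ n ≠ 0, ∀ x ∈ gr n, ∀ m : Y.M, x • m = 0
  op_smul_of_pos : ∀ n ≠ 0, ∀ x ∈ gr n, ∀ m : Y.M, MulOpposite.op x • m = 0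
  d_smul : ∀ (x : Y.R) (m : Y.M), d x • m = 0
  op_d_smul : ∀ (x : Y.R) (m : Y.M), MulOpposite.op (d x) • m = 0

namespace DGStructure

open ChainAlgebra

attribute [instance] graded

variable {Y : AlgBimod k K} (A : Y.DGStructure)

/-- The underlying chain algebra. -/
abbrev toChain : ChainAlgebra K where
  carrier := Y.R
  gr := A.gr
  d := A.d
  d_mem := A.d_mem
  d_zero := A.d_zero
  d_d := A.d_d
  leibniz := A.leibniz

/-- The sign is visible only in positive degrees, which act by zero. -/
theorem sgn_smul (x : Y.R) (m : Y.M) : (A.toChain.sgn x : Y.R) • m = x • m := by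
  refine ChainAlgebra.linearMap_ext (A := A.toChain)
    (f := ((LinearMap.toSpanSingleton Y.R Y.M m).restrictScalars K ∘ₗ A.toChain.sgn).toAddMonoidHom)
    (g := ((LinearMap.toSpanSingleton Y.R Y.M m).restrictScalars K).toAddMonoidHom)
    (fun n x hx => ?_) x
  change (A.toChain.sgn x : Y.R) • m = x • m
  rcases n with _ | n
  · rw [A.toChain.sgn_of_mem hx, pow_zero, one_smul]
  · rw [A.smul_of_pos _ n.succ_ne_zero _ hx, A.smul_of_pos _ n.succ_ne_zero _ (A.toChain.sgn_mem hx)]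

/-- The slot maps are `K`-linear, so they commute with scaling the arguments by the last row. -/
theorem codiff_horiz (p q : ℕ)
    (f : (Fin p → Fin q → K) → (Fin q → Y.R) → Y.M)
    (a : Fin (p + 1) → Fin q → K) :
    A.toChain.codiff q (Y.horiz p q f a) =
      Y.horiz p q (fun a => A.toChain.codiff q (f a)) a := by
  funext r
  simp only [codiff_apply, horiz_apply, Finset.sum_add_distrib, map_smul, Finset.smul_sum]
  rw [Finset.sum_comm]

/-- The two outer terms match because boundaries act trivially and signs are invisible to the
action; the inner ones match by the Leibniz rule. -/
theorem codiff_vert (p q : ℕ)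
    (f : (Fin p → Fin q → K) → (Fin q → Y.R) → Y.M)
    (hf : ∀ a, IsMultilin k (f a)) (a : Fin p → Fin (q + 1) → K) :
    A.toChain.codiff (q + 1) (Y.vert p q f a) =
      Y.vert p q (fun a => A.toChain.codiff q (f a)) a := by
  funext r
  simp only [codiff_apply, vert_apply, Finset.sum_add_distrib]
  congr 1
  · congr 1
    · rw [Fin.sum_univ_succ]
      simp only [slotL, lt_self_iff_false, if_false, if_true, A.d_smul,
        smul_zero, zero_add, Fin.succ_pos, A.sgn_smul, Fin.succ_lt_succ_iff, Fin.succ_inj,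
        Finset.smul_sum]
    · rw [Finset.sum_comm]
      refine Finset.sum_congr rfl fun l _ => ?_
      rw [← Finset.smul_sum]
      congr 1
      exact sum_contractNth_slotL (hf _) l r
  · rw [← Finset.smul_sum]
    congr 1
    rw [Fin.sum_univ_castSucc]
    simp only [slotL, lt_self_iff_false, if_false, if_true, A.op_d_smul, smul_zero, add_zero,
      Fin.castSucc_lt_castSucc_iff, Fin.castSucc_inj, (Fin.castSucc_lt_last _).not_gt,
      (Fin.castSucc_lt_last _).ne', LinearMap.id_apply, Finset.smul_sum]

/-- The part of the differential given by the differential of `A`. -/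
noncomputable def triI : Y.BiFam →ₗ[K] Y.BiFam where
  toFun f p q a := (-1 : ℤ) ^ (p + q) • A.toChain.codiff q (f p q a)
  map_add' f g := by funext p q a; simp
  map_smul' c f := by
    funext p q a
    simpa using smul_comm _ _ _

/-- The differential of the complex `K ^ ***(K, A, M)`. -/
noncomputable def triD : Y.BiFam →ₗ[K] Y.BiFam :=
  Y.biD + A.triI

/-- `⨁ Hom_k(K ^ ⊗(p q) ⊗ (A ^ ⊗q)ₘ, M)` over `p + q + m = n`. -/
def triCochains (n : ℕ) : Submodule K Y.BiFam where
  carrier := {f | ∀ p q, (∀ a, IsMultilin k (f p q a)) ∧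
    (∀ r, IsMultilin k fun x : Fin p × Fin q → K => f p q (fun i j => x (i, j)) r) ∧
    ∀ a (e : Fin q → ℕ) (x : Fin q → Y.R), (∀ j, x j ∈ A.gr (e j)) →
      p + q + ∑ j, e j ≠ n → f p q a x = 0}
  zero_mem' p q := ⟨fun _ => IsMultilin.zero, fun _ => IsMultilin.zero, fun _ _ _ _ _ => rfl⟩
  add_mem' {f g} hf hg p q := ⟨fun a => ((hf p q).1 a).add ((hg p q).1 a),
    fun r => ((hf p q).2.1 r).add ((hg p q).2.1 r), fun a e x hx h => by
      simp [(hf p q).2.2 a e x hx h, (hg p q).2.2 a e x hx h]⟩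
  smul_mem' c f hf p q := ⟨fun a => ((hf p q).1 a).smul c, fun r => ((hf p q).2.1 r).smul c,
    fun a e x hx h => by simp [(hf p q).2.2 a e x hx h]⟩

theorem sum_contractNth {q : ℕ} (l : Fin q) (e : Fin (q + 1) → ℕ) :
    ∑ j, Fin.contractNth l.castSucc (· + ·) e j = ∑ j, e j :=
  prod_contractNth (C := Multiplicative ℕ) l e

theorem biH_mem_triCochains {n : ℕ} {f : Y.BiFam} (hf : f ∈ A.triCochains n) :
    Y.biH f ∈ A.triCochains (n + 1) := by
  rintro (_ | p) q
  · exact ⟨fun _ => IsMultilin.zero, fun _ => IsMultilin.zero, fun _ _ _ _ _ => rfl⟩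
  · obtain ⟨h1, h2, h3⟩ := hf p q
    obtain ⟨h4, h5⟩ := Y.horiz_multilin h1 h2
    refine ⟨h4, h5, fun a e x hx h => ?_⟩
    change Y.horiz p q (f p q) a x = 0
    rw [horiz_apply, h3 _ e x hx (by omega), h3 _ e _ (fun j => ?_) (by omega),
      Finset.sum_eq_zero fun l _ => ?_]
    · simp
    · rw [h3 _ e x hx (by omega), smul_zero]
    · exact Submodule.smul_mem _ _ (hx j)

theorem biV_mem_triCochains {n : ℕ} {f : Y.BiFam} (hf : f ∈ A.triCochains n) :
    Y.biV f ∈ A.triCochains (n + 1) := by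
  rintro p (_ | q)
  · exact ⟨fun _ => IsMultilin.zero, fun _ => IsMultilin.zero, fun _ _ _ _ _ => rfl⟩
  · obtain ⟨h1, h2, h3⟩ := hf p q
    obtain ⟨h4, h5⟩ := Y.vert_multilin h1 h2
    refine ⟨fun a => (h4 a).zsmul _, fun r => (h5 r).zsmul _, fun a e x hx h => ?_⟩
    change (-1 : ℤ) ^ p • Y.vert p q (f p q) a x = 0
    rw [vert_apply]
    -- Either `x 0` has degree 0 and the remaining arguments have the wrong total degree, or `x 0`
    -- has positive degree and annihilates `M`.
    have e1 : x 0 • f p q (fun i j => a i j.succ) (fun j => x j.succ) = 0 := by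
      by_cases h0 : e 0 = 0
      · rw [Fin.sum_univ_succ] at h
        rw [h3 _ (fun j => e j.succ) _ (fun j => hx j.succ) (by omega), smul_zero]
      · exact A.smul_of_pos _ h0 _ (hx 0) _
    have e2 : MulOpposite.op (x (Fin.last q)) •
        f p q (fun i j => a i j.castSucc) (fun j => x j.castSucc) = 0 := by
      by_cases h0 : e (Fin.last q) = 0
      · rw [Fin.sum_univ_castSucc] at h
        rw [h3 _ (fun j => e j.castSucc) _ (fun j => hx j.castSucc) (by omega), smul_zero]
      · exact A.op_smul_of_pos _ h0 _ (hx _) _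
    rw [e1, e2, Finset.sum_eq_zero fun l _ => ?_]
    · simp
    · rw [h3 _ (Fin.contractNth l.castSucc (· + ·) e) _ (fun j => ?_) ?_, smul_zero]
      · rw [sum_contractNth]; omega
      · simp only [Fin.contractNth]
        split_ifs
        · exact hx _
        · exact SetLike.mul_mem_graded (hx _) (hx _)
        · exact hx _

theorem triI_mem_triCochains {n : ℕ} {f : Y.BiFam} (hf : f ∈ A.triCochains n) :
    A.triI f ∈ A.triCochains (n + 1) := by
  intro p q
  obtain ⟨h1, h2, h3⟩ := hf p q
  refine ⟨fun a => IsMultilin.zsmul ?_ _, fun r => IsMultilin.zsmul ?_ _, fun a e x hx h => ?_⟩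
  · rw [← restrictScalars_codiff k (A := A.toChain) (M := Y.M)]
    exact codiff_multilin (A := A.toChain.restrictScalars k) (h1 a)
  · exact IsMultilin.sum (s := Finset.univ) (f := fun i x => f p q (fun i j => x (i, j))
      fun j => A.toChain.slotL i j (r j)) fun i => h2 _
  · change (-1 : ℤ) ^ (p + q) • A.toChain.codiff q (f p q a) x = 0
    -- The subtraction is truncated: for `p > n` the cochain has no admissible degree and vanishes,
    -- which is treated separately below.
    have hd : (A.toChain.restrictScalars k).HasDegree (n - p) q (f p q a) := fun e x hx h' => by
      by_cases hpn : p ≤ n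
      · exact h3 a e x hx (by omega)
      · exact h3 a e x hx (by omega)
    rw [← restrictScalars_codiff k (A := A.toChain) (M := Y.M)]
    by_cases hpn : p ≤ n
    · rw [codiff_hasDegree (h1 a) hd e x hx (by omega), smul_zero]
    · have : f p q a = 0 := eq_zero_of_homogeneous (A := A.toChain) (h1 a) fun e x hx =>
        h3 a e x hx (by omega)
      rw [this, map_zero]
      simp

theorem triD_mem (n : ℕ) (f : Y.BiFam) (hf : f ∈ A.triCochains n) :
    A.triD f ∈ A.triCochains (n + 1) :=
  add_mem (add_mem (A.biH_mem_triCochains hf) (A.biV_mem_triCochains hf))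
    (A.triI_mem_triCochains hf)

/-- `codiff` commutes with the unsigned differentials `horiz` and `vert`. Both raise `p + q` by one,
so the sign `(-1) ^ (p + q)` turns this into anticommutation. -/
theorem triD_sq (n : ℕ) (f : Y.BiFam) (hf : f ∈ A.triCochains n) :
    A.triD (A.triD f) = 0 := by
  have hI : A.triI (A.triI f) = 0 := by
    funext p q a
    change (-1 : ℤ) ^ (p + q) • A.toChain.codiff q ((-1 : ℤ) ^ (p + q) • A.toChain.codiff q (f p q a)) = 0
    rw [map_zsmul, ← restrictScalars_codiff k (A := A.toChain) (M := Y.M),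
      ← restrictScalars_codiff k (A := A.toChain) (M := Y.M),
      codiff_sq (A := A.toChain.restrictScalars k) ((hf p q).1 a), smul_zero, smul_zero]
  have hH : A.triI (Y.biH f) + Y.biH (A.triI f) = 0 := by
    funext p q a
    rcases p with _ | p
    · change (-1 : ℤ) ^ (0 + q) • A.toChain.codiff q (0 : (Fin q → Y.R) → Y.M) + 0 = 0
      simp
    · change (-1 : ℤ) ^ (p + 1 + q) • A.toChain.codiff q (Y.horiz p q (f p q) a) +
        Y.horiz p q ((-1 : ℤ) ^ (p + q) • fun a => A.toChain.codiff q (f p q a)) a = 0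
      rw [map_zsmul, codiff_horiz, add_right_comm, pow_succ]
      simp
  have hV : A.triI (Y.biV f) + Y.biV (A.triI f) = 0 := by
    funext p q a
    rcases q with _ | q
    · change (-1 : ℤ) ^ (p + 0) • A.toChain.codiff 0 (0 : (Fin 0 → Y.R) → Y.M) + 0 = 0
      simp
    · change (-1 : ℤ) ^ (p + (q + 1)) • A.toChain.codiff (q + 1)
          ((-1 : ℤ) ^ p • Y.vert p q (f p q) a) +
        (-1 : ℤ) ^ p • Y.vert p q
          ((-1 : ℤ) ^ (p + q) • fun a => A.toChain.codiff q (f p q a)) a = 0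
      rw [map_zsmul, map_zsmul, A.codiff_vert p q _ (hf p q).1, ← add_assoc, pow_succ, Pi.smul_apply,
        smul_comm ((-1 : ℤ) ^ p)]
      simp
  have hB := Y.biD_sq f
  have : A.triD (A.triD f) = Y.biD (Y.biD f) +
      (A.triI (Y.biH f) + Y.biH (A.triI f)) +
      (A.triI (Y.biV f) + Y.biV (A.triI f)) +
      A.triI (A.triI f) := by
    simp only [triD, biD, LinearMap.add_apply, map_add]
    abel
  rw [this, hB, hH, hV, hI]
  simp

/-- The total complex of `K ^ ***(K, A, M)`. -/
noncomputable def triComplex : CochainComplex (ModuleCat.{u} K) ℕ :=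
  subComplex A.triCochains A.triD A.triD_mem A.triD_sq

end DGStructure

end AlgBimod

/-! ### Homogeneous dual bases and the expansion of tensors -/

theorem IsMultilin.eq_zero {κ ι V M : Type*} [CommRing κ] [AddCommGroup V] [Module κ V]
    [AddCommGroup M] [Module κ M] {f : (ι → V) → M}
    (hf : IsMultilin κ f) (c : ι → V) (j : ι) (h : c j = 0) : f c = 0 := by
  obtain ⟨f', hf⟩ := hf
  rw [← hf]
  exact f'.map_coord_zero j h

/-- A dual basis `x = ∑ σ(x)ᵢ vᵢ` of a graded projective module consisting of homogeneous elements. -/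
structure GradedDualBasis {K R : Type u} [CommRing K] [AddCommGroup R] [Module K R]
    (gr : ℕ → Submodule K R) where
  ι : Type u
  v : ι → R
  w : ι → ℕ
  v_mem : ∀ i, v i ∈ gr (w i)
  σ : R →ₗ[K] (ι →₀ K)
  sum_eq : ∀ x, Finsupp.linearCombination K v (σ x) = x
  degree_eq : ∀ n, ∀ x ∈ gr n, ∀ i, σ x i ≠ 0 → w i = n

/-- A section `s` of the canonical map from the free module on `A` to `A` is made homogeneous: on
degree `n` the basis vector of `x` is relabelled `(x, n)` and stands for the component of `x` in
degree `n`. Projecting the expansion by `s` to degree `n` shows that the new expansion is still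
correct. -/
theorem ChainAlgebra.nonempty_gradedDualBasis {K : Type u} [CommRing K] (A : ChainAlgebra K)
    [Module.Projective K A.carrier] : Nonempty (GradedDualBasis A.gr) := by
  classical
  obtain ⟨s, hs⟩ := Module.projective_def'.1 (inferInstance : Module.Projective K A.carrier)
  let σ : A.carrier →ₗ[K] (A.carrier × ℕ →₀ K) :=
    DirectSum.toModule K ℕ _ (fun n =>
      Finsupp.lmapDomain K K (fun x : A.carrier => (x, n)) ∘ₗ s ∘ₗ (A.gr n).subtype) ∘ₗ
      (DirectSum.decomposeLinearEquiv A.gr).toLinearMap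
  have hσ : ∀ n, ∀ x ∈ A.gr n, σ x = Finsupp.mapDomain (fun x : A.carrier => (x, n)) (s x) := by
    intro n x hx
    lift x to A.gr n using hx
    simp only [σ, LinearMap.comp_apply, LinearEquiv.coe_coe, DirectSum.decomposeLinearEquiv_apply,
      DirectSum.decompose_coe]
    exact DirectSum.toModule_lof (M := fun n => A.gr n) K n x
  refine ⟨⟨A.carrier × ℕ, fun i => A.proj i.2 i.1, Prod.snd, fun i => A.proj_mem _ _, σ, ?_, ?_⟩⟩
  · refine ChainAlgebra.linearMap_ext (f := (Finsupp.linearCombination K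
      (fun i : A.carrier × ℕ => A.proj i.2 i.1) ∘ₗ σ).toAddMonoidHom) (g := AddMonoidHom.id _)
      fun n x hx => ?_
    change Finsupp.linearCombination K (fun i : A.carrier × ℕ => A.proj i.2 i.1) (σ x) = x
    rw [hσ n x hx, Finsupp.linearCombination_mapDomain]
    have h1 : ((fun i : A.carrier × ℕ => A.proj i.2 i.1) ∘ fun x => (x, n)) =
        A.proj n ∘ id := rfl
    rw [h1, ← LinearMap.map_finsupp_linearCombination]
    exact (congrArg (A.proj n) (LinearMap.congr_fun hs x)).trans (A.proj_of_mem hx)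
  · intro n x hx i hi
    rw [hσ n x hx] at hi
    have := Finsupp.mapDomain_support (Finsupp.mem_support_iff.2 hi)
    obtain ⟨y, -, rfl⟩ := Finset.mem_image.1 this
    rfl

namespace GradedDualBasis

variable {K R M : Type u} [CommRing K] [AddCommGroup R] [Module K R] {gr : ℕ → Submodule K R}
  [AddCommGroup M] [Module K M] (β : GradedDualBasis gr)

/-- The value of `g : K ^ q × R ^ q → M` on the expansion of a tensor in `R ^ ⊗q` with respect to the
dual basis. -/
noncomputable def expand (q : ℕ) :
    ((Fin q → K) → (Fin q → R) → M) →ₗ[K] ((Fin q → R) → M) where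
  toFun g r := ∑ b ∈ Fintype.piFinset fun j => (β.σ (r j)).support,
    g (fun j => β.σ (r j) (b j)) (fun j => β.v (b j))
  map_add' f g := by funext r; simp [Finset.sum_add_distrib]
  map_smul' c f := by funext r; simp [Finset.smul_sum]

variable {q : ℕ} {g : (Fin q → K) → (Fin q → R) → M}

theorem expand_apply (r : Fin q → R) : β.expand q g r =
    ∑ b ∈ Fintype.piFinset fun j => (β.σ (r j)).support,
      g (fun j => β.σ (r j) (b j)) (fun j => β.v (b j)) := rfl

/-- Terms with a zero coefficient vanish, so the sum may run over any larger index set; this makes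
values at different arguments comparable. -/
theorem expand_eq_sum (hg : ∀ c y j, c j = 0 → g c y = 0) (r : Fin q → R) (s : Finset β.ι)
    (hs : ∀ j, (β.σ (r j)).support ⊆ s) : β.expand q g r =
    ∑ b ∈ Fintype.piFinset fun _ => s, g (fun j => β.σ (r j) (b j)) (fun j => β.v (b j)) := by
  rw [expand_apply]
  refine Finset.sum_subset (Fintype.piFinset_subset _ _ hs) fun b _ hb => ?_
  rw [Fintype.mem_piFinset] at hb
  push Not at hb
  obtain ⟨j, hj⟩ := hb
  exact hg _ _ j (Finsupp.notMem_support_iff.1 hj)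

theorem expand_eq_zero (r : Fin q → R) (e : Fin q → ℕ) (hr : ∀ j, r j ∈ gr (e j))
    (hg : ∀ c y, (∀ j, y j ∈ gr (e j)) → g c y = 0) : β.expand q g r = 0 := by
  rw [expand_apply]
  refine Finset.sum_eq_zero fun b hb => hg _ _ fun j => ?_
  rw [Fintype.mem_piFinset] at hb
  rw [← β.degree_eq _ _ (hr j) _ (Finsupp.mem_support_iff.1 (hb j))]
  exact β.v_mem _

variable {κ : Type*} [CommRing κ] [Module κ M]

/-- In every slot, `σ` is a section of the multiplication of coefficients with basis elements. -/
theorem expand_smul [Module κ R] {f : (Fin q → R) → M} (hf : IsMultilin κ f) :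
    β.expand q (fun c y => f fun j => c j • y j) = f := by
  classical
  funext r
  obtain ⟨f', hf⟩ := hf
  have hr : r = fun j => ∑ i ∈ (β.σ (r j)).support, β.σ (r j) i • β.v i :=
    funext fun j => (β.sum_eq (r j)).symm
  rw [expand_apply]
  simp only [← hf]
  conv_rhs => rw [hr, MultilinearMap.map_sum_finset]

variable [Algebra κ K]

/-- This is the `K`-linearity of `σ`. -/
theorem expand_mul (hg : ∀ y, IsMultilin κ fun c => g c y) (a : Fin q → K) (r : Fin q → R) :
    β.expand q (fun c y => g (a * c) y) r = β.expand q g (fun j => a j • r j) := by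
  classical
  have h0 : ∀ c y j, c j = 0 → g c y = 0 := fun c y j h => (hg y).eq_zero c j h
  rw [β.expand_eq_sum h0 (fun j => a j • r j) (Finset.univ.biUnion fun j => (β.σ (r j)).support)
    fun j => ?_, β.expand_eq_sum (fun c y j h => h0 _ _ j (by simp [h])) r
    (Finset.univ.biUnion fun j => (β.σ (r j)).support) fun j => ?_]
  · simp only [map_smul, Finsupp.smul_apply, smul_eq_mul]
    rfl
  · exact Finset.subset_biUnion_of_mem (fun j => (β.σ (r j)).support) (Finset.mem_univ j)
  · rw [map_smul]
    exact Finsupp.support_smul.trans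
      (Finset.subset_biUnion_of_mem (fun j => (β.σ (r j)).support) (Finset.mem_univ j))

variable [Module κ R] [IsScalarTower κ K R]

/-- The index set of the sum varies with the argument. Each test of additivity or homogeneity
involves finitely many arguments, and on these `expand` agrees with one truncated sum, which is
multilinear. -/
theorem isMultilin_expand (hg : ∀ y, IsMultilin κ fun c => g c y) :
    IsMultilin κ (β.expand q g) := by
  classical
  have hT : ∀ s : Finset β.ι, IsMultilin κ fun r : Fin q → R =>
      ∑ b ∈ Fintype.piFinset fun _ => s, g (fun j => β.σ (r j) (b j)) (fun j => β.v (b j)) :=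
    fun s => IsMultilin.sum
      (f := fun (b : Fin q → β.ι) (r : Fin q → R) => g (fun j => β.σ (r j) (b j)) (fun j => β.v (b j))) fun b =>
        (hg _).comp_linear fun j => (Finsupp.lapply (b j) ∘ₗ β.σ).restrictScalars κ
  have he : ∀ (r : Fin q → R) (i : Fin q) (F : Finset R), ∃ s : Finset β.ι, ∀ x ∈ F,
      β.expand q g (Function.update r i x) = ∑ b ∈ Fintype.piFinset fun _ => s,
        g (fun j => β.σ (Function.update r i x j) (b j)) (fun j => β.v (b j)) := by
    intro r i F
    refine ⟨(Finset.univ.biUnion fun j => (β.σ (r j)).support) ∪ F.biUnion fun x =>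
      (β.σ x).support, fun x hx => ?_⟩
    refine β.expand_eq_sum (fun c y j h => (hg y).eq_zero c j h) _ _ fun j => ?_
    by_cases h : j = i
    · subst h
      rw [Function.update_self]
      exact (Finset.subset_biUnion_of_mem (fun x => (β.σ x).support) hx).trans
        Finset.subset_union_right
    · rw [Function.update_of_ne h]
      exact (Finset.subset_biUnion_of_mem (fun j => (β.σ (r j)).support)
        (Finset.mem_univ j)).trans Finset.subset_union_left
  rw [isMultilin_iff]
  intro r i
  refine ⟨⟨⟨fun x => β.expand q g (Function.update r i x), fun x y => ?_⟩, fun c x => ?_⟩,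
    fun _ => rfl⟩
  · obtain ⟨s, hs⟩ := he r i {x, y, x + y}
    obtain ⟨l, hl⟩ := isMultilin_iff.1 (hT s) r i
    rw [hs x (by simp), hs y (by simp), hs (x + y) (by simp), hl, hl, hl, map_add]
  · obtain ⟨s, hs⟩ := he r i {x, c • x}
    obtain ⟨l, hl⟩ := isMultilin_iff.1 (hT s) r i
    change β.expand q g _ = c • β.expand q g _
    rw [hs x (by simp), hs (c • x) (by simp), hl, hl, map_smul]

end GradedDualBasis

/-! ### Contraction of the rows for projective $A$ -/

namespace AlgBimod

variable {k K : Type u} [Field k] [CommRing K] [Algebra k K]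

section Snoc

theorem contractNth_castSucc_snoc {S : Type*} {p : ℕ} (op : S → S → S) (l : Fin p)
    (a : Fin (p + 1) → S) (c : S) :
    Fin.contractNth l.castSucc.castSucc op (Fin.snoc a c : Fin (p + 2) → S) =
      Fin.snoc (Fin.contractNth l.castSucc op a) c := by
  funext j
  refine Fin.lastCases ?_ (fun j => ?_) j
  · have h1 : ¬ p < (l : ℕ) := by omega
    have h2 : ¬ p = (l : ℕ) := by omega
    simp [Fin.contractNth, h1, h2]
  · simp only [Fin.contractNth, Fin.snoc_castSucc, Fin.val_castSucc]
    rw [← Fin.castSucc_succ, Fin.snoc_castSucc]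

theorem contractNth_last_snoc {S : Type*} {p : ℕ} (op : S → S → S)
    (a : Fin (p + 1) → S) (c : S) :
    Fin.contractNth (Fin.last p).castSucc op (Fin.snoc a c : Fin (p + 2) → S) =
      Fin.snoc (fun i => a i.castSucc) (op (a (Fin.last p)) c) := by
  funext j
  refine Fin.lastCases ?_ (fun j => ?_) j
  · simp [Fin.contractNth]
  · simp [Fin.contractNth]

theorem snoc_succ {S : Type*} {p : ℕ} (a : Fin (p + 1) → S) (c : S) (i : Fin (p + 1)) :
    (Fin.snoc a c : Fin (p + 2) → S) i.succ =
      (Fin.snoc (fun i => a i.succ) c : Fin (p + 1) → S) i := by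
  refine Fin.lastCases ?_ (fun i => ?_) i
  · rw [Fin.succ_last, Fin.snoc_last, Fin.snoc_last]
  · rw [← Fin.castSucc_succ, Fin.snoc_castSucc, Fin.snoc_castSucc]

/-- The last row is singled out because the contraction fills it with the coefficients of the dual
basis. -/
theorem horiz_snoc (Y : AlgBimod k K) (p q : ℕ)
    (f : (Fin (p + 1) → Fin q → K) → (Fin q → Y.R) → Y.M)
    (a : Fin (p + 1) → Fin q → K) (c : Fin q → K) (r : Fin q → Y.R) :
    Y.horiz (p + 1) q f (Fin.snoc a c) r =
      (∏ j, a 0 j) • f (Fin.snoc (fun i => a i.succ) c) r +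
      ∑ l : Fin p, (-1 : ℤ) ^ ((l : ℕ) + 1) •
        f (Fin.snoc (Fin.contractNth l.castSucc (· * ·) a) c) r +
      (-1 : ℤ) ^ (p + 1) • f (Fin.snoc (fun i => a i.castSucc) (a (Fin.last p) * c)) r +
      (-1 : ℤ) ^ (p + 2) • f a (fun j => c j • r j) := by
  rw [horiz_apply, Fin.sum_univ_castSucc]
  simp only [contractNth_castSucc_snoc, contractNth_last_snoc, Fin.snoc_castSucc, Fin.snoc_last,
    snoc_succ, Fin.val_castSucc, Fin.val_last]
  have h0 : (Fin.snoc a c : Fin (p + 2) → Fin q → K) 0 = a 0 := by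
    rw [← Fin.castSucc_zero, Fin.snoc_castSucc]
  rw [h0]
  abel

end Snoc

namespace DGStructure

variable {Y : AlgBimod k K} (A : Y.DGStructure)

/-- The degree in $A$ is nonnegative, so cochains of total degree `n` live in `p + q ≤ n`; this
bounds the filtrations used below. -/
theorem triCochains_eq_zero {n : ℕ} {f : Y.BiFam} (hf : f ∈ A.triCochains n) {p q : ℕ}
    (h : n < p + q) : f p q = 0 := by
  funext a
  exact ChainAlgebra.eq_zero_of_homogeneous (A := A.toChain) ((hf p q).1 a) fun e x hx =>
    (hf p q).2.2 a e x hx (by omega)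

variable {A} (β : GradedDualBasis A.gr)

/-- The contraction in the direction of `p` given by a dual basis. -/
noncomputable def rowHomotopy : Y.BiFam →ₗ[K] Y.BiFam where
  toFun f p q a := (-1 : ℤ) ^ (p + 1) • β.expand q fun c y => f (p + 1) q (Fin.snoc a c) y
  map_add' f g := by
    funext p q a
    change (-1 : ℤ) ^ (p + 1) • β.expand q ((fun c y => f (p + 1) q (Fin.snoc a c) y) +
      fun c y => g (p + 1) q (Fin.snoc a c) y) = _
    rw [map_add, smul_add]
    rfl
  map_smul' c f := by
    funext p q a
    change (-1 : ℤ) ^ (p + 1) • β.expand q (c • fun c y => f (p + 1) q (Fin.snoc a c) y) = _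
    rw [map_smul, smul_comm]
    rfl

theorem rowHomotopy_apply (f : Y.BiFam) (p q : ℕ) (a : Fin p → Fin q → K) (r : Fin q → Y.R) :
    rowHomotopy β f p q a r =
      (-1 : ℤ) ^ (p + 1) • β.expand q (fun c y => f (p + 1) q (Fin.snoc a c) y) r := rfl

/-- The projection onto `K`-multilinear functions given by a dual basis. -/
noncomputable def rowProj (f : Y.BiFam) (q : ℕ) : (Fin q → Y.R) → Y.M :=
  β.expand q fun c y => (∏ j, c j) • f 0 q Fin.elim0 y

section

variable {p q : ℕ} {f : (Fin p → Fin q → K) → (Fin q → Y.R) → Y.M}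

theorem isMultilin_snoc_right {f : (Fin (p + 1) → Fin q → K) → (Fin q → Y.R) → Y.M}
    {r : Fin q → Y.R}
    (h : IsMultilin k fun x : Fin (p + 1) × Fin q → K => f (fun i j => x (i, j)) r)
    (a : Fin p → Fin q → K) :
    IsMultilin k fun c => f (Fin.snoc a c) r := by
  rw [isMultilin_iff]
  intro c j
  have := (isMultilin_pair (g := fun a => f a r)).1 h (Fin.snoc a c) (Fin.last p) j
  simp only [Fin.snoc_last, Fin.update_snoc_last] at this
  exact this

theorem isMultilin_snoc_left {f : (Fin (p + 1) → Fin q → K) → (Fin q → Y.R) → Y.M}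
    {r : Fin q → Y.R}
    (h : IsMultilin k fun x : Fin (p + 1) × Fin q → K => f (fun i j => x (i, j)) r)
    (c : Fin q → K) :
    IsMultilin k fun x : Fin p × Fin q → K => f (Fin.snoc (fun i j => x (i, j)) c) r := by
  refine (isMultilin_pair (g := fun a => f (Fin.snoc a c) r)).2 fun a i j => ?_
  have := (isMultilin_pair (g := fun a => f a r)).1 h (Fin.snoc a c) i.castSucc j
  simpa only [Fin.snoc_castSucc, ← Fin.snoc_update] using this

end

theorem rowHomotopy_mem {n : ℕ} {f : Y.BiFam} (hf : f ∈ A.triCochains (n + 1)) :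
    rowHomotopy β f ∈ A.triCochains n := by
  intro p q
  obtain ⟨h1, h2, h3⟩ := hf (p + 1) q
  refine ⟨fun a => (β.isMultilin_expand fun y => isMultilin_snoc_right (h2 y) a).zsmul _,
    fun r => IsMultilin.zsmul ?_ _, fun a e x hx h => ?_⟩
  · exact IsMultilin.sum (f := fun (b : Fin q → β.ι) (x : Fin p × Fin q → K) =>
      f (p + 1) q (Fin.snoc (fun i j => x (i, j)) fun j => β.σ (r j) (b j)) fun j => β.v (b j))
      fun b => isMultilin_snoc_left (h2 _) _
  · rw [rowHomotopy_apply, β.expand_eq_zero x e hx, smul_zero]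
    exact fun c y hy => h3 _ e y hy (by omega)

/-- In the column 0 the coboundary measures the failure of `K`-multilinearity; expanding it compares
`f` with the `K`-multilinear function that has the same values on basis elements. -/
theorem rowHomotopy_biH_zero {n : ℕ} {f : Y.BiFam} (hf : f ∈ A.triCochains n) (q : ℕ)
    (a : Fin 0 → Fin q → K) (r : Fin q → Y.R) :
    rowHomotopy β (Y.biH f) 0 q a r = f 0 q a r - rowProj β f q r := by
  have ha : a = Fin.elim0 := funext fun i => i.elim0
  have h1 : (fun (c : Fin q → K) (y : Fin q → Y.R) => Y.biH f (0 + 1) q (Fin.snoc a c) y) =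
      (fun c y => (∏ j, c j) • f 0 q Fin.elim0 y) -
        (fun c y => f 0 q Fin.elim0 fun j => c j • y j) := by
    funext c y
    change Y.horiz 0 q (f 0 q) (Fin.snoc a c) y = _
    rw [horiz_apply, Fin.sum_univ_zero, add_zero]
    have h0 : (Fin.snoc a c : Fin 1 → Fin q → K) 0 = c := Fin.snoc_last (n := 0) _ _
    have h0' : (Fin.snoc a c : Fin 1 → Fin q → K) (Fin.last 0) = c := Fin.snoc_last (n := 0) _ _
    rw [h0, h0', Subsingleton.elim (fun i : Fin 0 => (Fin.snoc a c : Fin 1 → Fin q → K) i.succ)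
      Fin.elim0, Subsingleton.elim (fun i : Fin 0 => (Fin.snoc a c : Fin 1 → Fin q → K) i.castSucc)
      Fin.elim0]
    simp [sub_eq_add_neg]
  rw [rowHomotopy_apply, h1, map_sub, Pi.sub_apply, β.expand_smul ((hf 0 q).1 Fin.elim0), ha]
  simp [rowProj]

/-- This is the contraction of a bar complex. When the coefficients of `σ` are inserted as last row,
the last face gives back `f` by `expand_smul`, the face multiplying the last two rows cancels by
`expand_mul` against the last face of the coboundary of the homotopy, and the remaining faces cancel
in pairs. -/
theorem rowHomotopy_biH_succ {n : ℕ} {f : Y.BiFam} (hf : f ∈ A.triCochains n) (p q : ℕ) :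
    Y.biH (rowHomotopy β f) (p + 1) q + rowHomotopy β (Y.biH f) (p + 1) q = f (p + 1) q := by
  funext a r
  change Y.horiz p q (rowHomotopy β f p q) a r + rowHomotopy β (Y.biH f) (p + 1) q a r = _
  have h1 : (fun (c : Fin q → K) (y : Fin q → Y.R) => Y.biH f (p + 1 + 1) q (Fin.snoc a c) y) =
      (∏ j, a 0 j) • (fun c y => f (p + 1) q (Fin.snoc (fun i => a i.succ) c) y) +
      ∑ l : Fin p, (-1 : ℤ) ^ ((l : ℕ) + 1) •
        (fun c y => f (p + 1) q (Fin.snoc (Fin.contractNth l.castSucc (· * ·) a) c) y) +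
      (-1 : ℤ) ^ (p + 1) •
        (fun c y => f (p + 1) q (Fin.snoc (fun i => a i.castSucc) (a (Fin.last p) * c)) y) +
      (-1 : ℤ) ^ (p + 2) • (fun c y => f (p + 1) q a (fun j => c j • y j)) := by
    funext c y
    simp only [Pi.add_apply, Pi.smul_apply, Finset.sum_apply]
    exact horiz_snoc Y p q (f (p + 1) q) a c y
  rw [rowHomotopy_apply, h1, map_add, map_add, map_add, map_sum, map_smul,
    map_zsmul, map_zsmul, β.expand_smul ((hf (p + 1) q).1 a), horiz_apply]
  simp only [map_zsmul, Pi.add_apply, Pi.smul_apply, Finset.sum_apply, rowHomotopy_apply]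
  have h2 := β.expand_mul (g := fun c y => f (p + 1) q (Fin.snoc (fun i => a i.castSucc) c) y)
    (κ := k) (fun y => isMultilin_snoc_right ((hf (p + 1) q).2.1 y) _) (a (Fin.last p)) r
  rw [h2]
  have h3 : ∀ m : Y.M, (-1 : ℤ) ^ (p + 2) • (-1 : ℤ) ^ (p + 2) • m = m := fun m => by
    rw [smul_smul, ← mul_pow]; simp
  have h4 : (-1 : ℤ) ^ (p + 1 + 1) = -(-1 : ℤ) ^ (p + 1) := by ring
  rw [smul_add, h3, ← add_assoc, add_eq_right, h4, neg_smul, add_neg_eq_zero, smul_add, smul_add,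
    Finset.smul_sum, smul_comm (∏ j, a 0 j)]
  congr 2
  exact Finset.sum_congr rfl fun l _ => smul_comm _ _ _

end DGStructure

end AlgBimod

/-! ### The Hochschild complex inside the triple complex -/

namespace AlgBimod

variable {k K : Type u} [Field k] [CommRing K] [Algebra k K]

theorem biH_alphaFam (Y : AlgBimod k K) (f : Y.HochFam) (hf : ∀ q, IsMultilin K (f q)) :
    Y.biH (Y.alphaFam f) = 0 := by
  funext p q
  rcases p with _ | _ | p
  · rfl
  · funext a r
    change Y.horiz 0 q (Y.alphaFam f 0 q) a r = 0
    obtain ⟨g, hg⟩ := hf q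
    rw [horiz_apply]
    change (∏ j, a 0 j) • f q r + _ +
      (-1 : ℤ) ^ (0 + 1) • f q (fun j => a (Fin.last 0) j • r j) = 0
    rw [← hg, ← hg, MultilinearMap.map_smul_univ]
    simp
  · exact map_zero (Y.horiz (p + 1) q)

theorem biV_alphaFam (Y : AlgBimod k K) (f : Y.HochFam) :
    Y.biV (Y.alphaFam f) = Y.alphaFam (Y.hochD f) := by
  funext p q
  rcases p with _ | p <;> rcases q with _ | q
  · rfl
  · funext a r
    change (-1 : ℤ) ^ 0 • Y.vert 0 q (Y.alphaFam f 0 q) a r = hochB Y.lact Y.ract q (f q) r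
    rw [pow_zero, one_smul, vert_apply, hochB_apply]
    simp
    rfl
  · rfl
  · change (-1 : ℤ) ^ (p + 1) • Y.vert (p + 1) q 0 = 0
    simp

namespace DGStructure

open ChainAlgebra

variable {Y : AlgBimod k K} (A : Y.DGStructure)

/-- The differential of the Hochschild complex of the chain algebra `A`. -/
noncomputable def hochD : Y.HochFam →ₗ[K] Y.HochFam :=
  Y.hochD + ChainAlgebra.chainV (A := A.toChain) Y

theorem triI_alphaFam (f : Y.HochFam) :
    A.triI (Y.alphaFam f) = Y.alphaFam (ChainAlgebra.chainV (A := A.toChain) Y f) := by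
  funext p q a
  rcases p with _ | p
  · change (-1 : ℤ) ^ (0 + q) • A.toChain.codiff q (f q) = (-1 : ℤ) ^ q • A.toChain.codiff q (f q)
    rw [zero_add]
  · change (-1 : ℤ) ^ (p + 1 + q) • A.toChain.codiff q (0 : (Fin q → Y.R) → Y.M) = 0
    rw [map_zero, smul_zero]

theorem alphaFam_mem (n : ℕ) (f : Y.HochFam) (hf : f ∈ A.toChain.chainCochains Y n) :
    Y.alphaFam f ∈ A.triCochains n := by
  rintro (_ | p) q
  · exact ⟨fun _ => (hf q).1.restrictScalars, fun _ => IsMultilin.of_isEmpty _,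
      fun _ e x hx h => (hf q).2 e x hx (by omega)⟩
  · exact ⟨fun _ => IsMultilin.zero, fun _ => IsMultilin.zero, fun _ _ _ _ _ => rfl⟩

theorem alphaFam_comm (n : ℕ) (f : Y.HochFam) (hf : f ∈ A.toChain.chainCochains Y n) :
    A.triD (Y.alphaFam f) = Y.alphaFam (A.hochD f) := by
  rw [triD, biD, LinearMap.add_apply, LinearMap.add_apply, Y.biH_alphaFam f fun q => (hf q).1,
    biV_alphaFam, triI_alphaFam, zero_add, hochD, LinearMap.add_apply, map_add]

variable {A} (β : GradedDualBasis A.gr)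

theorem rowHomotopy_eq_zero {f : Y.BiFam} {p q : ℕ} (h : f (p + 1) q = 0) :
    rowHomotopy β f p q = 0 := by
  funext a r
  rw [rowHomotopy_apply, h]
  change _ • β.expand q 0 r = _
  rw [map_zero]
  exact smul_zero _

theorem biH_eq_zero {f : Y.BiFam} {p q : ℕ} (h : ∀ p', p' + 1 = p → f p' q = 0) :
    Y.biH f p q = 0 := by
  rcases p with _ | p
  · rfl
  · change Y.horiz p q (f p q) = 0
    rw [h p rfl, map_zero]

theorem biV_eq_zero {f : Y.BiFam} {p q : ℕ} (h : ∀ q', q' + 1 = q → f p q' = 0) :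
    Y.biV f p q = 0 := by
  rcases q with _ | q
  · rfl
  · change (-1 : ℤ) ^ p • Y.vert p q (f p q) = 0
    rw [h q rfl, map_zero, smul_zero]

theorem triI_eq_zero {f : Y.BiFam} {p q : ℕ} (h : f p q = 0) : A.triI f p q = 0 := by
  funext a
  change (-1 : ℤ) ^ (p + q) • A.toChain.codiff q (f p q a) = 0
  rw [h, Pi.zero_apply, map_zero, smul_zero]

theorem rowProj_mem {n : ℕ} {f : Y.BiFam} (hf : f ∈ A.triCochains n) :
    rowProj β f ∈ A.toChain.chainCochains Y n := by
  classical
  intro q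
  refine ⟨β.isMultilin_expand fun y => ?_, fun e x hx h => ?_⟩
  · exact isMultilin_iff.2 fun c j => (isLin_prod c j).smul_right _
  · refine β.expand_eq_zero x e hx fun c y hy => ?_
    rw [(hf 0 q).2.2 _ e y hy (by omega), smul_zero]

variable (A) in
/-- If `A` is projective over `K`, then its Hochschild complex computes the cohomology of
`K ^ ***(K, A, M)`. -/
theorem isIso_alpha [Module.Projective K Y.R] {hD hDD} (n : ℕ) : IsIso
    (HomologicalComplex.homologyMap (subComplexMap Y.alphaFam A.alphaFam_mem A.alphaFam_comm :
      subComplex (fun n => A.toChain.chainCochains Y n) A.hochD hD hDD ⟶ A.triComplex) n) := by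
  obtain ⟨β⟩ := A.toChain.nonempty_gradedDualBasis
  have key := isIso_homologyMap_subComplexMap (hD := hD) (hDD := hDD) (hD' := A.triD_mem)
    (hDD' := A.triD_sq) Y.alphaFam A.alphaFam_mem A.alphaFam_comm (rowHomotopy (A := A) β)
  refine key (fun n x _ hx => ?_)
    (fun n f hf => rowHomotopy_mem β hf) (fun f hf => ?_) (fun n x _ => ?_)
    -- The filtration is by columns: step `j` consists of cochains that vanish in the columns `p >
    -- j`.
    (fun n j f => ∀ p q, j < p → f p q = 0)
    (fun n => ⟨n, fun f hf p q h => A.triCochains_eq_zero hf (by omega)⟩)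
    (fun n j f hf h p q hp => ?_) (fun n f hf h => ?_) n
  · funext q r
    have h0 : Y.alphaFam x 0 q Fin.elim0 r = 0 := by rw [hx]; rfl
    exact h0
  · funext p q
    exact rowHomotopy_eq_zero β (A.triCochains_eq_zero hf (by omega))
  · funext p q
    exact rowHomotopy_eq_zero β rfl
  -- In the columns `p > j` the homotopy applied to `f`, `biV f` or `triI f` vanishes, as it reads
  -- off the next column. Only the contraction of the row is left, and it removes `f` there.
  · obtain ⟨p, rfl⟩ := Nat.exists_eq_succ_of_ne_zero (by omega : p ≠ 0)
    have h1 : ∀ q, rowHomotopy (A := A) β f (p + 1) q = 0 := fun q =>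
      rowHomotopy_eq_zero β (h _ q (by omega))
    have h2 := rowHomotopy_biH_succ (A := A) β hf p q
    have h3 : rowHomotopy (A := A) β (Y.biV f) (p + 1) q = 0 :=
      rowHomotopy_eq_zero β (biV_eq_zero fun q' _ => h _ q' (by omega))
    have h4 : rowHomotopy (A := A) β (A.triI f) (p + 1) q = 0 :=
      rowHomotopy_eq_zero β (triI_eq_zero (h _ q (by omega)))
    simp only [triD, biD, LinearMap.add_apply, map_add, Pi.add_apply, Pi.sub_apply] at h2 ⊢
    rw [biV_eq_zero fun q' _ => h1 q', triI_eq_zero (h1 q), h3, h4, ← h2]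
    abel
  -- For a cochain in the column 0 the deformation is exactly the projection onto `K`-multilinear
  -- functions.
  · refine ⟨rowProj β f, rowProj_mem β hf, ?_⟩
    have h0 : rowHomotopy (A := A) β f = 0 := by
      funext p q
      exact rowHomotopy_eq_zero β (h _ q (by omega))
    have h3 : rowHomotopy (A := A) β (Y.biV f) = 0 := by
      funext p q
      exact rowHomotopy_eq_zero β (biV_eq_zero fun q' _ => h _ q' (by omega))
    have h4 : rowHomotopy (A := A) β (A.triI f) = 0 := by
      funext p q
      exact rowHomotopy_eq_zero β (triI_eq_zero (h _ q (by omega)))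
    rw [h0, map_zero, sub_zero]
    simp only [triD, biD, LinearMap.add_apply, map_add]
    rw [h3, h4, add_zero, add_zero]
    funext p q a r
    rcases p with _ | p
    · have := rowHomotopy_biH_zero (A := A) β hf q a r
      simp only [Pi.sub_apply]
      rw [this, sub_sub_cancel]
      rfl
    · have h5 : rowHomotopy (A := A) β (Y.biH f) (p + 1) q = 0 := by
        refine rowHomotopy_eq_zero β ?_
        change Y.horiz (p + 1) q (f (p + 1) q) = 0
        rw [h _ q (by omega), map_zero]
      simp only [Pi.sub_apply]
      rw [h5, h _ q (by omega)]
      simp [alphaFam]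

end DGStructure

end AlgBimod

/-! ### Contractions over the field $k$ and their tensor powers -/

/-- Over a field, the map onto the image has a section, which extends from the image to all of `W`.
-/
theorem exists_generalizedInverse {k V W : Type*} [Field k] [AddCommGroup V] [Module k V]
    [AddCommGroup W] [Module k W] (δ : V →ₗ[k] W) : ∃ t : W →ₗ[k] V, ∀ x, δ (t (δ x)) = δ x := by
  obtain ⟨g, hg⟩ := δ.rangeRestrict.exists_rightInverse_of_surjective δ.range_rangeRestrict
  obtain ⟨t, ht⟩ := g.exists_extend
  refine ⟨t, fun x => ?_⟩
  have h1 : t (δ x) = g ⟨δ x, x, rfl⟩ := LinearMap.congr_fun ht ⟨δ x, x, rfl⟩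
  have h2 : δ (g ⟨δ x, x, rfl⟩) = δ x :=
    congrArg Subtype.val (LinearMap.congr_fun hg ⟨δ x, x, rfl⟩)
  rwa [← h1] at h2

namespace ChainAlgebra

theorem Contraction.s_aug_mem {k K : Type u} [Field k] [CommRing K] {A : ChainAlgebra K}
    [Module k A.carrier] {R : Type u} [Ring R] [Algebra K R] [Module k R]
    {ε : Hom A (ofAlgebra K R)} (s : R →ₗ[k] A.carrier)
    (hs : ∀ r, s r ∈ A.gr 0) (n : ℕ) (x : A.carrier) (hx : x ∈ A.gr n) :
    s (ε.toAlg x) ∈ A.gr n := by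
  rcases n with _ | n
  · exact hs _
  · rw [ε.aug_of_pos n.succ_ne_zero hx, map_zero]
    exact zero_mem _

section Contraction

variable (k : Type u) {K : Type u} [Field k] [CommRing K] [Algebra k K] {A : ChainAlgebra K}
  [Algebra k A.carrier] [IsScalarTower k K A.carrier]
  {R : Type u} [Ring R] [Algebra K R] [Algebra k R] [IsScalarTower k K R]

/-- A `k`-linear contraction of a chain algebra `A` onto an algebra `R`. -/
structure Contraction (ε : Hom A (ofAlgebra K R)) where
  s : R →ₗ[k] A.carrier
  h : A.carrier →ₗ[k] A.carrier
  s_mem : ∀ r, s r ∈ A.gr 0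
  h_mem : ∀ n, ∀ x ∈ A.gr n, h x ∈ A.gr (n + 1)
  aug_s : ∀ r, ε.toAlg (s r) = r
  homotopy : ∀ x, A.d (h x) + h (A.d x) = x - s (ε.toAlg x)

variable (A) in
theorem exists_generalizedInverse_d : ∃ t : A.carrier →ₗ[k] A.carrier,
    (∀ n, ∀ x ∈ A.gr n, t x ∈ A.gr (n + 1)) ∧ ∀ x, A.d (t (A.d x)) = A.d x := by
  have h0 : ∀ n, ∃ t : ((A.restrictScalars k).gr n) →ₗ[k] ((A.restrictScalars k).gr (n + 1)),
      ∀ x : (A.restrictScalars k).gr (n + 1), A.d (t ⟨A.d x, A.d_mem n x x.2⟩ : _) = A.d x := by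
    intro n
    let δ : (A.restrictScalars k).gr (n + 1) →ₗ[k] (A.restrictScalars k).gr n :=
      (A.d.restrictScalars k).restrict (A.d_mem n)
    obtain ⟨t, ht⟩ := exists_generalizedInverse δ
    exact ⟨t, fun x => congrArg Subtype.val (ht x)⟩
  choose t ht using h0
  let T : A.carrier →ₗ[k] A.carrier :=
    DirectSum.toModule k ℕ A.carrier
      (fun n => ((A.restrictScalars k).gr (n + 1)).subtype ∘ₗ t n) ∘ₗ
      (DirectSum.decomposeLinearEquiv (A.restrictScalars k).gr).toLinearMap
  have hT : ∀ n (x : A.carrier) (hx : x ∈ A.gr n), T x = t n ⟨x, hx⟩ := by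
    intro n x hx
    have : DirectSum.decompose (A.restrictScalars k).gr x =
        DirectSum.of (fun n => (A.restrictScalars k).gr n) n ⟨x, hx⟩ :=
      DirectSum.decompose_of_mem _ hx
    simp only [T, LinearMap.comp_apply, LinearEquiv.coe_coe, DirectSum.decomposeLinearEquiv_apply,
      this]
    exact DirectSum.toModule_lof (M := fun n => (A.restrictScalars k).gr n) k n _
  refine ⟨T, fun n x hx => ?_, fun x => ?_⟩
  · rw [hT n x hx]
    exact (t n ⟨x, hx⟩).2
  · refine linearMap_ext (A := A) (f := (A.d.restrictScalars k ∘ₗ T ∘ₗ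
      A.d.restrictScalars k).toAddMonoidHom) (g := A.d.toAddMonoidHom) (fun n x hx => ?_) x
    change A.d (T (A.d x)) = A.d x
    rcases n with _ | n
    · rw [A.d_zero x hx, map_zero, map_zero]
    · rw [hT n _ (A.d_mem n x hx)]
      exact ht n ⟨x, hx⟩

variable {k}

-- The kernel of a weak equivalence to `R` is an acyclic complex of vector spaces over `k`, hence
-- contractible.
variable (k) in
theorem nonempty_contraction {ε : Hom A (ofAlgebra K R)} (hε : ε.IsWeakEquiv) :
    Nonempty (Contraction k ε) := by
  obtain ⟨h1, h2⟩ := ε.isWeakEquiv_iff.1 hε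
  let ε' : A.carrier →ₗ[k] R := ε.toAlg.toLinearMap.restrictScalars k
  have hsurj : Function.Surjective ε' := fun r => by
    obtain ⟨x, -, b, hb⟩ := h2 r rfl
    exact ⟨x, (sub_eq_zero.1 hb.symm : ε.alg x = r)⟩
  obtain ⟨s₀, hs₀⟩ := ε'.exists_rightInverse_of_surjective (LinearMap.range_eq_top.2 hsurj)
  obtain ⟨t, ht, hdt⟩ := A.exists_generalizedInverse_d k
  have haug : ∀ x, ε.toAlg (A.proj 0 x) = ε.toAlg x := by
    refine linearMap_ext (f := (ε.toAlg.toLinearMap ∘ₗ A.proj 0).toAddMonoidHom)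
      (g := ε.toAlg.toLinearMap.toAddMonoidHom) fun n x hx => ?_
    change ε.toAlg (A.proj 0 x) = ε.toAlg x
    rcases n with _ | n
    · rw [A.proj_of_mem hx]
    · rw [A.proj_of_mem_ne hx n.succ_ne_zero, map_zero, ε.aug_of_pos n.succ_ne_zero hx]
  have hεt : ∀ x, ε.toAlg (t x) = 0 := by
    refine linearMap_ext (f := (ε.toAlg.toLinearMap.restrictScalars k ∘ₗ t).toAddMonoidHom)
      (g := 0) fun n x hx => ?_
    exact ε.aug_of_pos n.succ_ne_zero (ht n x hx)
  -- The augmentation sees only degree 0, so a linear section may be replaced by its component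
  -- there.
  let s : R →ₗ[k] A.carrier := (A.proj 0).restrictScalars k ∘ₗ s₀
  have hs : ∀ r, s r ∈ A.gr 0 := fun r => A.proj_mem 0 _
  have hεs : ∀ r, ε.toAlg (s r) = r := fun r =>
    (haug _).trans (LinearMap.congr_fun hs₀ r)
  refine ⟨⟨s, t ∘ₗ (LinearMap.id - s ∘ₗ ε' - t ∘ₗ A.d.restrictScalars k), hs, fun n x hx => ?_,
    hεs, fun x => ?_⟩⟩
  · refine ht n _ (sub_mem (sub_mem hx (Contraction.s_aug_mem s hs n x hx)) ?_)
    change t (A.d x) ∈ A.gr n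
    rcases n with _ | n
    · rw [A.d_zero x hx, map_zero]
      exact zero_mem _
    · exact ht n _ (A.d_mem n x hx)
  · change A.d (t (x - s (ε.toAlg x) - t (A.d x))) +
      t (A.d x - s (ε.toAlg (A.d x)) - t (A.d (A.d x))) = _
    -- The element `x - s(ε x) - t(d x)` is a cycle in the kernel of the augmentation, hence a
    -- boundary, and `d t` is the identity on boundaries. The term `t(d x)` missing from `d(h x)` is
    -- `h(d x)`.
    obtain ⟨w, hw⟩ := h1 (x - s (ε.toAlg x) - t (A.d x))
      (by rw [map_sub, map_sub, A.d_zero _ (hs _), hdt, sub_zero, sub_self])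
      ⟨0, by
        change 0 = ε.toAlg _
        rw [map_sub, map_sub, hεs, hεt, sub_self, sub_zero]⟩
    rw [← hw, hdt, hw, ε.aug_d, A.d_d, map_zero, map_zero, sub_zero, sub_zero]
    abel

namespace Contraction

variable {ε : Hom A (ofAlgebra K R)} (c : Contraction k ε)

theorem aug_h (x : A.carrier) : ε.toAlg (c.h x) = 0 :=
  linearMap_ext (f := (ε.toAlg.toLinearMap.restrictScalars k ∘ₗ c.h).toAddMonoidHom)
    (g := 0) (fun n x hx => ε.aug_of_pos n.succ_ne_zero (c.h_mem n x hx)) x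

/-- The projection of `A` onto the image of `R`. -/
def e : A.carrier →ₗ[k] A.carrier := c.s ∘ₗ ε.toAlg.toLinearMap.restrictScalars k

theorem e_apply (x : A.carrier) : c.e x = c.s (ε.toAlg x) := rfl

theorem e_mem (n : ℕ) (x : A.carrier) (hx : x ∈ A.gr n) : c.e x ∈ A.gr n :=
  s_aug_mem c.s c.s_mem n x hx

/-- The maps in the slots of the contraction of the tensor power. -/
noncomputable def slot {q : ℕ} (i j : Fin q) : A.carrier →ₗ[k] A.carrier :=
  if j < i then A.sgn.restrictScalars k else if j = i then c.h else c.e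

variable {M : Type u} [AddCommGroup M] [Module k M]

/-- The contraction of the tensor power is the sum over `i` of the tensors with signs before the
slot `i`, `h` in it and `e` after it. The differential in an earlier slot anticommutes with the
sign; in a later slot both terms vanish, since `d e = 0` and `e d = 0`. -/
theorem slot_anticomm {q : ℕ} {f : (Fin q → A.carrier) → M} (hf : IsMultilin k f)
    (x : Fin q → A.carrier) {i l : Fin q} (hil : l ≠ i) :
    f (fun j => A.slotL l j (c.slot i j (x j))) + f (fun j => c.slot i j (A.slotL l j (x j))) = 0 := by
  rcases lt_or_gt_of_ne hil with h | h
  · obtain ⟨g, hg⟩ := isMultilin_iff.1 hf (fun j => A.slotL l j (c.slot i j (x j))) l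
    have e1 : (fun j => A.slotL l j (c.slot i j (x j))) =
        Function.update (fun j => A.slotL l j (c.slot i j (x j))) l (A.d (A.sgn (x l))) := by
      rw [eq_comm, Function.update_eq_self_iff]
      simp [slotL, slot, h]
    have e2 : (fun j => c.slot i j (A.slotL l j (x j))) =
        Function.update (fun j => A.slotL l j (c.slot i j (x j))) l (A.sgn (A.d (x l))) := by
      funext j
      simp only [slotL, slot, Function.update_apply]
      split_ifs <;> first | rfl | omega | skip
      · rename_i h1 h2 h3
        subst h3
        rfl
    rw [e1, e2, hg, hg, A.d_sgn, map_neg, neg_add_cancel]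
  · rw [hf.eq_zero _ l, hf.eq_zero _ l, add_zero]
    · simp [slotL, slot, h.not_gt, h.ne', e_apply, ε.aug_d]
    · simp [slotL, slot, h.not_gt, h.ne', e_apply, A.d_zero _ (c.s_mem _)]

/-- In the slot `i` the homotopy identity gives `1 - e`, and the two signs in each earlier slot
cancel. -/
theorem slot_self {q : ℕ} {f : (Fin q → A.carrier) → M} (hf : IsMultilin k f)
    (hsgn : ∀ x, A.sgn (A.sgn x) = x)
    (x : Fin q → A.carrier) (i : Fin q) :
    f (fun j => A.slotL i j (c.slot i j (x j))) + f (fun j => c.slot i j (A.slotL i j (x j))) =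
      f (fun j : Fin q => if (j : ℕ) < i + 1 then x j else c.e (x j)) -
        f (fun j : Fin q => if (j : ℕ) < i then x j else c.e (x j)) := by
  obtain ⟨g, hg⟩ := isMultilin_iff.1 hf (fun j => if j < i then x j else c.e (x j)) i
  have e1 : (fun j => A.slotL i j (c.slot i j (x j))) =
      Function.update (fun j => if j < i then x j else c.e (x j)) i (A.d (c.h (x i))) := by
    funext j
    simp only [slotL, slot, Function.update_apply]
    split_ifs with h1 h2 h2
    · omega
    · exact hsgn _
    · subst h2; rfl
    · rfl
  have e2 : (fun j => c.slot i j (A.slotL i j (x j))) =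
      Function.update (fun j => if j < i then x j else c.e (x j)) i (c.h (A.d (x i))) := by
    funext j
    simp only [slotL, slot, Function.update_apply]
    split_ifs with h1 h2 h2
    · omega
    · exact hsgn _
    · subst h2; rfl
    · rfl
  have e3 : (fun j : Fin q => if (j : ℕ) < i + 1 then x j else c.e (x j)) =
      Function.update (fun j => if j < i then x j else c.e (x j)) i (x i) := by
    funext j
    simp only [Function.update_apply, Fin.lt_def, Fin.ext_iff]
    split_ifs with h1 h2 h2 h3 h3 <;> first | rfl | omega | skip
    rw [show j = i from Fin.ext h2]
  have e4 : (fun j : Fin q => if (j : ℕ) < i then x j else c.e (x j)) =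
      Function.update (fun j => if j < i then x j else c.e (x j)) i (c.e (x i)) := by
    symm
    refine Function.update_eq_self_iff.2 ?_
    simp
  rw [e1, e2, e3, e4, hg, hg, hg, hg, ← map_add, ← map_sub, c.homotopy, e_apply]

/-- Only the diagonal terms survive, and they telescope from `e` in all slots to the identity in all
slots. -/
theorem sum_slot {q : ℕ} {f : (Fin q → A.carrier) → M} (hf : IsMultilin k f)
    (x : Fin q → A.carrier) :
    ∑ i, ∑ l, f (fun j => A.slotL l j (c.slot i j (x j))) +
      ∑ i, ∑ l, f (fun j => c.slot l j (A.slotL i j (x j))) = f x - f fun j => c.e (x j) := by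
  have hsgn : ∀ x, A.sgn (A.sgn x) = x := linearMap_ext
    (f := (A.sgn ∘ₗ A.sgn).toAddMonoidHom) (g := AddMonoidHom.id _) fun n x hx => by
      change A.sgn (A.sgn x) = x
      rw [A.sgn_of_mem (A.sgn_mem hx), A.sgn_of_mem hx, smul_smul, ← mul_pow]
      simp
  rw [Finset.sum_comm (f := fun i l => f fun j => c.slot l j (A.slotL i j (x j))),
    ← Finset.sum_add_distrib]
  simp only [← Finset.sum_add_distrib]
  have h : ∀ i : Fin q, ∑ l, (f (fun j => A.slotL l j (c.slot i j (x j))) +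
      f (fun j => c.slot i j (A.slotL l j (x j)))) =
      f (fun j : Fin q => if (j : ℕ) < i + 1 then x j else c.e (x j)) -
        f (fun j : Fin q => if (j : ℕ) < i then x j else c.e (x j)) := fun i => by
    rw [Finset.sum_eq_single i (fun l _ hl => c.slot_anticomm hf x hl)
      (fun h => absurd (Finset.mem_univ i) h), c.slot_self hf hsgn]
  simp only [h]
  rw [Fin.sum_univ_eq_sum_range (fun m => f (fun j : Fin q => if (j : ℕ) < m + 1 then x j else c.e (x j)) -
    f (fun j : Fin q => if (j : ℕ) < m then x j else c.e (x j))),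
    Finset.sum_range_sub fun m => f (fun j : Fin q => if (j : ℕ) < m then x j else c.e (x j))]
  simp

end Contraction

end Contraction

end ChainAlgebra

/-! ### Invariance of the triple complex under weak equivalences -/

namespace AlgBimod

variable {k K : Type u} [Field k] [CommRing K] [Algebra k K]

namespace DGStructure

open ChainAlgebra

variable {X Y : AlgBimod k K} (A : Y.DGStructure) (F : Y.Hom X)
  {ε : ChainAlgebra.Hom A.toChain (ofAlgebra K X.R)}

theorem triI_biFam (hF : ∀ x, F.alg x = ε.toAlg x) {n : ℕ} {f : X.BiFam} (hf : f ∈ X.biCochains n) :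
    A.triI (F.biFam f) = 0 := by
  funext p q a x
  change (-1 : ℤ) ^ (p + q) •
    (∑ i : Fin q, F.mod (f p q a fun j => F.alg (A.toChain.slotL i j (x j)))) = 0
  rw [Finset.sum_eq_zero fun i _ => ?_, smul_zero]
  rw [((hf p q).1 a).eq_zero _ i, map_zero]
  simp [slotL, hF, ε.aug_d]

theorem biFam_mem (hF : ∀ x, F.alg x = ε.toAlg x) (n : ℕ) (f : X.BiFam)
    (hf : f ∈ X.biCochains n) : F.biFam f ∈ A.triCochains n := by
  intro p q
  obtain ⟨h1, h2, -⟩ := F.biFam_mem n f hf p q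
  refine ⟨h1, h2, fun a e x hx h => ?_⟩
  change F.mod (f p q a fun j => F.alg (x j)) = 0
  by_cases hq : p + q = n
  · have : ∃ j, e j ≠ 0 := by
      by_contra! h'
      simp [h', hq] at h
    obtain ⟨j, hj⟩ := this
    rw [((hf p q).1 a).eq_zero _ j ((hF _).trans (ε.aug_of_pos hj (hx j))), map_zero]
  · rw [(hf p q).2.2 hq]
    exact map_zero _

theorem biFam_comm (hF : ∀ x, F.alg x = ε.toAlg x) (n : ℕ) (f : X.BiFam)
    (hf : f ∈ X.biCochains n) : A.triD (F.biFam f) = F.biFam (X.biD f) := by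
  rw [triD, LinearMap.add_apply, A.triI_biFam F hF hf, add_zero, F.biFam_comm]

variable {A} (c : Contraction k ε)

/-- The contraction in the direction of the differential of `A`. -/
noncomputable def slotHomotopy : Y.BiFam →ₗ[K] Y.BiFam where
  toFun f p q a x := (-1 : ℤ) ^ (p + q) • ∑ i : Fin q, f p q a fun j => c.slot i j (x j)
  map_add' f g := by
    funext p q a x
    simp [Finset.sum_add_distrib]
  map_smul' r f := by
    funext p q a x
    simp only [Pi.smul_apply, RingHom.id_apply, ← Finset.smul_sum]
    exact smul_comm _ _ _

theorem slotHomotopy_apply (f : Y.BiFam) (p q : ℕ) (a : Fin p → Fin q → K) (x : Fin q → Y.R) :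
    slotHomotopy c f p q a x =
      (-1 : ℤ) ^ (p + q) • ∑ i : Fin q, f p q a fun j => c.slot i j (x j) := rfl

theorem slotHomotopy_eq_zero {f : Y.BiFam} {p q : ℕ} (h : f p q = 0) :
    slotHomotopy c f p q = 0 := by
  funext a x
  simp [slotHomotopy_apply, h]

theorem slotHomotopy_mem {n : ℕ} {f : Y.BiFam} (hf : f ∈ A.triCochains (n + 1)) :
    slotHomotopy c f ∈ A.triCochains n := by
  intro p q
  obtain ⟨h1, h2, h3⟩ := hf p q
  refine ⟨fun a => IsMultilin.zsmul (IsMultilin.sum (s := Finset.univ)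
      (f := fun i x => f p q a fun j => c.slot i j (x j)) fun i =>
        (h1 a).comp_linear fun j => c.slot i j) _,
    fun r => IsMultilin.zsmul (IsMultilin.sum (s := Finset.univ)
      (f := fun i x => f p q (fun i j => x (i, j)) fun j => c.slot i j (r j)) fun i => h2 _) _,
    fun a e x hx h => ?_⟩
  rw [slotHomotopy_apply, Finset.sum_eq_zero fun i _ => ?_, smul_zero]
  refine h3 a (Function.update e i (e i + 1)) _ (fun j => ?_) ?_
  · rcases lt_trichotomy j i with hj | hj | hj
    · simpa [Contraction.slot, hj, hj.ne] using A.toChain.sgn_mem (hx j)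
    · subst hj
      simpa [Contraction.slot] using c.h_mem _ _ (hx j)
    · simpa [Contraction.slot, hj.not_gt, hj.ne'] using c.e_mem _ _ (hx j)
  · have h1 := Finset.sum_update_of_mem (Finset.mem_univ i) e (e i + 1)
    have h2 := Finset.sum_update_of_mem (Finset.mem_univ i) e (e i)
    rw [Function.update_eq_self] at h2
    omega

theorem slotHomotopy_triI {n : ℕ} {f : Y.BiFam} (hf : f ∈ A.triCochains n) (p q : ℕ)
    (a : Fin p → Fin q → K) (x : Fin q → Y.R) :
    A.triI (slotHomotopy c f) p q a x + slotHomotopy c (A.triI f) p q a x =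
      f p q a x - f p q a fun j => c.e (x j) := by
  have h : ∀ m : Y.M, (-1 : ℤ) ^ (p + q) • (-1 : ℤ) ^ (p + q) • m = m := fun m => by
    rw [smul_smul, ← mul_pow]; simp
  rw [← c.sum_slot ((hf p q).1 a) x, add_comm]
  change (-1 : ℤ) ^ (p + q) • (∑ i : Fin q, (-1 : ℤ) ^ (p + q) • ∑ l : Fin q,
      f p q a fun j => A.toChain.slotL l j (c.slot i j (x j))) +
    (-1 : ℤ) ^ (p + q) • (∑ i : Fin q, (-1 : ℤ) ^ (p + q) • ∑ l : Fin q,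
      f p q a fun j => c.slot l j (A.toChain.slotL i j (x j))) = _
  rw [← Finset.smul_sum, ← Finset.smul_sum, h, h]

include c in
/-- The complex `K ^ ***(K, A, M)` does not change under weak equivalences of `A`. -/
theorem isIso_biFam (hF : ∀ x, F.alg x = ε.toAlg x) (hmod : Function.Bijective F.mod) (n : ℕ) :
    IsIso (HomologicalComplex.homologyMap
      (subComplexMap F.biFam (A.biFam_mem F hF) (A.biFam_comm F hF) :
        X.biComplex ⟶ A.triComplex) n) := by
  have key := isIso_homologyMap_subComplexMap (hD := X.biD_mem) (hDD := fun _ f _ => X.biD_sq f)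
    (hD' := A.triD_mem) (hDD' := A.triD_sq) F.biFam (A.biFam_mem F hF) (A.biFam_comm F hF)
    (slotHomotopy c)
  have hmem : ∀ n, ∀ f ∈ A.triCochains (n + 1), slotHomotopy c f ∈ A.triCochains n :=
    fun n f hf => slotHomotopy_mem c hf
  have hH0 : ∀ f ∈ A.triCochains 0, slotHomotopy c f = 0 := by
    intro f hf
    funext p q
    -- A cochain of degree 0 lives at `p = q = 0`, where the sum over slots is empty.
    rcases Nat.eq_zero_or_pos (p + q) with h | h
    · obtain ⟨rfl, rfl⟩ : p = 0 ∧ q = 0 := by omega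
      funext a x
      simp [slotHomotopy_apply]
    · exact slotHomotopy_eq_zero c (A.triCochains_eq_zero hf h)
  refine key (fun n x _ hx => ?_) hmem hH0 (fun n x hx => ?_)
    -- Here the filtration is by the degree `n - p - q` in $A$, which is at most `j` on step `j`.
    -- Step `n` is everything.
    (fun n j f => ∀ p q, p + q + j < n → f p q = 0)
    (fun n => ⟨n, fun f hf p q h => by omega⟩)
    (fun n j f hf h p q hp => ?_) (fun n f hf h => ?_) n
  · funext p q a r
    have h0 : F.biFam x p q a (fun j => c.s (r j)) = 0 := by rw [hx]; rfl
    change F.mod (x p q a fun j => F.alg (c.s (r j))) = 0 at h0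
    simp only [hF, c.aug_s] at h0
    exact (map_eq_zero_iff _ hmod.1).1 h0
  · funext p q a y
    rw [slotHomotopy_apply, Finset.sum_eq_zero fun i _ => ?_, smul_zero]
    · rfl
    change F.mod (x p q a fun j => F.alg (c.slot i j (y j))) = 0
    rw [((hx p q).1 a).eq_zero _ i, map_zero]
    simp [Contraction.slot, hF, c.aug_h]
  -- At such `(p, q)` all terms with `biH` or `biV` come from smaller `p' + q'`, where `f` vanishes.
  -- The contraction of the third direction removes `f` up to its composition with `e`, which
  -- vanishes because `e` takes values in degree 0.
  · have h1 : ∀ p' q', p' + q' < p + q → f p' q' = 0 := fun p' q' h' => h p' q' (by omega)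
    have h2 : ∀ p' q', p' + q' < p + q → slotHomotopy c f p' q' = 0 := fun p' q' h' =>
      slotHomotopy_eq_zero c (h1 _ _ h')
    have e1 : Y.biH (slotHomotopy c f) p q = 0 := biH_eq_zero fun p' h' => h2 _ _ (by omega)
    have e2 : Y.biV (slotHomotopy c f) p q = 0 := biV_eq_zero fun p' h' => h2 _ _ (by omega)
    have e3 : slotHomotopy c (Y.biH f) p q = 0 := slotHomotopy_eq_zero c
      (biH_eq_zero fun p' h' => h1 _ _ (by omega))
    have e4 : slotHomotopy c (Y.biV f) p q = 0 := slotHomotopy_eq_zero c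
      (biV_eq_zero fun p' h' => h1 _ _ (by omega))
    funext a x
    have e5 := slotHomotopy_triI c hf p q a x
    rw [(hf p q).2.2 a (fun _ => 0) (fun j => c.e (x j)) (fun j => c.s_mem _)
      (by rw [Finset.sum_const_zero]; omega), sub_zero] at e5
    simp only [triD, biD, LinearMap.add_apply, map_add, Pi.add_apply, Pi.sub_apply, e1, e2, e3, e4,
      Pi.zero_apply, zero_add]
    rw [← e5]
    abel
  -- Now `f` is concentrated in degree 0 of $A$. The homotopy preserves `p` and `q` and lowers the
  -- total degree, so it kills `f`, `biH f` and `biV f`; what remains is `f` composed with `e = s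
  -- ε`, the pullback of `f` composed with `s`.
  · have hsupp : ∀ p q, p + q < n → f p q = 0 := fun p q h' => h p q h'
    have h0 : slotHomotopy c f = 0 := by
      rcases n with _ | n
      · exact hH0 f hf
      · funext p q
        rcases lt_or_ge (p + q) (n + 1) with h' | h'
        · exact slotHomotopy_eq_zero c (hsupp p q h')
        · exact A.triCochains_eq_zero (hmem n f hf) h'
    have hB : ∀ g ∈ A.triCochains (n + 1), (∀ p q, p + q ≤ n → g p q = 0) →
        slotHomotopy c g = 0 := by
      intro g hg hg'
      funext p q
      rcases le_or_gt (p + q) n with h' | h'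
      · exact slotHomotopy_eq_zero c (hg' p q h')
      · exact A.triCochains_eq_zero (hmem n g hg) h'
    have h1 : slotHomotopy c (Y.biH f) = 0 := hB _ (A.biH_mem_triCochains hf) fun p q h' =>
      biH_eq_zero fun p' _ => hsupp _ _ (by omega)
    have h2 : slotHomotopy c (Y.biV f) = 0 := hB _ (A.biV_mem_triCochains hf) fun p q h' =>
      biV_eq_zero fun p' _ => hsupp _ _ (by omega)
    let μ := LinearEquiv.ofBijective F.mod hmod
    refine ⟨fun p q a r => μ.symm (f p q a fun j => c.s (r j)), fun p q => ⟨fun a => ?_,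
      fun r => ?_, fun hpq => ?_⟩, ?_⟩
    · exact (((hf p q).1 a).comp_linear fun _ => c.s).comp (μ.symm.toLinearMap.restrictScalars k)
    · exact ((hf p q).2.1 _).comp (μ.symm.toLinearMap.restrictScalars k)
    · funext a r
      have : f p q = 0 := by
        rcases lt_or_gt_of_ne hpq with h' | h'
        · exact hsupp p q h'
        · exact A.triCochains_eq_zero hf h'
      change μ.symm (f p q a fun j => c.s (r j)) = 0
      rw [this]
      exact map_zero _
    · rw [h0, map_zero, sub_zero]
      simp only [triD, biD, LinearMap.add_apply, map_add, h1, h2, zero_add]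
      funext p q a x
      have e5 := slotHomotopy_triI c hf p q a x
      rw [h0, map_zero, Pi.zero_apply, Pi.zero_apply, Pi.zero_apply, Pi.zero_apply, zero_add] at e5
      change F.mod (μ.symm (f p q a fun j => c.s (F.alg (x j)))) =
        f p q a x - slotHomotopy c (A.triI f) p q a x
      rw [e5, sub_sub_cancel]
      refine (μ.apply_symm_apply _).trans ?_
      simp only [hF]
      rfl

end DGStructure

end AlgBimod

theorem subComplexMap_comp_eq {K : Type u} [CommRing K] {P P₁ P₂ P' : Type u} [AddCommGroup P]
    [Module K P] [AddCommGroup P₁] [Module K P₁] [AddCommGroup P₂] [Module K P₂]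
    [AddCommGroup P'] [Module K P']
    {C : ℕ → Submodule K P} {D : P →ₗ[K] P} {hD : ∀ n, ∀ f ∈ C n, D f ∈ C (n + 1)}
    {hDD : ∀ n, ∀ f ∈ C n, D (D f) = 0}
    {C₁ : ℕ → Submodule K P₁} {D₁ : P₁ →ₗ[K] P₁} {hD₁ : ∀ n, ∀ f ∈ C₁ n, D₁ f ∈ C₁ (n + 1)}
    {hDD₁ : ∀ n, ∀ f ∈ C₁ n, D₁ (D₁ f) = 0}
    {C₂ : ℕ → Submodule K P₂} {D₂ : P₂ →ₗ[K] P₂} {hD₂ : ∀ n, ∀ f ∈ C₂ n, D₂ f ∈ C₂ (n + 1)}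
    {hDD₂ : ∀ n, ∀ f ∈ C₂ n, D₂ (D₂ f) = 0}
    {C' : ℕ → Submodule K P'} {D' : P' →ₗ[K] P'} {hD' : ∀ n, ∀ f ∈ C' n, D' f ∈ C' (n + 1)}
    {hDD' : ∀ n, ∀ f ∈ C' n, D' (D' f) = 0}
    {F₁ : P →ₗ[K] P₁} {hF₁ : ∀ n, ∀ f ∈ C n, F₁ f ∈ C₁ n}
    {hc₁ : ∀ n, ∀ f ∈ C n, D₁ (F₁ f) = F₁ (D f)}
    {F₂ : P →ₗ[K] P₂} {hF₂ : ∀ n, ∀ f ∈ C n, F₂ f ∈ C₂ n}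
    {hc₂ : ∀ n, ∀ f ∈ C n, D₂ (F₂ f) = F₂ (D f)}
    {G₁ : P₁ →ₗ[K] P'} {hG₁ : ∀ n, ∀ f ∈ C₁ n, G₁ f ∈ C' n}
    {hd₁ : ∀ n, ∀ f ∈ C₁ n, D' (G₁ f) = G₁ (D₁ f)}
    {G₂ : P₂ →ₗ[K] P'} {hG₂ : ∀ n, ∀ f ∈ C₂ n, G₂ f ∈ C' n}
    {hd₂ : ∀ n, ∀ f ∈ C₂ n, D' (G₂ f) = G₂ (D₂ f)}
    (h : ∀ n, ∀ f ∈ C n, G₁ (F₁ f) = G₂ (F₂ f)) :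
    (subComplexMap F₁ hF₁ hc₁ : subComplex C D hD hDD ⟶ subComplex C₁ D₁ hD₁ hDD₁) ≫
        (subComplexMap G₁ hG₁ hd₁ : _ ⟶ subComplex C' D' hD' hDD') =
      (subComplexMap F₂ hF₂ hc₂ : subComplex C D hD hDD ⟶ subComplex C₂ D₂ hD₂ hDD₂) ≫
        subComplexMap G₂ hG₂ hd₂ := by
  refine HomologicalComplex.hom_ext _ _ fun n => ?_
  refine ModuleCat.hom_ext (LinearMap.ext fun f => Subtype.ext ?_)
  exact h n _ f.2

/-! ### The two comparison maps of an augmented chain algebra -/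

namespace AlgBimod

open ChainAlgebra

variable {k K : Type u} [Field k] [CommRing K] [Algebra k K]

section Pullback

variable (X : AlgBimod k K) {A : ChainAlgebra K} (ε : ChainAlgebra.Hom A (ofAlgebra K X.R))

/-- The bimodule `M` over the algebra underlying a chain algebra `A` augmented to `R`. -/
noncomputable def pullback : AlgBimod k K :=
  letI : Algebra k A.carrier := Algebra.compHom A.carrier (algebraMap k K)
  letI : Module A.carrier X.M := Module.compHom X.M ε.toAlg.toRingHom
  letI : Module A.carrierᵐᵒᵖ X.M := Module.compHom X.M ε.toAlg.toRingHom.op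
  { R := A.carrier
    M := X.M
    towerR := IsScalarTower.of_algebraMap_eq fun _ => rfl
    bimodule := ⟨fun r s m => smul_comm (ε.toAlg r) (MulOpposite.op (ε.toAlg s.unop)) m⟩
    towerLeft := ⟨fun c r m => by
      change ε.toAlg (c • r) • m = c • ε.toAlg r • m
      rw [map_smul, smul_assoc]⟩
    towerRight := ⟨fun c r m => by
      change MulOpposite.op (ε.toAlg (c • r.unop)) • m = c • MulOpposite.op (ε.toAlg r.unop) • m
      rw [map_smul, MulOpposite.op_smul, smul_assoc]⟩ }

/-- The chain algebra structure on the algebra of `X.pullback ε`. -/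
noncomputable def pullbackDG : (X.pullback ε).DGStructure where
  gr := A.gr
  graded := A.graded
  d := A.d
  d_mem := A.d_mem
  d_zero := A.d_zero
  d_d := A.d_d
  leibniz := A.leibniz
  smul_of_pos n hn x hx m := by
    have h : ∀ m : X.M, ε.toAlg x • m = 0 := fun m => by rw [ε.aug_of_pos hn hx, zero_smul]
    exact h m
  op_smul_of_pos n hn x hx m := by
    have h : ∀ m : X.M, MulOpposite.op (ε.toAlg x) • m = 0 := fun m => by
      rw [ε.aug_of_pos hn hx, MulOpposite.op_zero, zero_smul]
    exact h m
  d_smul x m := by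
    have h : ∀ (x : A.carrier) (m : X.M), ε.toAlg (A.d x) • m = 0 := fun x m => by
      rw [ε.aug_d, zero_smul]
    exact h x m
  op_d_smul x m := by
    have h : ∀ (x : A.carrier) (m : X.M), MulOpposite.op (ε.toAlg (A.d x)) • m = 0 := fun x m => by
      rw [ε.aug_d, MulOpposite.op_zero, zero_smul]
    exact h x m

/-- The morphism of pairs given by the augmentation. -/
noncomputable def pullbackHom : (X.pullback ε).Hom X where
  alg := ε.toAlg
  mod := (LinearMap.id : X.M →ₗ[K] X.M)
  map_left _ _ := rfl
  map_right _ _ := rfl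

theorem chainD_eq_hochD : chainD X ε = (X.pullbackDG ε).hochD := by
  refine LinearMap.ext fun f => funext fun q => ?_
  rcases q with _ | q
  · rfl
  · rfl

/-- The total complex of `K ^ ***(K, A, M)`. -/
noncomputable abbrev triComplex : CochainComplex (ModuleCat.{u} K) ℕ :=
  (X.pullbackDG ε).triComplex

/-- The inclusion of the Hochschild complex of `A`. -/
noncomputable def alphaTri : chainComplex X ε ⟶ X.triComplex ε :=
  subComplexMap (X.pullback ε).alphaFam (X.pullbackDG ε).alphaFam_mem fun n f hf => by
    rw [chainD_eq_hochD]
    exact (X.pullbackDG ε).alphaFam_comm n f hf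

/-- The map induced by the augmentation. -/
noncomputable def biToTri : X.biComplex ⟶ X.triComplex ε :=
  subComplexMap (X.pullbackHom ε).biFam
    ((X.pullbackDG ε).biFam_mem (ε := ε) (X.pullbackHom ε) fun _ => rfl)
    ((X.pullbackDG ε).biFam_comm (ε := ε) (X.pullbackHom ε) fun _ => rfl)

theorem isIso_alphaTri (h : Module.Projective K A.carrier) (n : ℕ) :
    IsIso (HomologicalComplex.homologyMap (X.alphaTri ε) n) := by
  have : Module.Projective K (X.pullback ε).R := h
  exact (X.pullbackDG ε).isIso_alpha (hD := by rw [← chainD_eq_hochD]; exact chainD_mem X ε)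
    (hDD := by rw [← chainD_eq_hochD]; exact chainD_sq X ε) n

theorem isIso_biToTri (h : ε.IsWeakEquiv) (n : ℕ) :
    IsIso (HomologicalComplex.homologyMap (X.biToTri ε) n) := by
  obtain ⟨c⟩ := nonempty_contraction k (A := (X.pullbackDG ε).toChain) (ε := ε) h
  exact DGStructure.isIso_biFam (A := X.pullbackDG ε) (X.pullbackHom ε) c (fun _ => rfl)
    Function.bijective_id n

/-- The map from the Hochschild complex of `R` to that of `A`. -/
noncomputable def compareHom : X.hochComplex ⟶ chainComplex X ε :=
  subComplexMap (compareFam X ε) (compareFam_mem X ε) (compareFam_comm X ε)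

theorem alpha_comp_biToTri (n : ℕ) :
    X.alpha n ≫ HomologicalComplex.homologyMap (X.biToTri ε) n =
      HomologicalComplex.homologyMap (X.compareHom ε) n ≫
      HomologicalComplex.homologyMap (X.alphaTri ε) n := by
  have h : X.alphaHom ≫ X.biToTri ε = X.compareHom ε ≫ X.alphaTri ε := by
    refine subComplexMap_comp_eq fun n f _ => ?_
    funext p q a x
    rcases p with _ | p
    · rfl
    · rfl
  exact (HomologicalComplex.homologyMap_comp _ _ n).symm.trans
    ((congrArg (HomologicalComplex.homologyMap · n) h).trans
      (HomologicalComplex.homologyMap_comp _ _ n))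

end Pullback

/-! ### Naturality of the comparison maps -/

section Naturality

namespace DGStructure

variable {X Y : AlgBimod k K} {A : X.DGStructure} {B : Y.DGStructure} (F : X.Hom Y)
  {ψ : ChainAlgebra.Hom A.toChain B.toChain}

theorem biFam_mem_triCochains (hF : ∀ x, F.alg x = ψ.alg x) (n : ℕ) (f : Y.BiFam)
    (hf : f ∈ B.triCochains n) : F.biFam f ∈ A.triCochains n := by
  intro p q
  obtain ⟨h1, h2, h3⟩ := hf p q
  refine ⟨fun a => ((h1 a).comp_linear fun _ => F.alg.toLinearMap.restrictScalars k).comp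
      (F.mod.restrictScalars k),
    fun r => (h2 _).comp (F.mod.restrictScalars k), fun a e x hx h => ?_⟩
  change F.mod (f p q a fun j => F.alg (x j)) = 0
  rw [h3 a e _ (fun j => by rw [hF]; exact ψ.map_mem _ _ (hx j)) h, map_zero]

theorem triD_biFam (hF : ∀ x, F.alg x = ψ.alg x) (f : Y.BiFam) :
    A.triD (F.biFam f) = F.biFam (B.triD f) := by
  have hI : A.triI (F.biFam f) = F.biFam (B.triI f) := by
    funext p q a x
    have h : ∀ i : Fin q, (fun j => F.alg (A.toChain.slotL i j (x j))) =
        fun j => B.toChain.slotL i j (F.alg (x j)) := by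
      intro i
      funext j
      rw [hF, hF]
      simp only [slotL]
      split_ifs
      · exact ψ.map_sgn _
      · exact ψ.map_d _
      · rfl
    change (-1 : ℤ) ^ (p + q) •
        (∑ i : Fin q, F.mod (f p q a fun j => F.alg (A.toChain.slotL i j (x j)))) =
      F.mod ((-1 : ℤ) ^ (p + q) • ∑ i : Fin q, f p q a fun j => B.toChain.slotL i j (F.alg (x j)))
    rw [map_zsmul, map_sum]
    simp only [h]
  rw [triD, triD, LinearMap.add_apply, LinearMap.add_apply, F.biFam_comm, hI, map_add]

end DGStructure

variable {X Y : AlgBimod k K} (F : X.Hom Y) {A B : ChainAlgebra K}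
  {ε : ChainAlgebra.Hom A (ofAlgebra K X.R)} {η : ChainAlgebra.Hom B (ofAlgebra K Y.R)}
  (ψ : ChainAlgebra.Hom A B) (h : ∀ x, η.toAlg (ψ.alg x) = F.alg (ε.toAlg x))

/-- The morphism of pairs between pullbacks. -/
noncomputable def Hom.pullback : (X.pullback ε).Hom (Y.pullback η) where
  alg := ψ.alg
  mod := F.mod
  map_left r m := by
    have : ∀ (r : A.carrier) (m : Y.M), F.mod (η.toAlg (ψ.alg r) • m) = ε.toAlg r • F.mod m :=
      fun r m => by rw [h, F.map_left]
    exact this r m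
  map_right r m := by
    have : ∀ (r : A.carrier) (m : Y.M), F.mod (MulOpposite.op (η.toAlg (ψ.alg r)) • m) =
        MulOpposite.op (ε.toAlg r) • F.mod m := fun r m => by rw [h, F.map_right]
    exact this r m

/-- The induced map of total complexes. -/
noncomputable def Hom.triMap : Y.triComplex η ⟶ X.triComplex ε :=
  subComplexMap (F.pullback ψ h).biFam
    (DGStructure.biFam_mem_triCochains (A := X.pullbackDG ε) (B := Y.pullbackDG η) (ψ := ψ)
      (F.pullback ψ h) fun _ => rfl)
    (fun _ f _ => DGStructure.triD_biFam (A := X.pullbackDG ε) (B := Y.pullbackDG η) (ψ := ψ)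
      (F.pullback ψ h) (fun _ => rfl) f)

/-- The induced map of Hochschild complexes. -/
noncomputable def Hom.chainMap : chainComplex Y η ⟶ chainComplex X ε :=
  subComplexMap (mapFam F ψ) (mapFam_mem F ψ) (fun _ f _ => mapFam_comm F ψ h f)

theorem Hom.biToTri_comp_triMap (n : ℕ) :
    HomologicalComplex.homologyMap (Y.biToTri η) n ≫
        HomologicalComplex.homologyMap (F.triMap ψ h) n =
      F.biCohomologyMap n ≫ HomologicalComplex.homologyMap (X.biToTri ε) n := by
  have e : Y.biToTri η ≫ F.triMap ψ h = (subComplexMap F.biFam F.biFam_mem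
      fun _ f _ => F.biFam_comm f : Y.biComplex ⟶ X.biComplex) ≫ X.biToTri ε := by
    refine subComplexMap_comp_eq fun n f _ => ?_
    funext p q a x
    change F.mod (f p q a fun j => η.toAlg (ψ.alg (x j))) =
      F.mod (f p q a fun j => F.alg (ε.toAlg (x j)))
    exact congrArg (fun r => F.mod (f p q a r)) (funext fun j => h (x j))
  exact (HomologicalComplex.homologyMap_comp _ _ n).symm.trans
    ((congrArg (HomologicalComplex.homologyMap · n) e).trans
      (HomologicalComplex.homologyMap_comp _ _ n))

theorem Hom.alphaTri_comp_triMap (n : ℕ) :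
    HomologicalComplex.homologyMap (Y.alphaTri η) n ≫
        HomologicalComplex.homologyMap (F.triMap ψ h) n =
      HomologicalComplex.homologyMap (F.chainMap ψ h) n ≫
        HomologicalComplex.homologyMap (X.alphaTri ε) n := by
  have e : Y.alphaTri η ≫ F.triMap ψ h = F.chainMap ψ h ≫ X.alphaTri ε := by
    refine subComplexMap_comp_eq fun n f _ => ?_
    funext p q a x
    rcases p with _ | p
    · rfl
    · exact map_zero F.mod
  exact (HomologicalComplex.homologyMap_comp _ _ n).symm.trans
    ((congrArg (HomologicalComplex.homologyMap · n) e).trans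
      (HomologicalComplex.homologyMap_comp _ _ n))

end Naturality

end AlgBimod

/-! ### The case of projective $R$ -/

namespace AlgBimod

open ChainAlgebra

variable {k K : Type u} [Field k] [CommRing K] [Algebra k K]

section Projective

variable (X : AlgBimod k K)

/-- The identity of `R`, concentrated in degree zero. -/
noncomputable def idAug : ChainAlgebra.Hom (ofAlgebra K X.R) (ofAlgebra K X.R) where
  alg := AlgHom.id K X.R
  map_mem _ _ hx := hx
  map_d _ := rfl

theorem idAug_isWeakEquiv : X.idAug.IsWeakEquiv := by
  rw [Hom.isWeakEquiv_iff]
  exact ⟨fun x _ h => h, fun b _ => ⟨b, rfl, 0, (sub_self b).symm⟩⟩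

/-- For `R` concentrated in degree 0 the two Hochschild complexes have the same cochains, so the
homotopy 0 and the trivial filtration suffice. -/
theorem isIso_compareHom_idAug (n : ℕ) :
    IsIso (HomologicalComplex.homologyMap (X.compareHom X.idAug) n) := by
  refine isIso_homologyMap_subComplexMap (compareFam X X.idAug) (compareFam_mem X X.idAug)
    (compareFam_comm X X.idAug) 0 (fun n x _ hx => hx) (fun n f _ => zero_mem _) (fun _ _ => rfl)
    (fun _ _ _ => rfl) (fun _ _ _ => True) (fun _ => ⟨0, fun _ _ => trivial⟩)
    (fun _ _ _ _ _ => trivial) (fun n f hf _ => ⟨f, fun q => ⟨(hf q).1, fun h => ?_⟩, ?_⟩) n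
  · funext x
    exact (hf q).2 (fun _ => 0) x (fun _ => Submodule.mem_top) (by simpa using h)
  · simp only [LinearMap.zero_apply, map_zero, sub_zero]
    rfl

/-- The comparison maps need only projectivity and a weak equivalence, not cofibrancy, so `R` may
serve as its own resolution. The claim follows by two out of three in the commuting square. -/
theorem isIso_alpha_of_projective (h : Module.Projective K X.R) (n : ℕ) : IsIso (X.alpha n) := by
  have h1 := X.isIso_alphaTri X.idAug h n
  have h2 := X.isIso_biToTri X.idAug X.idAug_isWeakEquiv n
  have h3 := X.isIso_compareHom_idAug n
  have h4 : IsIso (X.alpha n ≫ HomologicalComplex.homologyMap (X.biToTri X.idAug) n) := by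
    rw [X.alpha_comp_biToTri]
    infer_instance
  exact IsIso.of_isIso_comp_right _ (HomologicalComplex.homologyMap (X.biToTri X.idAug) n)

end Projective

/-! ### Low degrees -/

section LowDegrees

variable {X : AlgBimod k K}

/-- In total degree at most 1 the only component outside the column 0 is at `(1, 0)`, where a
cochain is an element of `M` equal to its horizontal coboundary. Once it vanishes, the coboundary at
`(1, 1)` is `c f(r) - f(c r)`, whose vanishing is `K`-linearity. -/
theorem exists_alphaFam_eq {n : ℕ} (hn : n ≤ 1) {t : X.BiFam} (ht : t ∈ X.biCochains n)
    (h1 : ∀ q, X.biD t 1 q = 0) (h2 : X.biD t 2 0 = 0) :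
    ∃ x ∈ X.hochCochains n, X.alphaFam x = t := by
  have h10 : t 1 0 = 0 := by
    funext a r
    have h : X.horiz 1 0 (t 1 0) (fun _ _ => 0) r = 0 := by
      have := congrFun (congrFun h2 fun _ _ => 0) r
      rwa [show X.biD t 2 0 = X.horiz 1 0 (t 1 0) + 0 from rfl, add_zero] at this
    rw [horiz_apply] at h
    -- With no columns all arguments agree, so the three terms of the coboundary are `m - m + m =
    -- m`.
    have e : ∀ b s, t 1 0 b s = t 1 0 a r := fun b s =>
      congrArg₂ _ (Subsingleton.elim _ _) (Subsingleton.elim _ _)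
    simp only [e] at h
    simpa using h
  have hp : ∀ p q, t (p + 1) q = 0 := by
    intro p q
    by_cases h : p + 1 + q = n
    · obtain ⟨rfl, rfl⟩ : p = 0 ∧ q = 0 := by omega
      exact h10
    · exact (ht _ q).2.2 h
  refine ⟨fun q => t 0 q Fin.elim0, fun q => ⟨?_, fun h => ?_⟩, ?_⟩
  · by_cases hq : q = n
    · rcases (by omega : q = 0 ∨ q = 1) with rfl | rfl
      · exact IsMultilin.of_isEmpty _
      · obtain ⟨g, hg⟩ := (ht 0 1).1 Fin.elim0
        refine ⟨⟨t 0 1 Fin.elim0, fun r i v w => ?_, fun r i c v => ?_⟩, fun _ => rfl⟩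
        · rw [← hg, ← hg, ← hg]
          exact g.map_update_add' r i v w
        · have h : X.horiz 0 1 (t 0 1) (fun _ _ => c) (fun _ => v) = 0 := by
            have := congrFun (congrFun (h1 1) fun _ _ => c) fun _ => v
            rwa [show X.biD t 1 1 = X.horiz 0 1 (t 0 1) + (-1 : ℤ) ^ 1 • X.vert 1 0 (t 1 0) from rfl,
              h10, map_zero, smul_zero, add_zero] at this
          have e : ∀ w, Function.update r i w = fun _ => w := fun w => by
            funext j
            rw [Subsingleton.elim j i, Function.update_self]
          have e' : ∀ b : Fin 0 → Fin 1 → K, b = Fin.elim0 := fun b => Subsingleton.elim _ _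
          rw [horiz_apply, e' fun i : Fin 0 => _] at h
          rw [e, e]
          simp only [Fin.sum_univ_zero, add_zero, zero_add, pow_one, neg_one_smul, Finset.prod_const,
            Finset.card_univ, Fintype.card_fin] at h
          exact (add_neg_eq_zero.1 h).symm
    · change IsMultilin K (t 0 q Fin.elim0)
      rw [(ht 0 q).2.2 (by omega)]
      exact IsMultilin.zero
  · change t 0 q Fin.elim0 = 0
    rw [(ht 0 q).2.2 (by omega)]
    rfl
  · funext p q
    rcases p with _ | p
    · funext a r
      rw [Subsingleton.elim a Fin.elim0]
      rfl
    · exact (hp p q).symm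

theorem alphaFam_injective : Function.Injective X.alphaFam := fun f g h => by
  funext q r
  have h0 : X.alphaFam f 0 q Fin.elim0 r = X.alphaFam g 0 q Fin.elim0 r := by rw [h]
  exact h0

/-- A cochain of degree at most 1 whose coboundary is a Hochschild cochain is itself one, so it
bounds already in the Hochschild complex. -/
theorem mono_alpha {n : ℕ} (hn : n ≤ 2) : Mono (X.alpha n) := by
  refine mono_homologyMap_subComplexMap n fun x hx _ hb => ?_
  rcases n with _ | n
  · exact alphaFam_injective (hb.trans (map_zero _).symm)
  · obtain ⟨y, hy, hyx⟩ := hb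
    obtain ⟨z, hz, rfl⟩ := exists_alphaFam_eq (by omega) hy (fun q => by rw [hyx]; rfl)
      (by rw [hyx]; rfl)
    refine ⟨z, hz, alphaFam_injective ?_⟩
    rw [← hyx, X.alphaFam_comm n z hz]

/-- Cocycles of degree at most 1 are themselves Hochschild cochains. -/
theorem epi_alpha {n : ℕ} (hn : n ≤ 1) : Epi (X.alpha n) := by
  refine epi_homologyMap_subComplexMap n fun t ht hDt => ?_
  obtain ⟨x, hx, rfl⟩ := exists_alphaFam_eq hn ht (fun q => by rw [hDt]; rfl) (by rw [hDt]; rfl)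
  refine ⟨x, hx, alphaFam_injective ?_, ?_⟩
  · rw [← X.alphaFam_comm n x hx, hDt, map_zero]
  · rw [sub_self]
    rcases n with _ | n
    · rfl
    · exact ⟨0, zero_mem _, map_zero _⟩

theorem isIso_alpha {n : ℕ} (hn : n ≤ 1) : IsIso (X.alpha n) := by
  have := mono_alpha (X := X) (hn.trans one_le_two)
  have := epi_alpha (X := X) hn
  exact isIso_of_mono_of_epi _

end LowDegrees

/-! ### The isomorphism with Shukla cohomology -/

section Shukla

variable (X : AlgBimod k K) (Q : CofibrantReplacement K X.R) (n : ℕ)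

theorem isIso_alphaTri_aug : IsIso (HomologicalComplex.homologyMap (X.alphaTri Q.aug) n) :=
  X.isIso_alphaTri Q.aug Q.cofibrant.projective n

theorem isIso_biToTri_aug : IsIso (HomologicalComplex.homologyMap (X.biToTri Q.aug) n) :=
  X.isIso_biToTri Q.aug Q.weakEquiv n

/-- The isomorphism between the cohomology of the bicomplex and Shukla cohomology. -/
noncomputable def shuklaIso : X.biCohomology n ≅ shukla X Q n :=
  haveI := X.isIso_alphaTri_aug Q n
  haveI := X.isIso_biToTri_aug Q n
  asIso (HomologicalComplex.homologyMap (X.biToTri Q.aug) n) ≪≫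
    (asIso (HomologicalComplex.homologyMap (X.alphaTri Q.aug) n)).symm

/-- This characterises the isomorphism, because `alphaTri` is injective in cohomology; its
properties are checked after composition with that map. -/
theorem shuklaIso_hom_comp :
    (X.shuklaIso Q n).hom ≫ HomologicalComplex.homologyMap (X.alphaTri Q.aug) n =
      HomologicalComplex.homologyMap (X.biToTri Q.aug) n := by
  have := X.isIso_alphaTri_aug Q n
  simp [shuklaIso]

theorem alpha_comp_shuklaIso : X.alpha n ≫ (X.shuklaIso Q n).hom = hochToShukla X Q n := by
  have := X.isIso_alphaTri_aug Q n
  rw [← cancel_mono (HomologicalComplex.homologyMap (X.alphaTri Q.aug) n), Category.assoc,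
    shuklaIso_hom_comp]
  exact X.alpha_comp_biToTri Q.aug n

variable {X} {Y : AlgBimod k K} (F : X.Hom Y) {Q} {Q' : CofibrantReplacement K Y.R}
  (ψ : ChainAlgebra.Hom Q.alg Q'.alg) (h : ∀ x, Q'.aug.toAlg (ψ.alg x) = F.alg (Q.aug.toAlg x))

/-- After composition with `alphaTri` this follows from the naturality squares of `alphaTri` and
`biToTri`. -/
theorem shuklaIso_naturality :
    (Y.shuklaIso Q' n).hom ≫ shuklaMap F ψ h n = F.biCohomologyMap n ≫ (X.shuklaIso Q n).hom := by
  have := X.isIso_alphaTri_aug Q n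
  rw [← cancel_mono (HomologicalComplex.homologyMap (X.alphaTri Q.aug) n), Category.assoc,
    Category.assoc, shuklaIso_hom_comp]
  refine Eq.trans ?_ (F.biToTri_comp_triMap ψ h n)
  rw [← shuklaIso_hom_comp, Category.assoc, F.alphaTri_comp_triMap ψ h n]
  rfl

end Shukla

end AlgBimod

theorem mainTheorem6 {k K : Type u} [Field k] [CommRing K] [Algebra k K] :
    -- `α ^ 0`, `α ^ 1` are isomorphisms and `α ^ 2` is a monomorphism
    (∀ X : AlgBimod k K, IsIso (X.alpha 0) ∧ IsIso (X.alpha 1) ∧ Mono (X.alpha 2)) ∧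
    -- `α ^ n` is an isomorphism for all `n` if `R` is projective over `K`
    (∀ X : AlgBimod k K, Module.Projective K X.R → ∀ n, IsIso (X.alpha n)) ∧
    -- Shukla cohomology is defined for every `R`, and it is canonically isomorphic to the
    -- cohomology of the bicomplex
    (∀ X : AlgBimod k K, Nonempty (ChainAlgebra.CofibrantReplacement K X.R)) ∧
    ∃ θ : ∀ (X : AlgBimod k K) (Q : ChainAlgebra.CofibrantReplacement K X.R) (n : ℕ),
        X.biCohomology n ≅ shukla X Q n,
      (∀ (X : AlgBimod k K) (Q : ChainAlgebra.CofibrantReplacement K X.R) (n : ℕ),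
        X.alpha n ≫ (θ X Q n).hom = hochToShukla X Q n) ∧
      (∀ (X Y : AlgBimod k K) (F : X.Hom Y) (Q : ChainAlgebra.CofibrantReplacement K X.R)
        (Q' : ChainAlgebra.CofibrantReplacement K Y.R) (ψ : ChainAlgebra.Hom Q.alg Q'.alg)
        (h : ∀ x, Q'.aug.toAlg (ψ.alg x) = F.alg (Q.aug.toAlg x)) (n : ℕ),
        (θ Y Q' n).hom ≫ shuklaMap F ψ h n = F.biCohomologyMap n ≫ (θ X Q n).hom) :=
  ⟨fun _ => ⟨AlgBimod.isIso_alpha zero_le_one, AlgBimod.isIso_alpha le_rfl,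
      AlgBimod.mono_alpha le_rfl⟩,
    fun X h n => X.isIso_alpha_of_projective h n,
    fun X => nonempty_cofibrantReplacement X.R,
    fun X Q n => X.shuklaIso Q n,
    fun X Q n => X.alpha_comp_shuklaIso Q n,
    fun _ _ F _ _ ψ h n => AlgBimod.shuklaIso_naturality n F ψ h⟩
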